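/- All operads are symmetric and unital, with operations of arities $n\in\mathbb N=\{1,2,\dots\}$, over a field $\mathbb K$; "$=$" between operads, resp. between posets, is read as the explicit canonical isomorphism given below. **Definitions.** The linearization $\langle P\rangle$ of a set operad $P$ is the algebraic operad $\langle P\rangle(n)=\mathbb K[P_n]$ with structure maps extended (multi)linearly. The Hadamard product $P\times_H Q$ of set operads has $(P\times_HQ)_n=P_n\times Q_n$ with componentwise structure maps. Let $\mathcal O=\mathcal F(V)/(R)$ be a binary quadratic operad: $V$ is an $\mathbb S_2$-module placed in arity $2$ and $R\subset\mathcal F(V)(3)$, where $\mathcal F(V)(3)=(V\otimes V)^{3}$ is spanned by the trees with an upper vertex $v$ and a lower vertex $w$ (the root) and leaves labelled from left to right by $(1,2,3)$, $(2,3,1)$ or $(3,1,2)$. Let $V_\circ,V_\bullet$ be two copies of $V$. Then ${}^{tc}\mathcal O$ is the binary quadratic operad with generators $V_\circ\oplus V_\bullet$ and relations: $R$ with both vertices decorated in $V_\circ$; $R$ with both vertices decorated in $V_\bullet$; for all $v,w\in V$ and each of the three leaf labellings, (tree with $v_\circ$ above $w_\bullet$) $-$ (tree with $v_\bullet$ above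 $w_\circ$); and $R$ with the upper vertex decorated in $V_\circ$ and the lower one in $V_\bullet$. In particular ${}^{tc}\mathcal Com$ is obtained from $\mathcal Com$ (one symmetric product, with the associativity relations). The set operad ${}^{tc}Com$ has $({}^{tc}Com)_n=\{D^n_0,\dots,D^n_{n-1}\}$ with trivial $\mathbb S_n$-action, unit $D^1_0$ and composition $\mu(D^n_i;D^{m_1}_{i_1},\dots,D^{m_n}_{i_n})=D^{m_1+\dots+m_n}_{i+i_1+\dots+i_n}$ ($i$ counts the white products $\circ$). For a set operad $P$, $\Pi_P(n)$ is the set of partitions of $[n]$ each of whose blocks $B$ is decorated by an element of $P_{|B|}$. One has $\alpha\le\beta$ if the underlying partition of $\alpha$ refines that of $\beta$ and, whenever a block $B$ of $\beta$ with decoration $q$ is the union $A_1\cup\dots\cup A_t$ of blocks of $\alpha$ with decorations $p_1,\dots,p_t$, there is $p\in P_t$ with $q=\mu(p;p_1,\dots,p_t)\sigma^{-1}$, where $\sigma$ is the permutation whose two-line notation has as top row the elements of $B$ in ascending order and as bottom row the elements of $A_1$ in ascending order, then those of $A_2$, etc. Let $\Pi_P(n)\to\Pi_n$ be the forgetful map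 to the partitions of $[n]$ ordered by refinement. For posets $A\to S\leftarrow B$, $A\times_SB$ is the fiber product with the componentwise order. If an algebraic operad is the linearization of a set operad $Q$, then $\Pi$ of it means $\Pi_Q$. **Theorem.** Let $\mathcal O=\mathcal F(V)/(R)$ be a binary quadratic operad over $\mathbb K$ which is the linearization of a set operad $P$, via an isomorphism $\varphi\colon\mathcal O\cong\langle P\rangle$. Then: 0. The algebraic operad ${}^{tc}\mathcal Com$ is the linearization of the set operad ${}^{tc}Com$, by an isomorphism sending the white product to $D^2_1$ and the black product to $D^2_0$. 1. ${}^{tc}\mathcal O=\langle P\times_H{}^{tc}Com\rangle$: there is an isomorphism of operads $\psi\colon{}^{tc}\mathcal O\cong\langle P\times_H{}^{tc}Com\rangle$ such that, for $v\in V$, if $\varphi(v)=\sum_pc_p\,p$, then $\psi(v_\circ)=\sum_pc_p\,(p,D^2_1)$ and $\psi(v_\bullet)=\sum_pc_p\,(p,D^2_0)$. 2. Consequently $\Pi_{{}^{tc}\mathcal O}:=\Pi_{P\times_H{}^{tc}Com}=\Pi_P\times_\Pi\Pi_{{}^{tc}Com}$: for every $n\ge1$ the map which sends a decorated partition to the pair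 of decorated partitions obtained by taking the first, resp. the second, components of all decorations is an order isomorphism $\Pi_{P\times_H{}^{tc}Com}(n)\cong\Pi_P(n)\times_{\Pi_n}\Pi_{{}^{tc}Com}(n)$. -/

import Mathlib

open scoped TensorProduct

universe u v w

noncomputable section

/-! ## Set operads -/

/-- The inputs of a composite `μ(p; p₁, …, p_k)`, grouped into consecutive blocks: the `j`-th input
of `pᵢ` is the input number `m₁ + ⋯ + mᵢ₋₁ + j` of the composite. -/
def blockEquiv {k : ℕ} (m : Fin k → ℕ+) {n : ℕ+} (h : ∑ i, (m i : ℕ) = n) :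
    (Σ i : Fin k, Fin (m i)) ≃ Fin n :=
  finSigmaFinEquiv.trans (finCongr h)

/-- The block permutation induced by `τ`: it moves the `i`-th block (of size `m (τ i)`) to the
`τ i`-th place. -/
def blockPerm {k : ℕ} (τ : Equiv.Perm (Fin k)) (m : Fin k → ℕ+) {n : ℕ+}
    (h : ∑ i, (m i : ℕ) = n) (h' : ∑ i, (m (τ i) : ℕ) = n) : Equiv.Perm (Fin n) :=
  (blockEquiv (fun i => m (τ i)) h').symm.trans
    ((Equiv.sigmaCongrLeft (β := fun i => Fin (m i)) τ).trans (blockEquiv m h))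

/-- The direct sum `σ₁ ⊕ ⋯ ⊕ σ_k`, permuting each block separately. -/
def sumPerm {k : ℕ} (m : Fin k → ℕ+) {n : ℕ+} (h : ∑ i, (m i : ℕ) = n)
    (σ : ∀ i, Equiv.Perm (Fin (m i))) : Equiv.Perm (Fin n) :=
  (blockEquiv m h).symm.trans ((Equiv.sigmaCongrRight σ).trans (blockEquiv m h))

/-- A (symmetric, unital) set operad, with operations of arities `1, 2, 3, …`.
`act` is the right action of the symmetric groups, `comp m h p q` is the composite
`μ(p; q₁, …, q_k)`, where `qᵢ` has arity `mᵢ` and `m₁ + ⋯ + m_k = n`. -/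
structure SetOperad where
  obj : ℕ+ → Type u
  act : ∀ {n : ℕ+}, obj n → Equiv.Perm (Fin n) → obj n
  one : obj 1
  comp : ∀ {k n : ℕ+} (m : Fin k → ℕ+), ∑ i, (m i : ℕ) = n → obj k → (∀ i, obj (m i)) → obj n
  act_one : ∀ {n : ℕ+} (x : obj n), act x 1 = x
  act_mul : ∀ {n : ℕ+} (x : obj n) (σ τ : Equiv.Perm (Fin n)), act x (σ * τ) = act (act x σ) τ
  one_comp : ∀ {n : ℕ+} (h : ∑ _ : Fin (1 : ℕ+), (n : ℕ) = n) (x : obj n),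
    comp (fun _ : Fin (1 : ℕ+) => n) h one (fun _ => x) = x
  comp_one : ∀ {n : ℕ+} (h : ∑ _ : Fin n, ((1 : ℕ+) : ℕ) = n) (x : obj n),
    comp (fun _ => 1) h x (fun _ => one) = x
  comp_assoc : ∀ {k n N : ℕ+} (a : Fin k → ℕ+) (ha : ∑ i, (a i : ℕ) = n)
    (b : ∀ i, Fin (a i) → ℕ+) (s : Fin k → ℕ+) (hb : ∀ i, ∑ j, (b i j : ℕ) = s i)
    (hs : ∑ i, (s i : ℕ) = N)
    (hN : ∑ l, (b ((blockEquiv a ha).symm l).1 ((blockEquiv a ha).symm l).2 : ℕ) = N)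
    (p : obj k) (q : ∀ i, obj (a i)) (r : ∀ i j, obj (b i j)),
    comp (fun l => b ((blockEquiv a ha).symm l).1 ((blockEquiv a ha).symm l).2) hN (comp a ha p q)
        (fun l => r ((blockEquiv a ha).symm l).1 ((blockEquiv a ha).symm l).2)
      = comp s hs p (fun i => comp (b i) (hb i) (q i) (r i))
  comp_act_left : ∀ {k n : ℕ+} (m : Fin k → ℕ+) (h : ∑ i, (m i : ℕ) = n)
    (τ : Equiv.Perm (Fin k)) (h' : ∑ i, (m (τ i) : ℕ) = n) (p : obj k) (q : ∀ i, obj (m i)),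
    comp (fun i => m (τ i)) h' (act p τ) (fun i => q (τ i)) =
      act (comp m h p q) (blockPerm τ m h h')
  comp_act_right : ∀ {k n : ℕ+} (m : Fin k → ℕ+) (h : ∑ i, (m i : ℕ) = n)
    (σ : ∀ i, Equiv.Perm (Fin (m i))) (p : obj k) (q : ∀ i, obj (m i)),
    comp m h p (fun i => act (q i) (σ i)) = act (comp m h p q) (sumPerm m h σ)

/-- The Hadamard product of two set operads. -/
def SetOperad.hadamard (P : SetOperad.{u}) (Q : SetOperad.{v}) : SetOperad.{max u v} where
  obj n := P.obj n × Q.obj n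
  act x σ := (P.act x.1 σ, Q.act x.2 σ)
  one := (P.one, Q.one)
  comp m h p q := (P.comp m h p.1 fun i => (q i).1, Q.comp m h p.2 fun i => (q i).2)
  act_one x := by simp [P.act_one, Q.act_one]
  act_mul x σ τ := by simp [P.act_mul, Q.act_mul]
  one_comp h x := Prod.ext (P.one_comp h x.1) (Q.one_comp h x.2)
  comp_one h x := by simp [P.comp_one, Q.comp_one]
  comp_assoc a ha b s hb hs hN p q r := Prod.ext
    (P.comp_assoc a ha b s hb hs hN p.1 (fun i => (q i).1) (fun i j => (r i j).1))
    (Q.comp_assoc a ha b s hb hs hN p.2 (fun i => (q i).2) (fun i j => (r i j).2))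
  comp_act_left m h τ h' p q := Prod.ext
    (P.comp_act_left m h τ h' p.1 fun i => (q i).1) (Q.comp_act_left m h τ h' p.2 fun i => (q i).2)
  comp_act_right m h σ p q := Prod.ext
    (P.comp_act_right m h σ p.1 fun i => (q i).1) (Q.comp_act_right m h σ p.2 fun i => (q i).2)

/-! ## Algebraic operads -/

/-- An algebraic operad over `K`: the `n`-ary operations form a vector space on which the symmetric
group acts linearly, and composition is multilinear. -/
structure AlgOperad (K : Type v) [Field K] extends SetOperad.{u} where
  [addCommGroup : ∀ n, AddCommGroup (obj n)]
  [module : ∀ n, Module K (obj n)]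
  act_add : ∀ {n : ℕ+} (x y : obj n) (σ : Equiv.Perm (Fin n)),
    act (x + y) σ = act x σ + act y σ
  act_smul : ∀ {n : ℕ+} (c : K) (x : obj n) (σ : Equiv.Perm (Fin n)),
    act (c • x) σ = c • act x σ
  comp_add_left : ∀ {k n : ℕ+} (m : Fin k → ℕ+) (h : ∑ i, (m i : ℕ) = n) (p p' : obj k)
    (q : ∀ i, obj (m i)), comp m h (p + p') q = comp m h p q + comp m h p' q
  comp_smul_left : ∀ {k n : ℕ+} (m : Fin k → ℕ+) (h : ∑ i, (m i : ℕ) = n) (c : K) (p : obj k)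
    (q : ∀ i, obj (m i)), comp m h (c • p) q = c • comp m h p q
  comp_update_add : ∀ {k n : ℕ+} (m : Fin k → ℕ+) (h : ∑ i, (m i : ℕ) = n) (p : obj k)
    (q : ∀ i, obj (m i)) (i : Fin k) (x y : obj (m i)),
    comp m h p (Function.update q i (x + y)) =
      comp m h p (Function.update q i x) + comp m h p (Function.update q i y)
  comp_update_smul : ∀ {k n : ℕ+} (m : Fin k → ℕ+) (h : ∑ i, (m i : ℕ) = n) (p : obj k)
    (q : ∀ i, obj (m i)) (i : Fin k) (c : K) (x : obj (m i)),
    comp m h p (Function.update q i (c • x)) = c • comp m h p (Function.update q i x)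

attribute [instance] AlgOperad.addCommGroup AlgOperad.module

/-- An isomorphism of algebraic operads. -/
structure AlgOperad.Iso {K : Type w} [Field K] (O : AlgOperad.{u} K) (Q : AlgOperad.{v} K) where
  toEquiv : ∀ n, O.obj n ≃ₗ[K] Q.obj n
  map_one : toEquiv 1 O.one = Q.one
  map_act : ∀ {n : ℕ+} (x : O.obj n) (σ : Equiv.Perm (Fin n)),
    toEquiv n (O.act x σ) = Q.act (toEquiv n x) σ
  map_comp : ∀ {k n : ℕ+} (m : Fin k → ℕ+) (h : ∑ i, (m i : ℕ) = n) (p : O.obj k)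
    (q : ∀ i, O.obj (m i)),
    toEquiv n (O.comp m h p q) = Q.comp m h (toEquiv k p) fun i => toEquiv (m i) (q i)

/-! ## The linearization of a set operad -/

/-- The multilinear extension of `f` to formal linear combinations. -/
def linComp (K : Type w) [Field K] {α : Type u} {k : ℕ} {β : Fin k → Type u} {γ : Type u}
    (f : α → (∀ i, β i) → γ) (p : α →₀ K) (q : ∀ i, β i →₀ K) : γ →₀ K :=
  Finsupp.linearCombination K (fun a =>
    ∑ y ∈ Fintype.piFinset (fun i => (q i).support),
      Finsupp.single (f a y) (∏ i, q i (y i))) p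

/-- Multilinearity, stated without `Function.update`. -/
def IsML (K : Type w) [Field K] {ι : Type*} {β : ι → Type*} [∀ i, AddCommGroup (β i)]
    [∀ i, Module K (β i)] {M : Type*} [AddCommGroup M] [Module K M] (F : (∀ i, β i) → M) : Prop :=
  ∀ (i : ι) (q q' q'' : ∀ i, β i) (c c' : K), (∀ j, j ≠ i → q j = q'' j ∧ q' j = q'' j) →
    (∀ j, j = i → q'' j = c • q j + c' • q' j) → F q'' = c • F q + c' • F q'

section
variable {K : Type w} [Field K]

theorem IsML.ext {ι : Type*} [Finite ι] {β : ι → Type*} {M : Type*} [AddCommGroup M] [Module K M]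
    {F G : (∀ i, β i →₀ K) → M} (hF : IsML K F) (hG : IsML K G)
    (h : ∀ y : ∀ i, β i, F (fun i => Finsupp.single (y i) 1) = G (fun i => Finsupp.single (y i) 1))
    (q : ∀ i, β i →₀ K) : F q = G q := by
  classical
  have key : ∀ {F : (∀ i, β i →₀ K) → M}, IsML K F →
      ∃ F' : MultilinearMap K (fun i => β i →₀ K) M, ⇑F' = F := by
    intro F hF
    refine ⟨MultilinearMap.mk' F ?_ ?_, rfl⟩
    · intro q i x y
      have := hF i (Function.update q i x) (Function.update q i y) (Function.update q i (x + y)) 1 1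
        (fun j hj => by simp [hj]) (fun j hj => by subst hj; simp)
      simpa using this
    · intro q i c x
      have := hF i (Function.update q i x) (Function.update q i x) (Function.update q i (c • x)) c 0
        (fun j hj => by simp [hj]) (fun j hj => by subst hj; simp)
      simpa using this
  obtain ⟨F', rfl⟩ := key hF
  obtain ⟨G', rfl⟩ := key hG
  have : F' = G' := Module.Basis.ext_multilinear (fun i => Finsupp.basisSingleOne) (by
    intro y
    simpa using h y)
  rw [this]

theorem IsML.reindex {ι ι' : Type*} (e : ι' ≃ ι) {β : ι → Type*} [∀ i, AddCommGroup (β i)]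
    [∀ i, Module K (β i)] {M : Type*} [AddCommGroup M] [Module K M]
    {F : (∀ i, β (e i)) → M} (hF : IsML K F) : IsML K (fun q : ∀ i, β i => F fun i => q (e i)) :=
  fun i q q' q'' c c' h1 h2 => hF (e.symm i) _ _ _ c c'
    (fun j hj => h1 (e j) (fun h => hj (by simp [← h])))
    (fun j hj => h2 (e j) (by simp [hj]))

theorem IsML.linear {ι : Type*} {β : ι → Type*} [∀ i, AddCommGroup (β i)]
    [∀ i, Module K (β i)] {M N : Type*} [AddCommGroup M] [Module K M] [AddCommGroup N] [Module K N]
    {F : (∀ i, β i) → M} (hF : IsML K F) (g : M → N)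
    (hg : ∀ (c c' : K) x y, g (c • x + c' • y) = c • g x + c' • g y) : IsML K (fun q => g (F q)) :=
  fun i q q' q'' c c' h1 h2 => by
    simp only [hF i q q' q'' c c' h1 h2, hg]

theorem IsML.linear_arg {ι : Type*} {β β' : ι → Type*} [∀ i, AddCommGroup (β i)]
    [∀ i, Module K (β i)] [∀ i, AddCommGroup (β' i)]
    [∀ i, Module K (β' i)] {M : Type*} [AddCommGroup M] [Module K M]
    {F : (∀ i, β i) → M} (hF : IsML K F) (g : ∀ i, β' i → β i)
    (hg : ∀ i (c c' : K) x y, g i (c • x + c' • y) = c • g i x + c' • g i y) :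
    IsML K (fun q => F fun i => g i (q i)) :=
  fun i q q' q'' c c' h1 h2 => hF i _ _ _ c c'
    (fun j hj => ⟨by rw [(h1 j hj).1], by rw [(h1 j hj).2]⟩)
    (fun j hj => by rw [h2 j hj, hg])

variable {α : Type u} {k : ℕ} {β : Fin k → Type u} {γ : Type u} (f : α → (∀ i, β i) → γ)

theorem linComp_eq (p : α →₀ K) (q : ∀ i, β i →₀ K) (s : ∀ i, Finset (β i))
    (hs : ∀ i, (q i).support ⊆ s i) :
    linComp K f p q = Finsupp.linearCombination K (fun a =>
    ∑ y ∈ Fintype.piFinset s, Finsupp.single (f a y) (∏ i, q i (y i))) p := by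
  unfold linComp
  congr 2
  funext a
  refine Finset.sum_subset (Fintype.piFinset_subset _ _ hs) ?_
  intro y _ hy
  simp only [Fintype.mem_piFinset, not_forall, Finsupp.mem_support_iff, not_not] at hy
  obtain ⟨i, hi⟩ := hy
  rw [Finset.prod_eq_zero (Finset.mem_univ i) hi, Finsupp.single_zero]

theorem linComp_linear (q : ∀ i, β i →₀ K) (c c' : K) (p p' : α →₀ K) :
    linComp K f (c • p + c' • p') q = c • linComp K f p q + c' • linComp K f p' q := by
  simp [linComp]

theorem linComp_isML (p : α →₀ K) : IsML K (linComp K f p) := by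
  classical
  intro i q q' q'' c c' h1 h2
  let s : ∀ i, Finset (β i) := fun i => (q i).support ∪ (q' i).support ∪ (q'' i).support
  rw [linComp_eq f p q s (fun i => by simp only [s]; grind),
    linComp_eq f p q' s (fun i => by simp only [s]; grind),
    linComp_eq f p q'' s (fun i => by simp only [s]; grind)]
  have hp : ∀ y : ∀ i, β i, ∏ i, q'' i (y i) = c * ∏ i, q i (y i) + c' * ∏ i, q' i (y i) := by
    intro y
    simp only [← Finset.mul_prod_erase Finset.univ _ (Finset.mem_univ i)]
    rw [Finset.prod_congr rfl (g := fun j => q'' j (y j)) (f := fun j => q j (y j)),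
      Finset.prod_congr rfl (g := fun j => q'' j (y j)) (f := fun j => q' j (y j)), h2 i rfl]
    · simp only [Finsupp.add_apply, Finsupp.smul_apply, smul_eq_mul]
      ring
    · intro j hj; rw [(h1 j (Finset.ne_of_mem_erase hj)).2]
    · intro j hj; rw [(h1 j (Finset.ne_of_mem_erase hj)).1]
  simp only [hp, Finsupp.single_add, Finset.sum_add_distrib, Finsupp.linearCombination_apply,
    smul_add, Finsupp.sum, Finset.smul_sum, Finsupp.smul_single, smul_eq_mul]
  simp only [mul_left_comm]

theorem linComp_single (a : α) (y : ∀ i, β i) :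
    linComp K f (Finsupp.single a 1) (fun i => Finsupp.single (y i) 1) =
      Finsupp.single (f a y) 1 := by
  classical
  rw [linComp_eq f _ _ (fun i => {y i}) (fun i => Finsupp.support_single_subset)]
  simp

theorem linComp_ext {M : Type*} [AddCommGroup M] [Module K M] {F G : (α →₀ K) → M}
    (hF : ∀ (c c' : K) x y, F (c • x + c' • y) = c • F x + c' • F y)
    (hG : ∀ (c c' : K) x y, G (c • x + c' • y) = c • G x + c' • G y)
    (h : ∀ a, F (Finsupp.single a 1) = G (Finsupp.single a 1)) (p : α →₀ K) : F p = G p := by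
  have hF0 : F 0 = 0 := by simpa using hF 0 0 0 0
  have hG0 : G 0 = 0 := by simpa using hG 0 0 0 0
  induction p using Finsupp.induction_linear with
  | zero => rw [hF0, hG0]
  | add x y hx hy =>
    have := hF 1 1 x y
    have := hG 1 1 x y
    simp_all
  | single a c =>
    have h1 := hF c 0 (Finsupp.single a 1) 0
    have h2 := hG c 0 (Finsupp.single a 1) 0
    simp only [smul_zero, add_zero, zero_smul, Finsupp.smul_single, smul_eq_mul, mul_one] at h1 h2
    rw [h1, h2, h]

theorem mapDomain_linear {α β : Type*} (g : α → β) (c c' : K) (x y : α →₀ K) :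
    Finsupp.mapDomain g (c • x + c' • y) =
      c • Finsupp.mapDomain g x + c' • Finsupp.mapDomain g y := by
  simp [Finsupp.mapDomain_add, Finsupp.mapDomain_smul]

variable (P : SetOperad.{u})

theorem linearization_one_comp {n : ℕ+} (h : ∑ _ : Fin (1 : ℕ+), (n : ℕ) = n) (x : P.obj n →₀ K) :
    linComp K (P.comp (fun _ : Fin (1 : ℕ+) => n) h) (Finsupp.single P.one 1) (fun _ => x) = x := by
  refine IsML.ext (F := fun q : Fin (1 : ℕ+) → (P.obj n →₀ K) =>
    linComp K (P.comp _ h) (Finsupp.single P.one 1) q)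
    (G := fun q => q 0) (linComp_isML _ _) ?_ ?_ (fun _ => x)
  · intro i q q' q'' c c' _ h2
    exact h2 0 (Subsingleton.elim (α := Fin 1) _ _)
  · intro y
    have hy : y = fun _ => y 0 := funext fun i => congrArg y (Subsingleton.elim (α := Fin 1) i 0)
    simp only [linComp_single]
    rw [hy, P.one_comp]

theorem linearization_comp_assoc {k n N : ℕ+} (a : Fin k → ℕ+) (ha : ∑ i, (a i : ℕ) = n)
    (b : ∀ i, Fin (a i) → ℕ+) (s : Fin k → ℕ+) (hb : ∀ i, ∑ j, (b i j : ℕ) = s i)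
    (hs : ∑ i, (s i : ℕ) = N)
    (hN : ∑ l, (b ((blockEquiv a ha).symm l).1 ((blockEquiv a ha).symm l).2 : ℕ) = N)
    (p : P.obj k →₀ K) (q : ∀ i, P.obj (a i) →₀ K) (r : ∀ i j, P.obj (b i j) →₀ K) :
    linComp K (P.comp (fun l => b ((blockEquiv a ha).symm l).1 ((blockEquiv a ha).symm l).2) hN)
        (linComp K (P.comp a ha) p q)
        (fun l => r ((blockEquiv a ha).symm l).1 ((blockEquiv a ha).symm l).2)
      = linComp K (P.comp s hs) p (fun i => linComp K (P.comp (b i) (hb i)) (q i) (r i)) := by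
  let e := blockEquiv a ha
  refine IsML.ext (ι := Σ i, Fin (a i)) (β := fun x => P.obj (b x.1 x.2))
    (F := fun r => linComp K (P.comp _ hN) (linComp K (P.comp a ha) p q)
      (fun l => r (e.symm l)))
    (G := fun r => linComp K (P.comp s hs) p
      (fun i => linComp K (P.comp (b i) (hb i)) (q i) (fun j => r ⟨i, j⟩)))
    (IsML.reindex e.symm (β := fun x : Σ i, Fin (a i) => P.obj (b x.1 x.2) →₀ K)
      (linComp_isML _ _)) ?_ ?_ (fun x => r x.1 x.2)
  · intro i r r' r'' c c' h1 h2
    refine linComp_isML _ _ i.1 _ _ _ c c' (fun j hj => ⟨?_, ?_⟩) ?_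
    · congr 1; funext l; exact (h1 ⟨j, l⟩ (fun h => hj (by rw [← h]))).1
    · congr 1; funext l; exact (h1 ⟨j, l⟩ (fun h => hj (by rw [← h]))).2
    · rintro _ rfl
      refine linComp_isML _ _ i.2 _ _ _ c c' (fun j hj => h1 ⟨i.1, j⟩ ?_) ?_
      · intro h; exact hj (by obtain ⟨i₁, i₂⟩ := i; cases h; rfl)
      · rintro _ rfl
        exact h2 _ rfl
  · intro z
    refine IsML.ext (β := fun i => P.obj (a i))
      (F := fun q => linComp K (P.comp _ hN) (linComp K (P.comp a ha) p q)
        (fun l => Finsupp.single (z (e.symm l)) 1))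
      (G := fun q => linComp K (P.comp s hs) p
        (fun i => linComp K (P.comp (b i) (hb i)) (q i) (fun j => Finsupp.single (z ⟨i, j⟩) 1)))
      (IsML.linear (linComp_isML _ p) (fun x => linComp K (P.comp _ hN) x
        (fun l => Finsupp.single (z (e.symm l)) 1)) (linComp_linear _ _))
      (IsML.linear_arg (β' := fun i => P.obj (a i) →₀ K) (linComp_isML _ p)
        (fun i x => linComp K (P.comp (b i) (hb i)) x (fun j => Finsupp.single (z ⟨i, j⟩) 1))
        (fun i => linComp_linear _ _)) ?_ q
    intro y
    refine linComp_ext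
      (F := fun p => linComp K (P.comp _ hN)
        (linComp K (P.comp a ha) p (fun i => Finsupp.single (y i) 1))
        (fun l => Finsupp.single (z (e.symm l)) 1))
      (G := fun p => linComp K (P.comp s hs) p (fun i => linComp K (P.comp (b i) (hb i))
        (Finsupp.single (y i) 1) (fun j => Finsupp.single (z ⟨i, j⟩) 1)))
      ?_ (linComp_linear _ _) ?_ p
    · intro c c' x x'
      simp only [linComp_linear]
    · intro x
      simp only [linComp_single]
      exact congrArg (fun t => Finsupp.single t 1)
        (P.comp_assoc a ha b s hb hs hN x y (fun i j => z ⟨i, j⟩))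

theorem linearization_comp_act_left {k n : ℕ+} (m : Fin k → ℕ+) (h : ∑ i, (m i : ℕ) = n)
    (τ : Equiv.Perm (Fin k)) (h' : ∑ i, (m (τ i) : ℕ) = n) (p : P.obj k →₀ K)
    (q : ∀ i, P.obj (m i) →₀ K) :
    linComp K (P.comp (fun i => m (τ i)) h') (p.mapDomain fun a => P.act a τ) (fun i => q (τ i)) =
      (linComp K (P.comp m h) p q).mapDomain fun a => P.act a (blockPerm τ m h h') := by
  refine IsML.ext (β := fun i => P.obj (m i))
    (F := fun q => linComp K (P.comp (fun i => m (τ i)) h') (p.mapDomain fun a => P.act a τ)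
      (fun i => q (τ i)))
    (G := fun q =>
      (linComp K (P.comp m h) p q).mapDomain fun a => P.act a (blockPerm τ m h h'))
    (IsML.reindex τ (β := fun i => P.obj (m i) →₀ K) (linComp_isML _ _))
    (IsML.linear (linComp_isML _ _) _ (mapDomain_linear _)) ?_ q
  intro y
  refine linComp_ext
    (F := fun p => linComp K (P.comp (fun i => m (τ i)) h') (p.mapDomain fun a => P.act a τ)
      (fun i => Finsupp.single (y (τ i)) 1))
    (G := fun p => (linComp K (P.comp m h) p (fun i => Finsupp.single (y i) 1)).mapDomain
      fun a => P.act a (blockPerm τ m h h')) ?_ ?_ ?_ p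
  · intro c c' x x'
    simp only [mapDomain_linear, linComp_linear]
  · intro c c' x x'
    simp only [mapDomain_linear, linComp_linear]
  · intro x
    rw [Finsupp.mapDomain_single,
      linComp_single (P.comp (fun i => m (τ i)) h') (P.act x τ) (fun i => y (τ i)),
      linComp_single, Finsupp.mapDomain_single, P.comp_act_left m h τ h' x y]

theorem linearization_comp_act_right {k n : ℕ+} (m : Fin k → ℕ+) (h : ∑ i, (m i : ℕ) = n)
    (σ : ∀ i, Equiv.Perm (Fin (m i))) (p : P.obj k →₀ K) (q : ∀ i, P.obj (m i) →₀ K) :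
    linComp K (P.comp m h) p (fun i => (q i).mapDomain fun a => P.act a (σ i)) =
      (linComp K (P.comp m h) p q).mapDomain fun a => P.act a (sumPerm m h σ) := by
  refine IsML.ext (β := fun i => P.obj (m i))
    (F := fun q => linComp K (P.comp m h) p (fun i => (q i).mapDomain fun a => P.act a (σ i)))
    (G := fun q => (linComp K (P.comp m h) p q).mapDomain fun a => P.act a (sumPerm m h σ))
    ?_ ?_ ?_ q
  · exact IsML.linear_arg (β := fun i => P.obj (m i) →₀ K) (β' := fun i => P.obj (m i) →₀ K)
      (F := linComp K (P.comp m h) p) (linComp_isML _ p)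
      (fun i x => x.mapDomain fun a => P.act a (σ i)) (fun i => mapDomain_linear _)
  · exact IsML.linear (linComp_isML _ _) _ (mapDomain_linear _)
  intro y
  have h1 : (fun i => (Finsupp.single (y i) (1 : K)).mapDomain fun a => P.act a (σ i)) =
      fun i => Finsupp.single (P.act (y i) (σ i)) 1 :=
    funext fun i => Finsupp.mapDomain_single
  simp only [h1]
  refine linComp_ext
    (F := fun p => linComp K (P.comp m h) p (fun i => Finsupp.single (P.act (y i) (σ i)) 1))
    (G := fun p => (linComp K (P.comp m h) p (fun i => Finsupp.single (y i) 1)).mapDomain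
      fun a => P.act a (sumPerm m h σ)) (linComp_linear _ _) ?_ ?_ p
  · intro c c' x x'
    simp only [mapDomain_linear, linComp_linear]
  · intro x
    rw [linComp_single (P.comp m h) x (fun i => P.act (y i) (σ i)), linComp_single,
      Finsupp.mapDomain_single, P.comp_act_right m h σ x y]

theorem linComp_update_add (p : α →₀ K) (q : ∀ i, β i →₀ K) (i : Fin k) (x y : β i →₀ K) :
    linComp K f p (Function.update q i (x + y)) =
      linComp K f p (Function.update q i x) + linComp K f p (Function.update q i y) := by
  have := linComp_isML (K := K) f p i (Function.update q i x) (Function.update q i y)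
    (Function.update q i (x + y)) 1 1 (fun j hj => by simp [hj]) (fun j hj => by subst hj; simp)
  simpa only [one_smul] using this

theorem linComp_update_smul (p : α →₀ K) (q : ∀ i, β i →₀ K) (i : Fin k) (c : K) (x : β i →₀ K) :
    linComp K f p (Function.update q i (c • x)) = c • linComp K f p (Function.update q i x) := by
  have := linComp_isML (K := K) f p i (Function.update q i x) (Function.update q i x)
    (Function.update q i (c • x)) c 0 (fun j hj => by simp [hj]) (fun j hj => by subst hj; simp)
  simpa only [zero_smul, add_zero] using this

end

/-- The linearization of a set operad: its `n`-ary operations are the formal linear combinations of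
elements of `P_n`, and the structure maps are extended (multi)linearly. -/
def SetOperad.linearization (K : Type w) [Field K] (P : SetOperad.{u}) :
    AlgOperad.{max u w} K where
  obj n := P.obj n →₀ K
  act x σ := Finsupp.mapDomain (fun a => P.act a σ) x
  one := Finsupp.single P.one 1
  comp m h := linComp K (P.comp m h)
  act_one x := by simp only [P.act_one]; exact Finsupp.mapDomain_id
  act_mul x σ τ := by
    rw [← Finsupp.mapDomain_comp]
    congr 1
    funext a
    exact P.act_mul a σ τ
  one_comp h x := linearization_one_comp P h x
  comp_one h x := by
    refine linComp_ext (F := fun x => linComp K (P.comp _ h) x _) (G := fun x => x)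
      (fun c c' x y => linComp_linear _ _ c c' x y) (fun _ _ _ _ => rfl) ?_ x
    intro a
    simp only [linComp_single, P.comp_one]
  comp_assoc := linearization_comp_assoc P
  comp_act_left := linearization_comp_act_left P
  comp_act_right := linearization_comp_act_right P
  act_add x y σ := Finsupp.mapDomain_add
  act_smul c x σ := Finsupp.mapDomain_smul c x
  comp_add_left m h p p' q := by simp [linComp]
  comp_smul_left m h c p q := by simp [linComp]
  comp_update_add m h p q i x y := linComp_update_add _ p q i x y
  comp_update_smul m h p q i c x := linComp_update_smul _ p q i c x

/-! ## Free operads -/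

/-- Formal operadic expressions in binary generators `v ∈ V`. The free operad is constructed, like
`FreeAlgebra` in Mathlib, as the quotient of these by the congruence `FreeRel` below, and thus has
the universal property of the free operad by construction. Evaluating away the formal permutations
and composites, such an expression is a linear combination of trees with decorated binary vertices
and labelled leaves. -/
inductive FreeTerm (K : Type u) (V : Type v) : ℕ+ → Type (max u v)
  | gen (v : V) : FreeTerm K V 2
  | one : FreeTerm K V 1
  | act {n : ℕ+} (t : FreeTerm K V n) (σ : Equiv.Perm (Fin n)) : FreeTerm K V n
  | comp {k n : ℕ+} (m : Fin k → ℕ+) (h : ∑ i, (m i : ℕ) = n) (t : FreeTerm K V k)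
      (s : ∀ i, FreeTerm K V (m i)) : FreeTerm K V n
  | zero {n : ℕ+} : FreeTerm K V n
  | add {n : ℕ+} (t t' : FreeTerm K V n) : FreeTerm K V n
  | smul {n : ℕ+} (c : K) (t : FreeTerm K V n) : FreeTerm K V n

/-- The congruence on formal expressions generated by the axioms of an algebraic operad, together
with the requirement that `V` is mapped to the binary operations linearly and equivariantly. Here
`swap` is the action of the transposition on `V`. -/
inductive FreeRel {K : Type u} [Field K] {V : Type v} [AddCommGroup V] [Module K V]
    (swap : V →ₗ[K] V) : ∀ {n : ℕ+}, FreeTerm K V n → FreeTerm K V n → Prop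
  | refl {n : ℕ+} (t : FreeTerm K V n) : FreeRel swap t t
  | symm {n : ℕ+} {t t' : FreeTerm K V n} : FreeRel swap t t' → FreeRel swap t' t
  | trans {n : ℕ+} {t t' t'' : FreeTerm K V n} :
      FreeRel swap t t' → FreeRel swap t' t'' → FreeRel swap t t''
  | act_congr {n : ℕ+} {t t' : FreeTerm K V n} (σ : Equiv.Perm (Fin n)) :
      FreeRel swap t t' → FreeRel swap (t.act σ) (t'.act σ)
  | comp_congr {k n : ℕ+} (m : Fin k → ℕ+) (h : ∑ i, (m i : ℕ) = n) {t t' : FreeTerm K V k}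
      {s s' : ∀ i, FreeTerm K V (m i)} : FreeRel swap t t' → (∀ i, FreeRel swap (s i) (s' i)) →
      FreeRel swap (.comp m h t s) (.comp m h t' s')
  | add_congr {n : ℕ+} {t t' s s' : FreeTerm K V n} :
      FreeRel swap t t' → FreeRel swap s s' → FreeRel swap (t.add s) (t'.add s')
  | smul_congr {n : ℕ+} (c : K) {t t' : FreeTerm K V n} :
      FreeRel swap t t' → FreeRel swap (t.smul c) (t'.smul c)
  -- vector space axioms
  | add_assoc {n : ℕ+} (t t' t'' : FreeTerm K V n) :
      FreeRel swap ((t.add t').add t'') (t.add (t'.add t''))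
  | add_comm {n : ℕ+} (t t' : FreeTerm K V n) : FreeRel swap (t.add t') (t'.add t)
  | zero_add {n : ℕ+} (t : FreeTerm K V n) : FreeRel swap (FreeTerm.zero.add t) t
  | neg_add {n : ℕ+} (t : FreeTerm K V n) : FreeRel swap ((t.smul (-1)).add t) .zero
  | one_smul {n : ℕ+} (t : FreeTerm K V n) : FreeRel swap (t.smul 1) t
  | mul_smul {n : ℕ+} (c c' : K) (t : FreeTerm K V n) :
      FreeRel swap (t.smul (c * c')) ((t.smul c').smul c)
  | smul_add {n : ℕ+} (c : K) (t t' : FreeTerm K V n) :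
      FreeRel swap ((t.add t').smul c) ((t.smul c).add (t'.smul c))
  | add_smul {n : ℕ+} (c c' : K) (t : FreeTerm K V n) :
      FreeRel swap (t.smul (c + c')) ((t.smul c).add (t.smul c'))
  -- operad axioms
  | act_one {n : ℕ+} (t : FreeTerm K V n) : FreeRel swap (t.act 1) t
  | act_mul {n : ℕ+} (t : FreeTerm K V n) (σ τ : Equiv.Perm (Fin n)) :
      FreeRel swap (t.act (σ * τ)) ((t.act σ).act τ)
  | one_comp {n : ℕ+} (h : ∑ _ : Fin (1 : ℕ+), (n : ℕ) = n) (t : FreeTerm K V n) :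
      FreeRel swap (.comp (fun _ : Fin (1 : ℕ+) => n) h .one (fun _ => t)) t
  | comp_one {n : ℕ+} (h : ∑ _ : Fin n, ((1 : ℕ+) : ℕ) = n) (t : FreeTerm K V n) :
      FreeRel swap (.comp (fun _ => 1) h t (fun _ => .one)) t
  | comp_assoc {k n N : ℕ+} (a : Fin k → ℕ+) (ha : ∑ i, (a i : ℕ) = n)
      (b : ∀ i, Fin (a i) → ℕ+) (s : Fin k → ℕ+) (hb : ∀ i, ∑ j, (b i j : ℕ) = s i)
      (hs : ∑ i, (s i : ℕ) = N)
      (hN : ∑ l, (b ((blockEquiv a ha).symm l).1 ((blockEquiv a ha).symm l).2 : ℕ) = N)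
      (p : FreeTerm K V k) (q : ∀ i, FreeTerm K V (a i)) (r : ∀ i j, FreeTerm K V (b i j)) :
      FreeRel swap
        (.comp (fun l => b ((blockEquiv a ha).symm l).1 ((blockEquiv a ha).symm l).2) hN
          (.comp a ha p q) (fun l => r ((blockEquiv a ha).symm l).1 ((blockEquiv a ha).symm l).2))
        (.comp s hs p (fun i => .comp (b i) (hb i) (q i) (r i)))
  | comp_act_left {k n : ℕ+} (m : Fin k → ℕ+) (h : ∑ i, (m i : ℕ) = n)
      (τ : Equiv.Perm (Fin k)) (h' : ∑ i, (m (τ i) : ℕ) = n) (p : FreeTerm K V k)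
      (q : ∀ i, FreeTerm K V (m i)) :
      FreeRel swap (.comp (fun i => m (τ i)) h' (p.act τ) (fun i => q (τ i)))
        ((FreeTerm.comp m h p q).act (blockPerm τ m h h'))
  | comp_act_right {k n : ℕ+} (m : Fin k → ℕ+) (h : ∑ i, (m i : ℕ) = n)
      (σ : ∀ i, Equiv.Perm (Fin (m i))) (p : FreeTerm K V k) (q : ∀ i, FreeTerm K V (m i)) :
      FreeRel swap (.comp m h p (fun i => (q i).act (σ i)))
        ((FreeTerm.comp m h p q).act (sumPerm m h σ))
  | act_add {n : ℕ+} (t t' : FreeTerm K V n) (σ : Equiv.Perm (Fin n)) :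
      FreeRel swap ((t.add t').act σ) ((t.act σ).add (t'.act σ))
  | act_smul {n : ℕ+} (c : K) (t : FreeTerm K V n) (σ : Equiv.Perm (Fin n)) :
      FreeRel swap ((t.smul c).act σ) ((t.act σ).smul c)
  | comp_add_left {k n : ℕ+} (m : Fin k → ℕ+) (h : ∑ i, (m i : ℕ) = n) (p p' : FreeTerm K V k)
      (q : ∀ i, FreeTerm K V (m i)) :
      FreeRel swap (.comp m h (p.add p') q) ((FreeTerm.comp m h p q).add (.comp m h p' q))
  | comp_smul_left {k n : ℕ+} (m : Fin k → ℕ+) (h : ∑ i, (m i : ℕ) = n) (c : K)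
      (p : FreeTerm K V k) (q : ∀ i, FreeTerm K V (m i)) :
      FreeRel swap (.comp m h (p.smul c) q) ((FreeTerm.comp m h p q).smul c)
  | comp_update_add {k n : ℕ+} (m : Fin k → ℕ+) (h : ∑ i, (m i : ℕ) = n) (p : FreeTerm K V k)
      (q : ∀ i, FreeTerm K V (m i)) (i : Fin k) (x y : FreeTerm K V (m i)) :
      FreeRel swap (.comp m h p (Function.update q i (x.add y)))
        ((FreeTerm.comp m h p (Function.update q i x)).add
          (.comp m h p (Function.update q i y)))
  | comp_update_smul {k n : ℕ+} (m : Fin k → ℕ+) (h : ∑ i, (m i : ℕ) = n) (p : FreeTerm K V k)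
      (q : ∀ i, FreeTerm K V (m i)) (i : Fin k) (c : K) (x : FreeTerm K V (m i)) :
      FreeRel swap (.comp m h p (Function.update q i (x.smul c)))
        ((FreeTerm.comp m h p (Function.update q i x)).smul c)
  -- linearity and equivariance of the generators
  | gen_add (v v' : V) : FreeRel swap (.gen (v + v')) ((FreeTerm.gen v).add (.gen v'))
  | gen_smul (c : K) (v : V) : FreeRel swap (.gen (c • v)) ((FreeTerm.gen v).smul c)
  | gen_swap (v : V) :
      FreeRel swap ((FreeTerm.gen v).act (Equiv.swap (0 : Fin (2 : ℕ+)) 1)) (.gen (swap v))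

section FreeOperad

variable {K : Type u} [Field K] {V : Type v} [AddCommGroup V] [Module K V] (swap : V →ₗ[K] V)

def freeSetoid (n : ℕ+) : Setoid (FreeTerm K V n) where
  r := FreeRel swap
  iseqv := ⟨.refl, .symm, .trans⟩

def FreeObj (n : ℕ+) : Type (max u v) := Quotient (freeSetoid swap n)

namespace FreeObj

variable {swap}

def mk {n : ℕ+} (t : FreeTerm K V n) : FreeObj swap n := Quotient.mk _ t

theorem sound {n : ℕ+} {t t' : FreeTerm K V n} (h : FreeRel swap t t') :
    (mk t : FreeObj swap n) = mk t' := Quotient.sound h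

theorem exists_mk {n : ℕ+} (x : FreeObj swap n) : ∃ t, mk t = x := Quotient.exists_rep x

instance (n : ℕ+) : Zero (FreeObj swap n) := ⟨mk .zero⟩

instance (n : ℕ+) : Add (FreeObj swap n) :=
  ⟨Quotient.map₂ FreeTerm.add fun _ _ h _ _ h' => .add_congr h h'⟩

instance (n : ℕ+) : SMul K (FreeObj swap n) :=
  ⟨fun c => Quotient.map (FreeTerm.smul c) fun _ _ h => .smul_congr c h⟩

instance (n : ℕ+) : Neg (FreeObj swap n) := ⟨fun x => (-1 : K) • x⟩

instance (n : ℕ+) : AddCommGroup (FreeObj swap n) :=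
  { AddGroup.ofLeftAxioms (G := FreeObj swap n)
      (by rintro ⟨a⟩ ⟨b⟩ ⟨c⟩; exact sound (.add_assoc a b c))
      (by rintro ⟨a⟩; exact sound (.zero_add a))
      (by rintro ⟨a⟩; exact sound (.neg_add a)) with
    add_comm := by rintro ⟨a⟩ ⟨b⟩; exact sound (.add_comm a b) }

instance (n : ℕ+) : Module K (FreeObj swap n) :=
  Module.ofMinimalAxioms
    (by rintro c ⟨a⟩ ⟨b⟩; exact sound (.smul_add c a b))
    (by rintro c c' ⟨a⟩; exact sound (.add_smul c c' a))
    (by rintro c c' ⟨a⟩; exact sound (.mul_smul c c' a))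
    (by rintro ⟨a⟩; exact sound (.one_smul a))

def act {n : ℕ+} (x : FreeObj swap n) (σ : Equiv.Perm (Fin n)) : FreeObj swap n :=
  Quotient.map (fun t => FreeTerm.act t σ) (fun _ _ h => .act_congr σ h) x

def comp {k n : ℕ+} (m : Fin k → ℕ+) (h : ∑ i, (m i : ℕ) = n) (p : FreeObj swap k)
    (q : ∀ i, FreeObj swap (m i)) : FreeObj swap n :=
  mk (.comp m h p.out fun i => (q i).out)

theorem comp_mk {k n : ℕ+} (m : Fin k → ℕ+) (h : ∑ i, (m i : ℕ) = n) (t : FreeTerm K V k)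
    (s : ∀ i, FreeTerm K V (m i)) :
    comp m h (mk t : FreeObj swap k) (fun i => mk (s i)) = mk (.comp m h t s) :=
  sound (.comp_congr m h (Quotient.mk_out (s := freeSetoid swap k) t)
    fun i => Quotient.mk_out (s := freeSetoid swap (m i)) (s i))

theorem exists_mk_family {k : ℕ} {m : Fin k → ℕ+} (q : ∀ i, FreeObj swap (m i)) :
    ∃ s : ∀ i, FreeTerm K V (m i), q = fun i => mk (s i) := by
  choose s hs using fun i => exists_mk (q i)
  exact ⟨s, funext fun i => (hs i).symm⟩

theorem update_mk {k : ℕ} {m : Fin k → ℕ+} (s : ∀ i, FreeTerm K V (m i)) (i : Fin k)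
    (t : FreeTerm K V (m i)) :
    Function.update (fun i => (mk (s i) : FreeObj swap (m i))) i (mk t) =
      fun j => mk (Function.update s i t j) := by
  funext j
  rw [Function.apply_update (fun i => (mk : FreeTerm K V (m i) → FreeObj swap (m i))) s i t j]

end FreeObj

open FreeObj in
/-- The free algebraic operad on the `𝕊`-module that is concentrated in arity `2`, where it is `V`
with the transposition acting by `swap`. -/
def FreeOperad : AlgOperad.{max u v} K where
  obj := FreeObj swap
  act := FreeObj.act
  one := mk .one
  comp := FreeObj.comp
  act_one := by rintro n ⟨t⟩; exact sound (.act_one t)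
  act_mul := by rintro n ⟨t⟩ σ τ; exact sound (.act_mul t σ τ)
  one_comp := by
    rintro n h x
    obtain ⟨t, rfl⟩ := exists_mk x
    rw [comp_mk (fun _ => n) h .one fun _ => t]
    exact sound (.one_comp h t)
  comp_one := by
    rintro n h x
    obtain ⟨t, rfl⟩ := exists_mk x
    rw [comp_mk (fun _ => 1) h t fun _ => .one]
    exact sound (.comp_one h t)
  comp_assoc := by
    intro k n N a ha b s hb hs hN p q r
    obtain ⟨p, rfl⟩ := exists_mk p
    obtain ⟨q, rfl⟩ := exists_mk_family q
    choose r' hr using fun i => exists_mk_family (r i)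
    obtain rfl : r = fun i j => mk (r' i j) := funext hr
    simp only [comp_mk]
    exact sound (.comp_assoc a ha b s hb hs hN p q r')
  comp_act_left := by
    intro k n m h τ h' p q
    obtain ⟨p, rfl⟩ := exists_mk p
    obtain ⟨q, rfl⟩ := exists_mk_family q
    refine Eq.trans (comp_mk _ h' (p.act τ) fun i => q (τ i)) ?_
    rw [comp_mk]
    exact sound (.comp_act_left m h τ h' p q)
  comp_act_right := by
    intro k n m h σ p q
    obtain ⟨p, rfl⟩ := exists_mk p
    obtain ⟨q, rfl⟩ := exists_mk_family q
    refine Eq.trans (comp_mk _ h p fun i => (q i).act (σ i)) ?_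
    rw [comp_mk]
    exact sound (.comp_act_right m h σ p q)
  act_add := by rintro n ⟨t⟩ ⟨t'⟩ σ; exact sound (.act_add t t' σ)
  act_smul := by rintro n c ⟨t⟩ σ; exact sound (.act_smul c t σ)
  comp_add_left := by
    intro k n m h p p' q
    obtain ⟨p, rfl⟩ := exists_mk p
    obtain ⟨p', rfl⟩ := exists_mk p'
    obtain ⟨q, rfl⟩ := exists_mk_family q
    refine Eq.trans (comp_mk m h (p.add p') q) ?_
    rw [comp_mk, comp_mk]
    exact sound (.comp_add_left m h p p' q)
  comp_smul_left := by
    intro k n m h c p q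
    obtain ⟨p, rfl⟩ := exists_mk p
    obtain ⟨q, rfl⟩ := exists_mk_family q
    refine Eq.trans (comp_mk m h (p.smul c) q) ?_
    rw [comp_mk]
    exact sound (.comp_smul_left m h c p q)
  comp_update_add := by
    intro k n m h p q i x y
    obtain ⟨p, rfl⟩ := exists_mk p
    obtain ⟨q, rfl⟩ := exists_mk_family q
    obtain ⟨x, rfl⟩ := exists_mk x
    obtain ⟨y, rfl⟩ := exists_mk y
    change comp m h _ (Function.update _ i (mk (x.add y))) = _
    rw [update_mk, update_mk, update_mk, comp_mk, comp_mk, comp_mk]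
    exact sound (.comp_update_add m h p q i x y)
  comp_update_smul := by
    intro k n m h p q i c x
    obtain ⟨p, rfl⟩ := exists_mk p
    obtain ⟨q, rfl⟩ := exists_mk_family q
    obtain ⟨x, rfl⟩ := exists_mk x
    change comp m h _ (Function.update _ i (mk (x.smul c))) = _
    rw [update_mk, update_mk, comp_mk, comp_mk]
    exact sound (.comp_update_smul m h p q i c x)

/-- The generators of the free operad. -/
def FreeOperad.gen : V →ₗ[K] (FreeOperad swap).obj 2 where
  toFun v := FreeObj.mk (.gen v)
  map_add' v v' := FreeObj.sound (.gen_add v v')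
  map_smul' c v := FreeObj.sound (.gen_smul c v)

end FreeOperad

/-! ## Operadic ideals and quotients -/

/-- Membership in the operadic ideal of `O` generated by `S`. -/
inductive AlgOperad.IdealMem {K : Type v} [Field K] (O : AlgOperad.{u} K)
    (S : ∀ n, Set (O.obj n)) : ∀ n : ℕ+, O.obj n → Prop
  | of {n : ℕ+} (x : O.obj n) : x ∈ S n → IdealMem O S n x
  | zero {n : ℕ+} : IdealMem O S n 0
  | add {n : ℕ+} (x y : O.obj n) : IdealMem O S n x → IdealMem O S n y → IdealMem O S n (x + y)
  | smul {n : ℕ+} (c : K) (x : O.obj n) : IdealMem O S n x → IdealMem O S n (c • x)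
  | act {n : ℕ+} (x : O.obj n) (σ : Equiv.Perm (Fin n)) :
      IdealMem O S n x → IdealMem O S n (O.act x σ)
  | comp_left {k n : ℕ+} (m : Fin k → ℕ+) (h : ∑ i, (m i : ℕ) = n) (p : O.obj k)
      (q : ∀ i, O.obj (m i)) : IdealMem O S k p → IdealMem O S n (O.comp m h p q)
  | comp_right {k n : ℕ+} (m : Fin k → ℕ+) (h : ∑ i, (m i : ℕ) = n) (p : O.obj k)
      (q : ∀ i, O.obj (m i)) (i : Fin k) :
      IdealMem O S (m i) (q i) → IdealMem O S n (O.comp m h p q)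

namespace AlgOperad

variable {K : Type v} [Field K] (O : AlgOperad.{u} K) (S : ∀ n, Set (O.obj n))

/-- The operadic ideal generated by `S`. -/
def ideal (n : ℕ+) : Submodule K (O.obj n) where
  carrier := {x | O.IdealMem S n x}
  zero_mem' := .zero
  add_mem' hx hy := .add _ _ hx hy
  smul_mem' c _ hx := .smul c _ hx

theorem comp_sub_mem {k n : ℕ+} (m : Fin k → ℕ+) (h : ∑ i, (m i : ℕ) = n) (p p' : O.obj k)
    (q q' : ∀ i, O.obj (m i)) (hp : p - p' ∈ O.ideal S k)
    (hq : ∀ i, q i - q' i ∈ O.ideal S (m i)) :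
    O.comp m h p q - O.comp m h p' q' ∈ O.ideal S n := by
  have h1 : O.comp m h p q - O.comp m h p' q ∈ O.ideal S n := by
    have := O.comp_add_left m h (p - p') p' q
    rw [sub_add_cancel] at this
    rw [this, add_sub_cancel_right]
    exact .comp_left m h _ q hp
  have h2 : ∀ s : Finset (Fin k),
      O.comp m h p' q - O.comp m h p' (s.piecewise q' q) ∈ O.ideal S n := by
    intro s
    induction s using Finset.induction_on with
    | empty => simp
    | insert i s hi ih =>
      rw [Finset.piecewise_insert]
      have h3 := O.comp_update_add m h p' (s.piecewise q' q) i (q i - q' i) (q' i)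
      rw [sub_add_cancel] at h3
      have h4 : Function.update (s.piecewise q' q) i (q i) = s.piecewise q' q := by
        rw [Function.update_eq_self_iff]
        simp [hi]
      rw [h4] at h3
      have h5 : O.comp m h p' (Function.update (s.piecewise q' q) i (q i - q' i)) ∈
          O.ideal S n := by
        refine .comp_right m h p' _ i ?_
        rw [Function.update_self]
        exact hq i
      rw [h3] at ih
      have := (O.ideal S n).add_mem ih h5
      convert this using 1
      abel
  have h3 := h2 Finset.univ
  rw [Finset.piecewise_univ] at h3
  have := (O.ideal S n).add_mem h1 h3
  rwa [sub_add_sub_cancel] at this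

abbrev QuotObj (n : ℕ+) : Type u := O.obj n ⧸ O.ideal S n

def quotMk (n : ℕ+) : O.obj n →ₗ[K] O.QuotObj S n := (O.ideal S n).mkQ

theorem quotMk_surj (n : ℕ+) : Function.Surjective (O.quotMk S n) := (O.ideal S n).mkQ_surjective

def quotComp {k n : ℕ+} (m : Fin k → ℕ+) (h : ∑ i, (m i : ℕ) = n) (p : O.QuotObj S k)
    (q : ∀ i, O.QuotObj S (m i)) : O.QuotObj S n :=
  O.quotMk S n (O.comp m h (Function.surjInv (O.quotMk_surj S k) p)
    fun i => Function.surjInv (O.quotMk_surj S (m i)) (q i))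

theorem quotComp_mk {k n : ℕ+} (m : Fin k → ℕ+) (h : ∑ i, (m i : ℕ) = n) (p : O.obj k)
    (q : ∀ i, O.obj (m i)) :
    O.quotComp S m h (O.quotMk S k p) (fun i => O.quotMk S (m i) (q i)) =
      O.quotMk S n (O.comp m h p q) :=
  (Submodule.Quotient.eq _).2 (O.comp_sub_mem S m h _ _ _ _
    ((Submodule.Quotient.eq _).1 (Function.surjInv_eq (O.quotMk_surj S k) _))
    fun i => (Submodule.Quotient.eq _).1 (Function.surjInv_eq (O.quotMk_surj S (m i)) _))

def quotAct {n : ℕ+} (x : O.QuotObj S n) (σ : Equiv.Perm (Fin n)) : O.QuotObj S n :=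
  (O.ideal S n).mapQ (O.ideal S n)
    ({ toFun := fun x => O.act x σ
       map_add' := fun x y => O.act_add x y σ
       map_smul' := fun c x => O.act_smul c x σ } : O.obj n →ₗ[K] O.obj n)
    (fun x hx => .act x σ hx) x

theorem quotAct_mk {n : ℕ+} (x : O.obj n) (σ : Equiv.Perm (Fin n)) :
    O.quotAct S (O.quotMk S n x) σ = O.quotMk S n (O.act x σ) := rfl

theorem exists_quotMk_family {k : ℕ} {m : Fin k → ℕ+} (q : ∀ i, O.QuotObj S (m i)) :
    ∃ s : ∀ i, O.obj (m i), q = fun i => O.quotMk S (m i) (s i) := by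
  choose s hs using fun i => O.quotMk_surj S (m i) (q i)
  exact ⟨s, funext fun i => (hs i).symm⟩

theorem update_quotMk {k : ℕ} {m : Fin k → ℕ+} (s : ∀ i, O.obj (m i)) (i : Fin k)
    (t : O.obj (m i)) :
    Function.update (fun i => O.quotMk S (m i) (s i)) i (O.quotMk S (m i) t) =
      fun j => O.quotMk S (m j) (Function.update s i t j) := by
  funext j
  rw [Function.apply_update (fun i => O.quotMk S (m i)) s i t j]

/-- The quotient of an algebraic operad by the operadic ideal generated by `S`. -/
def quotient : AlgOperad.{u} K where
  obj := O.QuotObj S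
  act := O.quotAct S
  one := O.quotMk S 1 O.one
  comp := O.quotComp S
  act_one x := by
    obtain ⟨x, rfl⟩ := O.quotMk_surj S _ x
    rw [quotAct_mk, O.act_one]
  act_mul x σ τ := by
    obtain ⟨x, rfl⟩ := O.quotMk_surj S _ x
    rw [quotAct_mk, quotAct_mk, quotAct_mk, O.act_mul]
  one_comp h x := by
    obtain ⟨x, rfl⟩ := O.quotMk_surj S _ x
    exact (O.quotComp_mk S _ h O.one fun _ => x).trans (congrArg (O.quotMk S _) (O.one_comp h x))
  comp_one h x := by
    obtain ⟨x, rfl⟩ := O.quotMk_surj S _ x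
    exact (O.quotComp_mk S _ h x fun _ => O.one).trans (congrArg (O.quotMk S _) (O.comp_one h x))
  comp_assoc a ha b s hb hs hN p q r := by
    obtain ⟨p, rfl⟩ := O.quotMk_surj S _ p
    obtain ⟨q, rfl⟩ := O.exists_quotMk_family S q
    choose r' hr using fun i => O.exists_quotMk_family S (r i)
    obtain rfl : r = fun i j => O.quotMk S _ (r' i j) := funext hr
    simp only [quotComp_mk]
    exact congrArg (O.quotMk S _) (O.comp_assoc a ha b s hb hs hN p q r')
  comp_act_left m h τ h' p q := by
    obtain ⟨p, rfl⟩ := O.quotMk_surj S _ p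
    obtain ⟨q, rfl⟩ := O.exists_quotMk_family S q
    rw [quotComp_mk, quotAct_mk, quotAct_mk]
    exact (O.quotComp_mk S _ h' (O.act p τ) fun i => q (τ i)).trans
      (congrArg (O.quotMk S _) (O.comp_act_left m h τ h' p q))
  comp_act_right m h σ p q := by
    obtain ⟨p, rfl⟩ := O.quotMk_surj S _ p
    obtain ⟨q, rfl⟩ := O.exists_quotMk_family S q
    simp only [quotComp_mk, quotAct_mk]
    exact congrArg (O.quotMk S _) (O.comp_act_right m h σ p q)
  act_add x y σ := by
    obtain ⟨x, rfl⟩ := O.quotMk_surj S _ x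
    obtain ⟨y, rfl⟩ := O.quotMk_surj S _ y
    rw [← map_add, quotAct_mk, quotAct_mk, quotAct_mk, O.act_add, map_add]
  act_smul c x σ := by
    obtain ⟨x, rfl⟩ := O.quotMk_surj S _ x
    rw [← map_smul, quotAct_mk, quotAct_mk, O.act_smul, map_smul]
  comp_add_left m h p p' q := by
    obtain ⟨p, rfl⟩ := O.quotMk_surj S _ p
    obtain ⟨p', rfl⟩ := O.quotMk_surj S _ p'
    obtain ⟨q, rfl⟩ := O.exists_quotMk_family S q
    rw [← map_add, quotComp_mk, quotComp_mk, quotComp_mk, O.comp_add_left, map_add]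
  comp_smul_left m h c p q := by
    obtain ⟨p, rfl⟩ := O.quotMk_surj S _ p
    obtain ⟨q, rfl⟩ := O.exists_quotMk_family S q
    rw [← map_smul, quotComp_mk, quotComp_mk, O.comp_smul_left, map_smul]
  comp_update_add m h p q i x y := by
    obtain ⟨p, rfl⟩ := O.quotMk_surj S _ p
    obtain ⟨q, rfl⟩ := O.exists_quotMk_family S q
    obtain ⟨x, rfl⟩ := O.quotMk_surj S _ x
    obtain ⟨y, rfl⟩ := O.quotMk_surj S _ y
    rw [← map_add, update_quotMk, update_quotMk, update_quotMk, quotComp_mk, quotComp_mk,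
      quotComp_mk, O.comp_update_add, map_add]
  comp_update_smul m h p q i c x := by
    obtain ⟨p, rfl⟩ := O.quotMk_surj S _ p
    obtain ⟨q, rfl⟩ := O.exists_quotMk_family S q
    obtain ⟨x, rfl⟩ := O.quotMk_surj S _ x
    rw [← map_smul, update_quotMk, update_quotMk, quotComp_mk, quotComp_mk, O.comp_update_smul,
      map_smul]

end AlgOperad

/-! ## Binary quadratic operads -/

/-- The arities of the two inputs of `μ(y; x, id)`, for binary `x` and `y`. -/
def treeArity : Fin (2 : ℕ+) → ℕ+
  | ⟨0, _⟩ => 2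
  | ⟨_ + 1, _⟩ => 1

theorem treeArity_sum : ∑ i, (treeArity i : ℕ) = (3 : ℕ+) := rfl

/-- The two inputs of `μ(y; x, id)`. -/
def AlgOperad.treeInputs {K : Type v} [Field K] (O : AlgOperad.{u} K) (x : O.obj 2) :
    ∀ i, O.obj (treeArity i)
  | ⟨0, _⟩ => x
  | ⟨_ + 1, _⟩ => O.one

theorem AlgOperad.update_treeInputs {K : Type v} [Field K] (O : AlgOperad.{u} K) (x x' : O.obj 2) :
    Function.update (O.treeInputs x) (0 : Fin (2 : ℕ+)) x' = O.treeInputs x' := by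
  funext i
  match i with
  | ⟨0, _⟩ => exact Function.update_self _ _ _
  | ⟨j + 1, _⟩ => exact Function.update_of_ne (fun h => by cases h) _ _

/-- The three kinds of trees with two binary vertices. `O.tree c x y` is the tree with `x` above
`y`, i.e. with `x` attached to the first input of `y`, whose leaves from left to right are
labelled `1,2,3` for `c = 0`; `2,3,1` for `c = 1`; `3,1,2` for `c = 2`. -/
def AlgOperad.tree {K : Type v} [Field K] (O : AlgOperad.{u} K) (c : Fin 3) :
    O.obj 2 →ₗ[K] O.obj 2 →ₗ[K] O.obj 3 :=
  LinearMap.mk₂ K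
    (fun x y => O.act (O.comp treeArity treeArity_sum y (O.treeInputs x))
      (finRotate (3 : ℕ+) ^ (c : ℕ))⁻¹)
    (fun x x' y => by
      have h := O.comp_update_add treeArity treeArity_sum y (O.treeInputs 0) 0 x x'
      rw [update_treeInputs, update_treeInputs] at h
      rw [← O.act_add, ← h]
      exact congrArg (fun z => O.act (O.comp _ _ y z) _) (O.update_treeInputs 0 (x + x')).symm)
    (fun a x y => by
      have h := O.comp_update_smul treeArity treeArity_sum y (O.treeInputs 0) 0 a x
      rw [update_treeInputs] at h
      rw [← O.act_smul, ← h]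
      exact congrArg (fun z => O.act (O.comp _ _ y z) _) (O.update_treeInputs 0 (a • x)).symm)
    (fun x y y' => by rw [O.comp_add_left, O.act_add])
    (fun a x y => by rw [O.comp_smul_left, O.act_smul])

/-- A presentation `F(V)/(R)` of a binary quadratic operad. The `𝕊`-module of generators is
concentrated in arity `2`, where it is `V` with the transposition acting by `swap`. A relation is
an element of `F(V)(3) = (V ⊗ V)³`: the element `v ⊗ w` of the `c`-th summand stands for the tree of
the `c`-th kind with `v` above `w`. -/
structure BinaryQuadratic (K : Type u) [Field K] where
  V : Type v
  [addCommGroup : AddCommGroup V]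
  [module : Module K V]
  swap : V →ₗ[K] V
  swap_swap : ∀ v, swap (swap v) = v
  rel : Set (Fin 3 → V ⊗[K] V)

attribute [instance] BinaryQuadratic.addCommGroup BinaryQuadratic.module

namespace BinaryQuadratic

variable {K : Type u} [Field K] (D : BinaryQuadratic.{u, v} K)

/-- The element of `F(V)(3)` with the given coordinates. -/
def treeSum (r : Fin 3 → D.V ⊗[K] D.V) : (FreeOperad D.swap).obj 3 :=
  ∑ c, TensorProduct.lift (((FreeOperad D.swap).tree c).compl₁₂
    (FreeOperad.gen D.swap) (FreeOperad.gen D.swap)) (r c)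

/-- The relations, as a collection of subsets of the free operad (concentrated in arity `3`). -/
inductive IsRelator : ∀ n : ℕ+, (FreeOperad D.swap).obj n → Prop
  | mk (r : Fin 3 → D.V ⊗[K] D.V) (hr : r ∈ D.rel) : IsRelator 3 (D.treeSum r)

/-- The binary quadratic operad `F(V)/(R)`. -/
def operad : AlgOperad.{max u v} K :=
  (FreeOperad D.swap).quotient fun n => {x | D.IsRelator n x}

/-- The binary operation of `F(V)/(R)` given by a generator. -/
def gen : D.V →ₗ[K] D.operad.obj 2 :=
  (AlgOperad.quotMk _ _ 2).comp (FreeOperad.gen D.swap)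

/-- Apply `f` to the decoration of the upper vertex and `g` to the decoration of the lower one. -/
def decorate {V : Type v} {W : Type w} [AddCommGroup V] [Module K V] [AddCommGroup W] [Module K W]
    (f g : V →ₗ[K] W) (r : Fin 3 → V ⊗[K] V) : Fin 3 → W ⊗[K] W :=
  fun c => TensorProduct.map f g (r c)

/-- The operad of two totally compatible structures: generators `V_∘ ⊕ V_•` (the first summand is
`V_∘`), and relations `R_∘`, `R_•`, the relations saying that `v_∘` above `w_•` equals `v_•` above
`w_∘`, and the relations `R` with the upper vertex in `V_∘` and the lower vertex in `V_•`. -/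
def tc : BinaryQuadratic.{u, v} K where
  V := D.V × D.V
  swap := D.swap.prodMap D.swap
  swap_swap v := by simp [D.swap_swap]
  rel :=
    decorate (LinearMap.inl K D.V D.V) (LinearMap.inl K D.V D.V) '' D.rel ∪
    decorate (LinearMap.inr K D.V D.V) (LinearMap.inr K D.V D.V) '' D.rel ∪
    {r | ∃ (c : Fin 3) (v w : D.V),
      r = Pi.single c ((v, (0 : D.V)) ⊗ₜ[K] ((0 : D.V), w) - ((0 : D.V), v) ⊗ₜ[K] (w, (0 : D.V)))} ∪
    decorate (LinearMap.inl K D.V D.V) (LinearMap.inr K D.V D.V) '' D.rel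

end BinaryQuadratic

/-- The difference between the trees of the `c`-th and the `d`-th kind whose vertices are decorated
by the generator `1` of the trivial representation `K`. -/
def comRel (K : Type u) [Field K] (c d : Fin 3) : Fin 3 → K ⊗[K] K :=
  Pi.single c ((1 : K) ⊗ₜ[K] (1 : K)) - Pi.single d ((1 : K) ⊗ₜ[K] (1 : K))

/-- The operad `Com`: one symmetric binary operation, and associativity. -/
def comPresentation (K : Type u) [Field K] : BinaryQuadratic.{u, u} K where
  V := K
  swap := LinearMap.id
  swap_swap _ := rfl
  rel := {comRel K 0 1, comRel K 0 2}

/-- The product of `Com`, as a generator. -/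
def comProduct (K : Type u) [Field K] : (comPresentation K).V := (1 : K)

theorem tcCom_bound {k n : ℕ+} (m : Fin k → ℕ+) (h : ∑ i, (m i : ℕ) = n) (p : Fin k)
    (q : ∀ i, Fin (m i)) : (p : ℕ) + ∑ i, (q i : ℕ) < n := by
  have h1 : ∑ i : Fin k, ((q i : ℕ) + 1) ≤ ∑ i, (m i : ℕ) :=
    Finset.sum_le_sum fun i _ => (q i).2
  rw [Finset.sum_add_distrib, h] at h1
  simp at h1
  have := p.2
  omega

/-- The set operad `ᵗᶜCom`: its elements of arity `n` are `D₀ⁿ, …, Dₙ₋₁ⁿ`, where `Dᵢⁿ` is the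
composite of `n - 1` products, `i` of which are white. -/
def tcCom : SetOperad.{0} where
  obj n := Fin n
  act x _ := x
  one := (0 : Fin (1 : ℕ+))
  comp m h p q := ⟨p + ∑ i, (q i : ℕ), tcCom_bound m h p q⟩
  act_one _ := rfl
  act_mul _ _ _ := rfl
  one_comp h x := by
    apply Fin.ext
    change 0 + ∑ _ : Fin 1, (x : ℕ) = x
    simp
  comp_one h x := by
    apply Fin.ext
    change (x : ℕ) + ∑ _, 0 = x
    simp
  comp_assoc a ha b s hb hs hN p q r := by
    apply Fin.ext
    simp only [Finset.sum_add_distrib, add_assoc]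
    rw [Equiv.sum_comp (blockEquiv a ha).symm (fun x => (r x.1 x.2 : ℕ)), Fintype.sum_sigma]
  comp_act_left m h τ h' p q := by
    apply Fin.ext
    simp only
    rw [Equiv.sum_comp τ (fun i => (q i : ℕ))]
  comp_act_right _ _ _ _ _ := rfl

/-- The element `Dᵢⁿ` of `ᵗᶜCom`. -/
def tcCom.D {n : ℕ+} (i : Fin n) : tcCom.obj n := i

/-! ## Operadic partition posets -/

/-- A `P`-partition of `[n]`: a partition of `[n]` each of whose blocks `B` is decorated by an
element of `P_{|B|}`. -/
structure SetOperad.Partition (P : SetOperad.{u}) (n : ℕ) where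
  partition : Finpartition (Finset.univ : Finset (Fin n))
  deco : ∀ B : {B // B ∈ partition.parts},
    P.obj ⟨B.1.card, Finset.card_pos.2 (partition.nonempty_of_mem_parts B.2)⟩

/-- A list `A_1, …, A_t` of distinct blocks of the partition `π` whose union is `B`. -/
structure BlockList {n : ℕ} (π : Finpartition (Finset.univ : Finset (Fin n)))
    (B : Finset (Fin n)) where
  length : ℕ+
  block : Fin length → {A // A ∈ π.parts}
  injective : Function.Injective block
  mem_iff : ∀ x, x ∈ B ↔ ∃ i, x ∈ (block i).1

namespace BlockList

variable {n : ℕ} {π : Finpartition (Finset.univ : Finset (Fin n))} {B : Finset (Fin n)}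
  (L : BlockList π B)

/-- The number of elements of the `i`-th block in the list. -/
def size (i : Fin L.length) : ℕ+ :=
  ⟨(L.block i).1.card, Finset.card_pos.2 (π.nonempty_of_mem_parts (L.block i).2)⟩

/-- The elements of `B`, listed block by block, the elements of each block being in ascending
order. -/
def elem (x : Σ i, Fin (L.size i)) : {b // b ∈ B} :=
  ⟨(L.block x.1).1.orderEmbOfFin rfl x.2,
    (L.mem_iff _).2 ⟨x.1, (L.block x.1).1.orderEmbOfFin_mem rfl x.2⟩⟩

theorem elem_bijective : Function.Bijective L.elem := by
  constructor
  · rintro ⟨i, a⟩ ⟨j, b⟩ h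
    have h : (L.block i).1.orderEmbOfFin rfl a = (L.block j).1.orderEmbOfFin rfl b :=
      congrArg Subtype.val h
    have hij : i = j := L.injective (Subtype.ext (π.eq_of_mem_parts (L.block i).2 (L.block j).2
      ((L.block i).1.orderEmbOfFin_mem rfl a)
      (h ▸ (L.block j).1.orderEmbOfFin_mem rfl b)))
    subst hij
    rw [((L.block i).1.orderEmbOfFin rfl).injective h]
  · rintro ⟨b, hb⟩
    obtain ⟨i, hi⟩ := (L.mem_iff b).1 hb
    have : b ∈ Set.range ((L.block i).1.orderEmbOfFin rfl) := by
      rw [Finset.range_orderEmbOfFin]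
      exact hi
    obtain ⟨a, ha⟩ := this
    exact ⟨⟨i, a⟩, Subtype.ext ha⟩

theorem sum_size (hB : 0 < B.card) :
    ∑ i, (L.size i : ℕ) = ((⟨B.card, hB⟩ : ℕ+) : ℕ) := by
  have := Fintype.card_of_bijective L.elem_bijective
  simpa using this

/-- The permutation `σ` in two-line notation: the top row consists of the elements of `B` in
ascending order, the bottom row of the elements of `A_1`, then those of `A_2`, and so on. -/
def perm (hB : 0 < B.card) : Equiv.Perm (Fin ((⟨B.card, hB⟩ : ℕ+) : ℕ)) :=
  (blockEquiv L.size (L.sum_size hB)).symm.trans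
    ((Equiv.ofBijective L.elem L.elem_bijective).trans (B.orderIsoOfFin rfl).symm.toEquiv)

end BlockList

namespace SetOperad

/-- The order of the operadic partition poset: `α ≤ β` if the partition of `α` refines that of `β`
and, whenever a block `B` of `β` is the union of blocks `A_1, …, A_t` of `α`, the decoration of `B`
is `μ(p; p_1, …, p_t)σ⁻¹` for some `p ∈ P_t`, where `p_i` is the decoration of `A_i`. -/
instance (P : SetOperad.{u}) (n : ℕ) : LE (P.Partition n) where
  le α β := α.partition ≤ β.partition ∧
    ∀ (B : {B // B ∈ β.partition.parts}) (L : BlockList α.partition B.1),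
      ∃ p : P.obj L.length, β.deco B =
        P.act (P.comp L.size (L.sum_size _) p fun i => α.deco (L.block i)) (L.perm _)⁻¹

/-- The projection to the poset of partitions of `[n]`. -/
def proj (P : SetOperad.{u}) (n : ℕ) (α : P.Partition n) :
    Finpartition (Finset.univ : Finset (Fin n)) :=
  α.partition

/-- Apply a map to all the decorations. -/
def Partition.map {P : SetOperad.{u}} {Q : SetOperad.{v}} {n : ℕ} (f : ∀ k, P.obj k → Q.obj k)
    (α : P.Partition n) : Q.Partition n where
  partition := α.partition
  deco B := f _ (α.deco B)

end SetOperad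

/-- The fiber product of `P` and `Q` over `f : P → S` and `g : Q → S`, with the order induced by the
componentwise order on `P × Q`. -/
abbrev FiberProduct {P : Type u} {Q : Type v} {S : Type w} (f : P → S) (g : Q → S) :=
  {x : P × Q // f x.1 = g x.2}

end

noncomputable section

/-! ## Morphisms of algebraic operads and universal properties -/

/-- A morphism of algebraic operads. -/
structure AlgOperad.Hom {K : Type w} [Field K] (O : AlgOperad.{u} K) (Q : AlgOperad.{v} K) where
  app : ∀ n, O.obj n →ₗ[K] Q.obj n
  map_one : app 1 O.one = Q.one
  map_act : ∀ {n : ℕ+} (x : O.obj n) (σ : Equiv.Perm (Fin n)),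
    app n (O.act x σ) = Q.act (app n x) σ
  map_comp : ∀ {k n : ℕ+} (m : Fin k → ℕ+) (h : ∑ i, (m i : ℕ) = n) (p : O.obj k)
    (q : ∀ i, O.obj (m i)),
    app n (O.comp m h p q) = Q.comp m h (app k p) fun i => app (m i) (q i)

namespace AlgOperad

variable {K : Type w} [Field K]

theorem comp_congr (A : AlgOperad.{u} K) {k n : ℕ+} {m m' : Fin k → ℕ+}
    (h : ∑ i, (m i : ℕ) = n) (h' : ∑ i, (m' i : ℕ) = n) (p : A.obj k) {q : ∀ i, A.obj (m i)}
    {q' : ∀ i, A.obj (m' i)} (hm : ∀ i, m i = m' i) (hq : ∀ i, HEq (q i) (q' i)) :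
    A.comp m h p q = A.comp m' h' p q' := by
  obtain rfl : m = m' := funext hm
  obtain rfl : q = q' := funext fun i => eq_of_heq (hq i)
  rfl

theorem Hom.map_treeInputs {O : AlgOperad.{u} K} {Q : AlgOperad.{v} K} (F : O.Hom Q)
    (x : O.obj 2) : (fun i => F.app _ (O.treeInputs x i)) = Q.treeInputs (F.app 2 x) := by
  funext i
  match i with
  | ⟨0, _⟩ => rfl
  | ⟨_ + 1, _⟩ => exact F.map_one

theorem Hom.map_tree {O : AlgOperad.{u} K} {Q : AlgOperad.{v} K} (F : O.Hom Q) (c : Fin 3)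
    (x y : O.obj 2) : F.app 3 (O.tree c x y) = Q.tree c (F.app 2 x) (F.app 2 y) := by
  simp only [tree, LinearMap.mk₂_apply, F.map_act]
  exact congrArg (Q.act · _) ((F.map_comp _ _ _ _).trans
    (congrArg (Q.comp _ _ _) (F.map_treeInputs x)))

/-- The morphism underlying an isomorphism. -/
def Iso.toHom {O : AlgOperad.{u} K} {Q : AlgOperad.{v} K} (F : O.Iso Q) : O.Hom Q where
  app n := (F.toEquiv n).toLinearMap
  map_one := F.map_one
  map_act := F.map_act
  map_comp := F.map_comp

/-- A bijective morphism is an isomorphism. -/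
def Hom.toIso {O : AlgOperad.{u} K} {Q : AlgOperad.{v} K} (F : O.Hom Q)
    (hF : ∀ n, Function.Bijective (F.app n)) : O.Iso Q where
  toEquiv n := LinearEquiv.ofBijective (F.app n) (hF n)
  map_one := F.map_one
  map_act := F.map_act
  map_comp := F.map_comp

end AlgOperad

section lift

variable {K : Type w} [Field K] {V : Type v} [AddCommGroup V] [Module K V]
  (A : AlgOperad.{u} K) (f : V →ₗ[K] A.obj 2)

/-- The value of a formal expression in an operad. -/
def FreeTerm.eval : ∀ {n : ℕ+}, FreeTerm K V n → A.obj n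
  | _, .gen v => f v
  | _, .one => A.one
  | _, .act t σ => A.act (eval t) σ
  | _, .comp m h t s => A.comp m h (eval t) fun i => eval (s i)
  | _, .zero => 0
  | _, .add t t' => eval t + eval t'
  | _, .smul c t => c • eval t

theorem FreeTerm.eval_update {k : ℕ} {m : Fin k → ℕ+} (q : ∀ i, FreeTerm K V (m i)) (i : Fin k)
    (x : FreeTerm K V (m i)) :
    (fun j => FreeTerm.eval A f (Function.update q i x j)) =
      Function.update (fun j => FreeTerm.eval A f (q j)) i (FreeTerm.eval A f x) := by
  funext j
  exact Function.apply_update (fun j => FreeTerm.eval A f (n := m j)) q i x j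

variable {A f} {swap : V →ₗ[K] V}

theorem FreeTerm.eval_eq_of_freeRel
    (hf : ∀ v, A.act (f v) (Equiv.swap (0 : Fin (2 : ℕ+)) 1) = f (swap v))
    {n : ℕ+} {t t' : FreeTerm K V n} (h : FreeRel swap t t') :
    FreeTerm.eval A f t = FreeTerm.eval A f t' := by
  induction h with
  | refl t => rfl
  | symm _ ih => exact ih.symm
  | trans _ _ ih ih' => exact ih.trans ih'
  | act_congr σ _ ih => exact congrArg (A.act · σ) ih
  | comp_congr m h _ _ ih ih' =>
    simp only [FreeTerm.eval, ih]
    exact congrArg _ (funext ih')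
  | add_congr _ _ ih ih' => simp only [FreeTerm.eval, ih, ih']
  | smul_congr c _ ih => simp only [FreeTerm.eval, ih]
  | add_assoc => exact add_assoc _ _ _
  | add_comm => exact add_comm _ _
  | zero_add => exact zero_add _
  | neg_add => simp [FreeTerm.eval]
  | one_smul => exact one_smul K _
  | mul_smul => exact mul_smul _ _ _
  | smul_add => exact smul_add _ _ _
  | add_smul => exact add_smul _ _ _
  | act_one => exact A.act_one _
  | act_mul => exact A.act_mul _ _ _
  | one_comp h t => exact A.one_comp h _
  | comp_one h t => exact A.comp_one h _
  | comp_assoc a ha b s hb hs hN p q r =>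
    exact A.comp_assoc a ha b s hb hs hN _ _ fun i j => FreeTerm.eval A f (r i j)
  | comp_act_left m h τ h' p q =>
    exact A.comp_act_left m h τ h' _ fun i => FreeTerm.eval A f (q i)
  | comp_act_right m h σ p q => exact A.comp_act_right m h σ _ _
  | act_add => exact A.act_add _ _ _
  | act_smul => exact A.act_smul _ _ _
  | comp_add_left => exact A.comp_add_left _ _ _ _ _
  | comp_smul_left => exact A.comp_smul_left _ _ _ _ _
  | comp_update_add m h p q i x y =>
    simp only [FreeTerm.eval, FreeTerm.eval_update]
    exact A.comp_update_add m h _ _ i _ _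
  | comp_update_smul m h p q i c x =>
    simp only [FreeTerm.eval, FreeTerm.eval_update]
    exact A.comp_update_smul m h _ _ i c _
  | gen_add => exact f.map_add _ _
  | gen_smul => exact f.map_smul _ _
  | gen_swap v => exact hf v

/-- The universal property of the free operad. -/
def FreeOperad.lift
    (hf : ∀ v, A.act (f v) (Equiv.swap (0 : Fin (2 : ℕ+)) 1) = f (swap v)) :
    (FreeOperad swap).Hom A where
  app n :=
    { toFun := fun x => Quotient.lift (FreeTerm.eval A f)
        (fun _ _ h => FreeTerm.eval_eq_of_freeRel hf h) x
      map_add' := by rintro ⟨x⟩ ⟨y⟩; rfl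
      map_smul' := by rintro c ⟨x⟩; rfl }
  map_one := rfl
  map_act := by rintro n ⟨x⟩ σ; rfl
  map_comp := by
    intro k n m h p q
    obtain ⟨p, rfl⟩ := FreeObj.exists_mk p
    obtain ⟨q, rfl⟩ := FreeObj.exists_mk_family q
    exact congrArg _ (FreeObj.comp_mk m h p q)

end lift

namespace AlgOperad

variable {K : Type w} [Field K] {O : AlgOperad.{u} K} {A : AlgOperad.{v} K}

theorem comp_update_zero (A : AlgOperad.{v} K) {k n : ℕ+} (m : Fin k → ℕ+)
    (h : ∑ i, (m i : ℕ) = n) (p : A.obj k) (q : ∀ i, A.obj (m i)) (i : Fin k) (hq : q i = 0) :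
    A.comp m h p q = 0 := by
  have := A.comp_update_smul m h p q i 0 0
  rwa [zero_smul, zero_smul, ← hq, Function.update_eq_self] at this

theorem zero_comp (A : AlgOperad.{v} K) {k n : ℕ+} (m : Fin k → ℕ+)
    (h : ∑ i, (m i : ℕ) = n) (q : ∀ i, A.obj (m i)) : A.comp m h 0 q = 0 := by
  simpa using A.comp_smul_left m h 0 0 q

theorem zero_act (A : AlgOperad.{v} K) {n : ℕ+} (σ : Equiv.Perm (Fin n)) :
    A.act (0 : A.obj n) σ = 0 := by
  simpa using A.act_smul 0 (0 : A.obj n) σ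

theorem Hom.map_eq_zero_of_idealMem (F : O.Hom A) {S : ∀ n, Set (O.obj n)}
    (hS : ∀ n, ∀ x ∈ S n, F.app n x = 0) {n : ℕ+} {x : O.obj n} (hx : O.IdealMem S n x) :
    F.app n x = 0 := by
  induction hx with
  | of x hx => exact hS _ x hx
  | zero => exact map_zero _
  | add x y _ _ hx hy => rw [map_add, hx, hy, add_zero]
  | smul c x _ hx => rw [map_smul, hx, smul_zero]
  | act x σ _ hx => rw [F.map_act, hx, A.zero_act]
  | comp_left m h p q _ hp => rw [F.map_comp, hp, A.zero_comp]
  | comp_right m h p q i _ hq => rw [F.map_comp, A.comp_update_zero _ _ _ _ i hq]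

/-- The universal property of the quotient of an operad. -/
def quotientLift (F : O.Hom A) (S : ∀ n, Set (O.obj n))
    (hS : ∀ n, ∀ x ∈ S n, F.app n x = 0) : (O.quotient S).Hom A where
  app n := (O.ideal S n).liftQ (F.app n) fun _ hx => F.map_eq_zero_of_idealMem hS hx
  map_one := F.map_one
  map_act x σ := by
    obtain ⟨x, rfl⟩ := O.quotMk_surj S _ x
    exact F.map_act x σ
  map_comp m h p q := by
    obtain ⟨p, rfl⟩ := O.quotMk_surj S _ p
    obtain ⟨q, rfl⟩ := O.exists_quotMk_family S q
    exact (congrArg _ (O.quotComp_mk S m h p q)).trans (F.map_comp m h p q)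

end AlgOperad

namespace BinaryQuadratic

variable {K : Type u} [Field K] (D : BinaryQuadratic.{u, v} K)

/-- The value, in an operad, of an element of `V ⊗ V` placed on the tree of the `c`-th kind, where
the upper vertex is interpreted by `f` and the lower one by `g`. -/
def treeMap (A : AlgOperad.{w} K) {V : Type v} [AddCommGroup V] [Module K V] (f g : V →ₗ[K] A.obj 2)
    (c : Fin 3) : V ⊗[K] V →ₗ[K] A.obj 3 :=
  TensorProduct.lift ((A.tree c).compl₁₂ f g)

/-- The universal property of `F(V)/(R)`. -/
def lift (A : AlgOperad.{w} K) (f : D.V →ₗ[K] A.obj 2)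
    (hf : ∀ v, A.act (f v) (Equiv.swap (0 : Fin (2 : ℕ+)) 1) = f (D.swap v))
    (hr : ∀ r ∈ D.rel, ∑ c, treeMap A f f c (r c) = 0) : D.operad.Hom A :=
  AlgOperad.quotientLift (FreeOperad.lift hf) _ (by
    rintro n x ⟨r, h⟩
    rw [treeSum, map_sum, ← hr r h]
    refine Finset.sum_congr rfl fun c _ => ?_
    change ((FreeOperad.lift hf).app 3 ∘ₗ treeMap _ _ _ c) (r c) = _
    congr 1
    ext x y
    exact (FreeOperad.lift hf).map_tree c _ _)

theorem act_gen (v : D.V) :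
    D.operad.act (D.gen v) (Equiv.swap (0 : Fin (2 : ℕ+)) 1) = D.gen (D.swap v) :=
  congrArg (AlgOperad.quotMk _ _ 2) (FreeObj.sound (.gen_swap v))

/-- The quotient morphism `F(V) → F(V)/(R)`. -/
def quotientHom : (FreeOperad D.swap).Hom D.operad where
  app n := AlgOperad.quotMk _ _ n
  map_one := rfl
  map_act _ _ := rfl
  map_comp m h p q := (AlgOperad.quotComp_mk _ _ m h p q).symm

theorem rel_eq_zero {r : Fin 3 → D.V ⊗[K] D.V} (h : r ∈ D.rel) :
    ∑ c, treeMap D.operad D.gen D.gen c (r c) = 0 := by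
  have h0 : AlgOperad.quotMk _ (fun n => {x | D.IsRelator n x}) 3 (D.treeSum r) = 0 :=
    (Submodule.Quotient.mk_eq_zero _).2 (.of _ (.mk r h))
  rw [treeSum, map_sum] at h0
  refine Eq.trans (Finset.sum_congr rfl fun c _ => ?_) h0
  change _ = (D.quotientHom.app 3 ∘ₗ treeMap _ _ _ c) (r c)
  congr 1
  ext x y
  exact (D.quotientHom.map_tree c _ _).symm

end BinaryQuadratic

/-! ## Planar monomials -/

namespace AlgOperad

variable {K : Type w} [Field K] (A : AlgOperad.{u} K)

theorem comp_comp {k n N : ℕ+} (a : Fin k → ℕ+) (ha : ∑ i, (a i : ℕ) = n)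
    (m : Fin n → ℕ+) (h : ∑ l, (m l : ℕ) = N) (p : A.obj k) (x : ∀ i, A.obj (a i))
    (q : ∀ l, A.obj (m l)) (b : ∀ i, Fin (a i) → ℕ+) (s : Fin k → ℕ+)
    (hb : ∀ i, ∑ j, (b i j : ℕ) = s i) (hs : ∑ i, (s i : ℕ) = N) (r : ∀ i j, A.obj (b i j))
    (hm : ∀ i j, m (blockEquiv a ha ⟨i, j⟩) = b i j)
    (hq : ∀ i j, HEq (q (blockEquiv a ha ⟨i, j⟩)) (r i j)) :
    A.comp m h (A.comp a ha p x) q = A.comp s hs p fun i => A.comp (b i) (hb i) (x i) (r i) := by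
  have hm' : ∀ l, m l = b ((blockEquiv a ha).symm l).1 ((blockEquiv a ha).symm l).2 := fun l => by
    rw [← hm]
    exact congrArg m ((blockEquiv a ha).apply_symm_apply l).symm
  have hq' : ∀ l, HEq (q l) (r ((blockEquiv a ha).symm l).1 ((blockEquiv a ha).symm l).2) :=
    fun l => by
      refine HEq.trans ?_ (hq _ _)
      rw [show (⟨((blockEquiv a ha).symm l).1, ((blockEquiv a ha).symm l).2⟩ :
        Σ i, Fin (a i)) = (blockEquiv a ha).symm l from rfl, Equiv.apply_symm_apply]
  have hN : ∑ l, (b ((blockEquiv a ha).symm l).1 ((blockEquiv a ha).symm l).2 : ℕ) = N := by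
    rw [← h]
    exact Finset.sum_congr rfl fun l _ => by rw [hm']
  rw [← A.comp_assoc a ha b s hb hs hN p x r]
  exact A.comp_congr h hN _ hm' hq'

theorem exists_comp_act_left {k n : ℕ+} (m : Fin k → ℕ+) (h : ∑ i, (m i : ℕ) = n)
    (p : A.obj k) (τ : Equiv.Perm (Fin k)) (q : ∀ i, A.obj (m i)) :
    ∃ (h' : ∑ i, (m (τ.symm i) : ℕ) = n) (ρ : Equiv.Perm (Fin n)),
      A.comp m h (A.act p τ) q =
        A.act (A.comp (fun i => m (τ.symm i)) h' p fun i => q (τ.symm i)) ρ := by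
  have h' : ∑ i, (m (τ.symm i) : ℕ) = n := by
    rw [Equiv.sum_comp τ.symm (fun i => (m i : ℕ)), h]
  have h'' : ∑ i, (m (τ.symm (τ i)) : ℕ) = n := by simpa using h
  refine ⟨h', blockPerm τ (fun i => m (τ.symm i)) h' h'', ?_⟩
  rw [← A.comp_act_left (fun i => m (τ.symm i)) h' τ h'' p fun i => q (τ.symm i)]
  exact A.comp_congr h h'' _ (fun i => by simp) fun i => by rw [Equiv.symm_apply_apply]

theorem comp_one_left {k : ℕ+} (m : Fin (1 : ℕ+) → ℕ+) (h : ∑ i, (m i : ℕ) = k)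
    (q : ∀ i, A.obj (m i)) {p : ∀ n, A.obj n → Prop} (hp : p (m 0) (q 0)) :
    p k (A.comp m h A.one q) := by
  have hk : m 0 = k := PNat.coe_injective ((Fin.sum_univ_one fun i : Fin 1 => (m i : ℕ)).symm.trans h)
  subst hk
  have h0 : ∀ i, i = (0 : Fin (1 : ℕ+)) := fun i => Subsingleton.elim (α := Fin 1) _ _
  have := A.one_comp (Fin.sum_univ_one fun i : Fin 1 => (m 0 : ℕ)) (q 0)
  rw [← this] at hp
  convert hp using 1
  exact A.comp_congr _ _ _ (fun i => by rw [h0 i]) fun i => by rw [h0 i]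

theorem comp_mem_of_mem_span {k n : ℕ+} (m : Fin k → ℕ+) (h : ∑ i, (m i : ℕ) = n) (p : A.obj k)
    (S : ∀ n, Set (A.obj n)) (W : Submodule K (A.obj n))
    (hS : ∀ q : ∀ i, A.obj (m i), (∀ i, q i ∈ S (m i)) → A.comp m h p q ∈ W)
    (q : ∀ i, A.obj (m i)) (hq : ∀ i, q i ∈ Submodule.span K (S (m i))) :
    A.comp m h p q ∈ W := by
  have key : ∀ (s : Finset (Fin k)) (q : ∀ i, A.obj (m i)), (∀ i ∉ s, q i ∈ S (m i)) →
      (∀ i, q i ∈ Submodule.span K (S (m i))) → A.comp m h p q ∈ W := by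
    intro s
    induction s using Finset.induction_on with
    | empty => exact fun q hq _ => hS q fun i => hq i (Finset.notMem_empty i)
    | insert i s hi ih =>
      intro q h1 h2
      have : ∀ x ∈ Submodule.span K (S (m i)), A.comp m h p (Function.update q i x) ∈ W := by
        intro x hx
        induction hx using Submodule.span_induction with
        | mem x hx =>
          refine ih _ (fun j hj => ?_) fun j => ?_
          · rcases eq_or_ne j i with rfl | hji
            · rwa [Function.update_self]
            · rw [Function.update_of_ne hji]
              exact h1 j fun h => (Finset.mem_insert.1 h).elim hji hj
          · rcases eq_or_ne j i with rfl | hji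
            · rw [Function.update_self]
              exact Submodule.subset_span hx
            · rw [Function.update_of_ne hji]
              exact h2 j
        | zero =>
          rw [A.comp_update_zero m h p _ i (Function.update_self _ _ _)]
          exact W.zero_mem
        | add x y _ _ hx hy =>
          rw [A.comp_update_add]
          exact W.add_mem hx hy
        | smul c x _ hx =>
          rw [A.comp_update_smul]
          exact W.smul_mem c hx
      simpa using this (q i) (h2 i)
  exact key Finset.univ q (fun i hi => absurd (Finset.mem_univ i) hi) hq

variable (G : Set (A.obj 2))

/-- The planar monomials in a set of binary operations. -/
inductive Planar : ∀ n : ℕ+, A.obj n → Prop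
  | one : Planar 1 A.one
  | node {n : ℕ+} (m : Fin (2 : ℕ+) → ℕ+) (h : ∑ i, (m i : ℕ) = n) (v : A.obj 2)
      (x : ∀ i, A.obj (m i)) : v ∈ G → (∀ i, Planar (m i) (x i)) → Planar n (A.comp m h v x)

/-- The planar monomials with permuted inputs. -/
def permutedPlanar (n : ℕ+) : Set (A.obj n) :=
  {x | ∃ a σ, A.Planar G n a ∧ A.act a σ = x}

/-- The linear combinations of planar monomials with permuted inputs. -/
def planarSpan (n : ℕ+) : Submodule K (A.obj n) :=
  Submodule.span K (A.permutedPlanar G n)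

variable {A G}

theorem Planar.mem_planarSpan {n : ℕ+} {x : A.obj n} (hx : A.Planar G n x) :
    x ∈ A.planarSpan G n :=
  Submodule.subset_span ⟨x, 1, hx, A.act_one x⟩

theorem act_mem_planarSpan {n : ℕ+} {x : A.obj n} (hx : x ∈ A.planarSpan G n)
    (σ : Equiv.Perm (Fin n)) : A.act x σ ∈ A.planarSpan G n := by
  induction hx using Submodule.span_induction with
  | mem x hx =>
    obtain ⟨a, τ, ha, rfl⟩ := hx
    exact Submodule.subset_span ⟨a, τ * σ, ha, A.act_mul a τ σ⟩
  | zero => rw [A.zero_act]; exact Submodule.zero_mem _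
  | add x y _ _ hx hy => rw [A.act_add]; exact Submodule.add_mem _ hx hy
  | smul c x _ hx => rw [A.act_smul]; exact Submodule.smul_mem _ c hx

theorem node_mem_planarSpan {n : ℕ+} (m : Fin (2 : ℕ+) → ℕ+) (h : ∑ i, (m i : ℕ) = n)
    {v : A.obj 2} (hv : v ∈ G) (x : ∀ i, A.obj (m i)) (hx : ∀ i, x i ∈ A.planarSpan G (m i)) :
    A.comp m h v x ∈ A.planarSpan G n := by
  refine A.comp_mem_of_mem_span m h v (A.permutedPlanar G) _ (fun q hq => ?_) x hx
  choose a σ ha hσ using hq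
  obtain rfl : (fun i => A.act (a i) (σ i)) = q := funext hσ
  rw [A.comp_act_right]
  exact Submodule.subset_span ⟨_, _, .node m h v a hv ha, rfl⟩

theorem Planar.comp_mem {k : ℕ+} {p : A.obj k} (hp : A.Planar G k p) :
    ∀ {n : ℕ+} (m : Fin k → ℕ+) (h : ∑ i, (m i : ℕ) = n) (q : ∀ i, A.obj (m i)),
      (∀ i, q i ∈ A.planarSpan G (m i)) → A.comp m h p q ∈ A.planarSpan G n := by
  induction hp with
  | one =>
    intro n m h q hq
    exact A.comp_one_left m h q (p := fun n x => x ∈ A.planarSpan G n) (hq 0)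
  | @node n a ha v x hv _ ih =>
    intro N m h q hq
    have hpos : ∀ i, 0 < ∑ j, (m (blockEquiv a ha ⟨i, j⟩) : ℕ) := fun i =>
      Finset.sum_pos (fun j _ => (m _).pos) ⟨⟨0, (a i).pos⟩, Finset.mem_univ _⟩
    have hs : ∑ i, ∑ j, (m (blockEquiv a ha ⟨i, j⟩) : ℕ) = N := by
      rw [← h, ← Equiv.sum_comp (blockEquiv a ha), Fintype.sum_sigma]
    rw [A.comp_comp a ha m h v x q (fun i j => m (blockEquiv a ha ⟨i, j⟩))
      (fun i => ⟨_, hpos i⟩) (fun i => rfl) hs (fun i j => q (blockEquiv a ha ⟨i, j⟩))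
      (fun _ _ => rfl) (fun _ _ => HEq.rfl)]
    exact node_mem_planarSpan _ _ hv _ fun i => ih i _ _ _ fun j => hq _

theorem comp_mem_planarSpan {k n : ℕ+} {p : A.obj k} (hp : p ∈ A.planarSpan G k)
    (m : Fin k → ℕ+) (h : ∑ i, (m i : ℕ) = n) (q : ∀ i, A.obj (m i))
    (hq : ∀ i, q i ∈ A.planarSpan G (m i)) : A.comp m h p q ∈ A.planarSpan G n := by
  induction hp using Submodule.span_induction with
  | mem p hp =>
    obtain ⟨a, τ, ha, rfl⟩ := hp
    obtain ⟨h', ρ, h''⟩ := A.exists_comp_act_left m h a τ q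
    rw [h'']
    exact act_mem_planarSpan (ha.comp_mem _ _ _ fun i => hq _) _
  | zero => rw [A.zero_comp]; exact Submodule.zero_mem _
  | add x y _ _ hx hy => rw [A.comp_add_left]; exact Submodule.add_mem _ hx hy
  | smul c x _ hx => rw [A.comp_smul_left]; exact Submodule.smul_mem _ c hx

theorem subset_planarSpan : G ⊆ A.planarSpan G 2 := fun v hv => by
  have := A.comp_one (n := 2) rfl v
  rw [← this]
  exact (Planar.node _ _ v _ hv fun _ => .one).mem_planarSpan

end AlgOperad

theorem BinaryQuadratic.planarSpan_eq_top {K : Type u} [Field K] (D : BinaryQuadratic.{u, v} K)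
    (G : Set (D.operad.obj 2)) (hG : ∀ v, D.gen v ∈ Submodule.span K G) (n : ℕ+) :
    D.operad.planarSpan G n = ⊤ := by
  refine top_unique fun x _ => ?_
  obtain ⟨x, rfl⟩ := AlgOperad.quotMk_surj _ _ n x
  obtain ⟨t, rfl⟩ := FreeObj.exists_mk x
  change D.quotientHom.app n (FreeObj.mk t) ∈ _
  induction t with
  | gen v => exact Submodule.span_le.2 AlgOperad.subset_planarSpan (hG v)
  | one => exact AlgOperad.Planar.one.mem_planarSpan
  | act t σ ih => exact AlgOperad.act_mem_planarSpan (ih trivial) σ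
  | comp m h t s ih ih' =>
    rw [← FreeObj.comp_mk]
    have := D.quotientHom.map_comp m h (FreeObj.mk t) fun i => FreeObj.mk (s i)
    refine (congrArg (· ∈ D.operad.planarSpan G _) this).mpr ?_
    exact AlgOperad.comp_mem_planarSpan (ih trivial) m h _ fun i => ih' i trivial
  | zero => exact (D.operad.planarSpan G _).zero_mem
  | add t t' ih ih' => exact (D.operad.planarSpan G _).add_mem (ih trivial) (ih' trivial)
  | smul c t ih => exact (D.operad.planarSpan G _).smul_mem c (ih trivial)

/-! ## Numbering the inputs of a composite -/

theorem blockEquiv_val {k : ℕ} (m : Fin k → ℕ+) {n : ℕ+} (h : ∑ i, (m i : ℕ) = n) (i : Fin k)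
    (j : Fin (m i)) :
    (blockEquiv m h ⟨i, j⟩ : ℕ) = (∑ i', if i' < i then (m i' : ℕ) else 0) + j := by
  simp only [blockEquiv, Equiv.trans_apply, finCongr_apply, Fin.val_cast, finSigmaFinEquiv_apply]
  congr 1
  rw [← Finset.sum_filter]
  refine Finset.sum_nbij (Fin.castLE i.2.le) ?_ ?_ ?_ ?_
  · intro a _
    exact Finset.mem_filter.2 ⟨Finset.mem_univ _, a.2⟩
  · exact fun a _ b _ hab => Fin.castLE_injective _ hab
  · intro a ha
    have ha : a < i := by simpa using ha
    exact ⟨⟨a, ha⟩, by simp, rfl⟩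
  · exact fun _ _ => rfl

theorem blockEquiv_lt_iff {k : ℕ} (m : Fin k → ℕ+) {n : ℕ+} (h : ∑ i, (m i : ℕ) = n)
    (i i' : Fin k) (j : Fin (m i)) (j' : Fin (m i')) :
    blockEquiv m h ⟨i, j⟩ < blockEquiv m h ⟨i', j'⟩ ↔ i < i' ∨ i = i' ∧ (j : ℕ) < j' := by
  have key : ∀ (i i' : Fin k) (j : Fin (m i)) (j' : Fin (m i')), i < i' →
      blockEquiv m h ⟨i, j⟩ < blockEquiv m h ⟨i', j'⟩ := by
    intro i i' j j' hi
    rw [Fin.lt_def, blockEquiv_val, blockEquiv_val]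
    have h1 : (∑ a, if a < i then (m a : ℕ) else 0) + m i ≤ ∑ a, if a < i' then (m a : ℕ) else 0 := by
      have h2 : (∑ a, if a = i then (m a : ℕ) else 0) = m i := by simp
      rw [← h2, ← Finset.sum_add_distrib]
      refine Finset.sum_le_sum fun a _ => ?_
      rcases lt_trichotomy a i with ha | rfl | ha
      · simp [ha, ha.ne, ha.trans hi]
      · simp [hi]
      · simp [ha.ne', ha.not_gt]
    have := j.2
    omega
  rcases lt_trichotomy i i' with hi | rfl | hi
  · simp [hi, key i i' j j' hi]
  · rw [Fin.lt_def, blockEquiv_val, blockEquiv_val]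
    simp
  · simp [hi.not_gt, hi.ne', (key i' i j' j hi).le]

/-- The blocks of blocks are numbered consistently. -/
theorem blockEquiv_assoc {k n N : ℕ+} (a : Fin k → ℕ+) (ha : ∑ i, (a i : ℕ) = n)
    (b : ∀ i, Fin (a i) → ℕ+) (s : Fin k → ℕ+) (hb : ∀ i, ∑ j, (b i j : ℕ) = s i)
    (hs : ∑ i, (s i : ℕ) = N)
    (hN : ∑ l, (b ((blockEquiv a ha).symm l).1 ((blockEquiv a ha).symm l).2 : ℕ) = N)
    (l : Fin n) (t : Fin (b ((blockEquiv a ha).symm l).1 ((blockEquiv a ha).symm l).2)) :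
    blockEquiv (fun l => b ((blockEquiv a ha).symm l).1 ((blockEquiv a ha).symm l).2) hN ⟨l, t⟩ =
      blockEquiv s hs ⟨((blockEquiv a ha).symm l).1,
        blockEquiv (b _) (hb _) ⟨((blockEquiv a ha).symm l).2, t⟩⟩ := by
  apply Fin.ext
  rw [blockEquiv_val, blockEquiv_val, blockEquiv_val, ← add_assoc]
  congr 1
  rw [← Equiv.sum_comp (blockEquiv a ha), Fintype.sum_sigma]
  obtain ⟨⟨i, j⟩, rfl⟩ := (blockEquiv a ha).surjective l
  simp only [blockEquiv_lt_iff]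
  have h1 : ∀ i' j', (b ((blockEquiv a ha).symm (blockEquiv a ha ⟨i', j'⟩)).1
      ((blockEquiv a ha).symm (blockEquiv a ha ⟨i', j'⟩)).2) = b i' j' := fun i' j' => by
    rw [Equiv.symm_apply_apply]
  simp only [h1]
  have h2 : ∀ x : Σ i, Fin (a i), (blockEquiv a ha).symm (blockEquiv a ha x) = x :=
    fun x => Equiv.symm_apply_apply _ _
  rw [h2]
  have h3 : (∑ j', if j' < j then (b i j' : ℕ) else 0) =
      ∑ i', if i' = i then (∑ j' : Fin (a i'), if (j' : ℕ) < j then (b i' j' : ℕ) else 0) else 0 := by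
    simp
  rw [h3, ← Finset.sum_add_distrib]
  refine Finset.sum_congr rfl fun i' _ => ?_
  rcases lt_trichotomy i' i with hi | rfl | hi
  · simp [hi, hi.ne, ← hb i']
  · simp
  · simp [hi.not_gt, hi.ne']

theorem blockEquiv_one {n : ℕ+} (h : ∑ _ : Fin (1 : ℕ+), (n : ℕ) = n) (i : Fin (1 : ℕ+))
    (j : Fin n) : blockEquiv (fun _ : Fin (1 : ℕ+) => n) h ⟨i, j⟩ = j := by
  apply Fin.ext
  rw [blockEquiv_val]
  simp [show i = 0 from Subsingleton.elim (α := Fin 1) i 0]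

theorem blockEquiv_ones {n : ℕ+} (h : ∑ _ : Fin n, ((1 : ℕ+) : ℕ) = n) (i : Fin n)
    (j : Fin (1 : ℕ+)) : blockEquiv (fun _ : Fin n => 1) h ⟨i, j⟩ = i := by
  apply Fin.ext
  rw [blockEquiv_val]
  have hj : (j : ℕ) = 0 := Nat.lt_one_iff.1 j.2
  have : (Finset.univ.filter fun i' : Fin n => i' < i) = Finset.Iio i := by ext; simp
  simp [hj, this]

theorem blockPerm_apply {k : ℕ} (τ : Equiv.Perm (Fin k)) (m : Fin k → ℕ+) {n : ℕ+}
    (h : ∑ i, (m i : ℕ) = n) (h' : ∑ i, (m (τ i) : ℕ) = n) (i : Fin k) (j : Fin (m (τ i))) :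
    blockPerm τ m h h' (blockEquiv (fun i => m (τ i)) h' ⟨i, j⟩) = blockEquiv m h ⟨τ i, j⟩ := by
  simp only [blockPerm, Equiv.trans_apply, Equiv.symm_apply_apply]
  rfl

theorem sumPerm_apply {k : ℕ} (m : Fin k → ℕ+) {n : ℕ+} (h : ∑ i, (m i : ℕ) = n)
    (σ : ∀ i, Equiv.Perm (Fin (m i))) (i : Fin k) (j : Fin (m i)) :
    sumPerm m h σ (blockEquiv m h ⟨i, j⟩) = blockEquiv m h ⟨i, σ i j⟩ := by
  simp only [sumPerm, Equiv.trans_apply, Equiv.symm_apply_apply]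
  rfl

/-! ## Operations that depend on a set of marked inputs -/

/-- The operad of families of operations that depend on a set of marked inputs: in a composite, the
`i`-th input of the outer operation counts as marked if all the inputs above it are. -/
def AlgOperad.marked {K : Type w} [Field K] (A : AlgOperad.{u} K) : AlgOperad.{u} K where
  obj n := (Fin n → Prop) → A.obj n
  act f σ x := A.act (f (x ∘ σ.symm)) σ
  one _ := A.one
  comp m h f g x := A.comp m h (f fun i => ∀ j, x (blockEquiv m h ⟨i, j⟩))
    fun i => g i fun j => x (blockEquiv m h ⟨i, j⟩)
  act_one f := funext fun x => A.act_one _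
  act_mul f σ τ := funext fun x => A.act_mul _ _ _
  one_comp h f := by
    funext x
    simp only [blockEquiv_one]
    exact A.one_comp h _
  comp_one h f := by
    funext x
    simp only [blockEquiv_ones]
    refine (A.comp_one h _).trans (congrArg f (funext fun i => propext ?_))
    exact ⟨fun hx => hx 0, fun hx _ => hx⟩
  comp_assoc a ha b s hb hs hN p q r := by
    funext x
    have h1 := fun l t => congrArg x (blockEquiv_assoc a ha b s hb hs hN l t)
    have h2 : ∀ l c, (blockEquiv a ha).symm l = c → (∀ t, x (blockEquiv
        (fun l => b ((blockEquiv a ha).symm l).1 ((blockEquiv a ha).symm l).2) hN ⟨l, t⟩)) =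
          ∀ t, x (blockEquiv s hs ⟨c.1, blockEquiv (b c.1) (hb c.1) ⟨c.2, t⟩⟩) := by
      rintro l _ rfl
      simp only [h1]
    have h3 := fun i j => h2 _ ⟨i, j⟩ ((blockEquiv a ha).symm_apply_apply ⟨i, j⟩)
    have h4 : ∀ i, (∀ j t, x (blockEquiv s hs ⟨i, blockEquiv (b i) (hb i) ⟨j, t⟩⟩)) =
        ∀ u, x (blockEquiv s hs ⟨i, u⟩) := fun i => propext
      ⟨fun hx u => by
        obtain ⟨⟨j, t⟩, rfl⟩ := (blockEquiv (b i) (hb i)).surjective u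
        exact hx j t, fun hx j t => hx _⟩
    simp only [h3, h4]
    simp only [h1]
    exact A.comp_assoc a ha b s hb hs hN _
      (fun i => q i fun j => ∀ t, x (blockEquiv s hs ⟨i, blockEquiv (b i) (hb i) ⟨j, t⟩⟩))
      (fun i j => r i j fun t => x (blockEquiv s hs ⟨i, blockEquiv (b i) (hb i) ⟨j, t⟩⟩))
  comp_act_left m h τ h' p q := by
    funext x
    have h1 : ∀ i j, (x ∘ (blockPerm τ m h h').symm) (blockEquiv m h ⟨τ i, j⟩) =
        x (blockEquiv (fun i => m (τ i)) h' ⟨i, j⟩) := fun i j => by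
      rw [← blockPerm_apply τ m h h', Function.comp_apply, Equiv.symm_apply_apply]
    have := A.comp_act_left m h τ h'
      (p fun i => ∀ j, (x ∘ (blockPerm τ m h h').symm) (blockEquiv m h ⟨i, j⟩))
      (fun i => q i fun j => (x ∘ (blockPerm τ m h h').symm) (blockEquiv m h ⟨i, j⟩))
    refine Eq.trans ?_ this
    simp only [h1]
    congr 3
    funext i
    obtain ⟨i, rfl⟩ := τ.surjective i
    simp only [h1, Function.comp_apply]
    rw [Equiv.symm_apply_apply]
  comp_act_right m h σ p q := by
    funext x
    have h1 : ∀ i j, (x ∘ (sumPerm m h σ).symm) (blockEquiv m h ⟨i, j⟩) =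
        x (blockEquiv m h ⟨i, (σ i).symm j⟩) := fun i j => by
      rw [Function.comp_apply]
      congr 1
      rw [Equiv.symm_apply_eq, sumPerm_apply, Equiv.apply_symm_apply]
    simp only [h1]
    have := A.comp_act_right m h σ (p fun i => ∀ j, x (blockEquiv m h ⟨i, j⟩))
      (fun i => q i fun j => x (blockEquiv m h ⟨i, (σ i).symm j⟩))
    refine this.trans ?_
    congr 3
    funext i
    exact propext (Equiv.forall_congr_left (σ i))
  act_add x y σ := funext fun _ => A.act_add _ _ _
  act_smul c x σ := funext fun _ => A.act_smul _ _ _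
  comp_add_left m h p p' q := funext fun _ => A.comp_add_left _ _ _ _ _
  comp_smul_left m h c p q := funext fun _ => A.comp_smul_left _ _ _ _ _
  comp_update_add m h p q i f g := funext fun x => by
    have h1 := fun φ => funext fun i' => Function.apply_update
      (fun i' (φ : (Fin (m i') → Prop) → A.obj (m i')) => φ fun j => x (blockEquiv m h ⟨i', j⟩))
      q i φ i'
    simp only [Pi.add_apply, h1]
    exact A.comp_update_add _ _ _ _ _ _ _
  comp_update_smul m h p q i c f := funext fun x => by
    have h1 := fun φ => funext fun i' => Function.apply_update
      (fun i' (φ : (Fin (m i') → Prop) → A.obj (m i')) => φ fun j => x (blockEquiv m h ⟨i', j⟩))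
      q i φ i'
    simp only [Pi.smul_apply, h1]
    exact A.comp_update_smul _ _ _ _ _ _ _

/-! ## Composites with binary operations -/

/-- The arities of the two inputs of a binary operation. -/
def pairArity (k l : ℕ+) : Fin (2 : ℕ+) → ℕ+
  | ⟨0, _⟩ => k
  | ⟨_ + 1, _⟩ => l

theorem pairArity_sum {k l n : ℕ+} (h : k + l = n) : ∑ i, (pairArity k l i : ℕ) = n := by
  subst h
  exact Fin.sum_univ_two fun i : Fin 2 => (pairArity k l i : ℕ)

theorem pairArity_add {m : Fin (2 : ℕ+) → ℕ+} {n : ℕ+} (h : ∑ i, (m i : ℕ) = n) :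
    m 0 + m 1 = n :=
  PNat.coe_injective ((Fin.sum_univ_two fun i : Fin 2 => (m i : ℕ)).symm.trans h)

theorem Fin.eq_zero_or_one (i : Fin (2 : ℕ+)) : i = 0 ∨ i = 1 := by
  match i with
  | ⟨0, _⟩ => exact .inl rfl
  | ⟨1, _⟩ => exact .inr rfl

namespace AlgOperad

variable {K : Type w} [Field K] (A : AlgOperad.{u} K)

/-- The two inputs of a binary operation. -/
def pairInputs {k l : ℕ+} (a : A.obj k) (b : A.obj l) : ∀ i, A.obj (pairArity k l i)
  | ⟨0, _⟩ => a
  | ⟨_ + 1, _⟩ => b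

/-- The composite `μ(v; a, b)` with a binary operation `v`. -/
def bin {k l n : ℕ+} (h : k + l = n) (v : A.obj 2) (a : A.obj k) (b : A.obj l) : A.obj n :=
  A.comp (pairArity k l) (pairArity_sum h) v (A.pairInputs a b)

theorem comp_eq_bin {n : ℕ+} (m : Fin (2 : ℕ+) → ℕ+) (h : ∑ i, (m i : ℕ) = n) (v : A.obj 2)
    (x : ∀ i, A.obj (m i)) : A.comp m h v x = A.bin (pairArity_add h) v (x 0) (x 1) :=
  A.comp_congr _ _ _
    (fun i => by rcases Fin.eq_zero_or_one i with rfl | rfl <;> rfl)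
    fun i => by rcases Fin.eq_zero_or_one i with rfl | rfl <;> rfl

theorem tree_zero (x y : A.obj 2) : A.tree 0 x y = A.bin (n := 3) rfl y x A.one := by
  rw [tree, LinearMap.mk₂_apply]
  simp only [Fin.val_zero, pow_zero, inv_one, A.act_one]
  exact A.comp_eq_bin treeArity treeArity_sum y _

theorem exists_bin_act_swap {k l n : ℕ+} (h : k + l = n) (h' : l + k = n) :
    ∃ ρ : Equiv.Perm (Fin n), ∀ (v : A.obj 2) (a : A.obj k) (b : A.obj l),
      A.bin h' (A.act v (Equiv.swap (0 : Fin (2 : ℕ+)) 1)) b a = A.act (A.bin h v a b) ρ := by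
  have h'' : ∑ i, (pairArity k l (Equiv.swap (0 : Fin (2 : ℕ+)) 1 i) : ℕ) = n := by
    rw [Equiv.sum_comp (Equiv.swap (0 : Fin (2 : ℕ+)) 1) fun i => (pairArity k l i : ℕ),
      pairArity_sum h]
  refine ⟨blockPerm _ _ (pairArity_sum h) h'', fun v a b => ?_⟩
  rw [bin, bin, ← A.comp_act_left _ _ _ h'']
  exact A.comp_congr _ _ _
    (fun i => by rcases Fin.eq_zero_or_one i with rfl | rfl <;> rfl)
    fun i => by rcases Fin.eq_zero_or_one i with rfl | rfl <;> rfl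

/-- The arities of the three inputs of a ternary operation. -/
def tripleArity (k l m : ℕ+) : Fin (3 : ℕ+) → ℕ+
  | ⟨0, _⟩ => k
  | ⟨1, _⟩ => l
  | ⟨_ + 2, _⟩ => m

/-- The three inputs of a ternary operation. -/
def tripleInputs {k l m : ℕ+} (a : A.obj k) (b : A.obj l) (c : A.obj m) :
    ∀ i, A.obj (tripleArity k l m i)
  | ⟨0, _⟩ => a
  | ⟨1, _⟩ => b
  | ⟨_ + 2, _⟩ => c

theorem tripleArity_sum {k l m n : ℕ+} (h : k + l + m = n) :
    ∑ i, (tripleArity k l m i : ℕ) = n := by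
  subst h
  exact Fin.sum_univ_three fun i : Fin 3 => (tripleArity k l m i : ℕ)

/-- The composite `μ(x; a, b, c)` with a ternary operation `x`. -/
def tri {k l m n : ℕ+} (h : k + l + m = n) (x : A.obj 3) (a : A.obj k) (b : A.obj l)
    (c : A.obj m) : A.obj n :=
  A.comp (tripleArity k l m) (tripleArity_sum h) x (A.tripleInputs a b c)

theorem bin_bin_left {k l m r n : ℕ+} (h : k + l = r) (h' : r + m = n) (h'' : k + l + m = n)
    (v w : A.obj 2) (a : A.obj k) (b : A.obj l) (c : A.obj m) :
    A.bin h' w (A.bin h v a b) c = A.tri h'' (A.bin (n := 3) rfl w v A.one) a b c := by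
  subst h
  let β : ∀ i, Fin (pairArity 2 1 i) → ℕ+
    | ⟨0, _⟩ => pairArity k l
    | ⟨_ + 1, _⟩ => fun _ => m
  let r : ∀ i j, A.obj (β i j)
    | ⟨0, _⟩ => A.pairInputs a b
    | ⟨_ + 1, _⟩ => fun _ => c
  have hβ : ∀ i, ∑ j, (β i j : ℕ) = pairArity (k + l) m i := fun i => by
    rcases Fin.eq_zero_or_one i with rfl | rfl
    · exact pairArity_sum rfl
    · exact Fin.sum_univ_one fun _ : Fin 1 => (m : ℕ)
  refine Eq.symm ((A.comp_comp (pairArity 2 1) (pairArity_sum rfl) _ (tripleArity_sum h'') w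
    (A.pairInputs v A.one) (A.tripleInputs a b c) β (pairArity (k + l) m) hβ (pairArity_sum h')
    r ?_ ?_).trans (congrArg _ (funext fun i => ?_)))
  · intro i j
    rcases Fin.eq_zero_or_one i with rfl | rfl
    · rcases Fin.eq_zero_or_one j with rfl | rfl <;> rfl
    · obtain rfl : j = (0 : Fin 1) := Subsingleton.elim (α := Fin 1) _ _
      rfl
  · intro i j
    rcases Fin.eq_zero_or_one i with rfl | rfl
    · rcases Fin.eq_zero_or_one j with rfl | rfl <;> rfl
    · obtain rfl : j = (0 : Fin 1) := Subsingleton.elim (α := Fin 1) _ _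
      rfl
  · rcases Fin.eq_zero_or_one i with rfl | rfl
    · rfl
    · exact A.one_comp _ c

theorem bin_bin_right {k l m r n : ℕ+} (h : l + m = r) (h' : k + r = n) (h'' : k + l + m = n)
    (v w : A.obj 2) (a : A.obj k) (b : A.obj l) (c : A.obj m) :
    A.bin h' w a (A.bin h v b c) = A.tri h'' (A.bin (n := 3) rfl w A.one v) a b c := by
  subst h
  let β : ∀ i, Fin (pairArity 1 2 i) → ℕ+
    | ⟨0, _⟩ => fun _ => k
    | ⟨_ + 1, _⟩ => pairArity l m
  let r : ∀ i j, A.obj (β i j)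
    | ⟨0, _⟩ => fun _ => a
    | ⟨_ + 1, _⟩ => A.pairInputs b c
  have hβ : ∀ i, ∑ j, (β i j : ℕ) = pairArity k (l + m) i := fun i => by
    rcases Fin.eq_zero_or_one i with rfl | rfl
    · exact Fin.sum_univ_one fun _ : Fin 1 => (k : ℕ)
    · exact pairArity_sum rfl
  refine Eq.symm ((A.comp_comp (pairArity 1 2) (pairArity_sum rfl) _ (tripleArity_sum h'') w
    (A.pairInputs A.one v) (A.tripleInputs a b c) β (pairArity k (l + m)) hβ (pairArity_sum h')
    r ?_ ?_).trans (congrArg _ (funext fun i => ?_)))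
  · intro i j
    rcases Fin.eq_zero_or_one i with rfl | rfl
    · obtain rfl : j = (0 : Fin 1) := Subsingleton.elim (α := Fin 1) _ _
      rfl
    · rcases Fin.eq_zero_or_one j with rfl | rfl <;> rfl
  · intro i j
    rcases Fin.eq_zero_or_one i with rfl | rfl
    · obtain rfl : j = (0 : Fin 1) := Subsingleton.elim (α := Fin 1) _ _
      rfl
    · rcases Fin.eq_zero_or_one j with rfl | rfl <;> rfl
  · rcases Fin.eq_zero_or_one i with rfl | rfl
    · exact A.one_comp _ a
    · rfl

end AlgOperad

theorem AlgOperad.Hom.map_bin {K : Type w} [Field K] {O : AlgOperad.{u} K} {Q : AlgOperad.{v} K}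
    (F : O.Hom Q) {k l n : ℕ+} (h : k + l = n) (v : O.obj 2) (a : O.obj k) (b : O.obj l) :
    F.app n (O.bin h v a b) = Q.bin h (F.app 2 v) (F.app k a) (F.app l b) := by
  rw [bin, F.map_comp, comp_eq_bin]
  rfl

/-! ## Counting marked inputs -/

/-- The truth value of a proposition. -/
def truthValue (p : Prop) : Bool := @decide p (Classical.propDecidable p)

@[simp]
theorem truthValue_of_true {p : Prop} (h : p) : truthValue p = true :=
  @decide_eq_true p (Classical.propDecidable p) h

@[simp]
theorem truthValue_of_false {p : Prop} (h : ¬ p) : truthValue p = false :=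
  @decide_eq_false p (Classical.propDecidable p) h

open Classical in
/-- The number of white vertices of a tree whose inputs are marked by `x`: a vertex is white if all
the inputs above one of its two edges are marked. -/
def whiteCount {n : ℕ} (x : Fin n → Prop) : ℕ :=
  (∑ j, if x j then 1 else 0) - if ∀ j, x j then 1 else 0

theorem toNat_truthValue_add (p q r : Prop) :
    (truthValue (p ∨ q)).toNat + (truthValue (p ∧ q ∨ r)).toNat =
      (truthValue (q ∨ r)).toNat + (truthValue (q ∧ r ∨ p)).toNat := by
  by_cases hp : p <;> by_cases hq : q <;> by_cases hr : r <;> simp [hp, hq, hr]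

/-- The marking of the first `i` inputs. -/
def firstMarked (n : ℕ) (i : ℕ) : Fin n → Prop := fun j => (j : ℕ) < i

open Classical in
theorem sum_marked_le {n : ℕ} (x : Fin n → Prop) : (∑ j, if x j then 1 else 0) ≤ n := by
  rw [← Finset.card_filter]
  exact (Finset.card_filter_le _ _).trans (by simp)

theorem whiteCount_lt {n : ℕ+} (x : Fin n → Prop) : whiteCount x < n := by
  classical
  rw [whiteCount]
  have h1 := sum_marked_le x
  have h2 := n.pos
  split_ifs with h
  · omega
  · push Not at h
    obtain ⟨j, hj⟩ := h
    rw [← Finset.card_filter, Nat.sub_zero]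
    refine (Finset.card_lt_card (Finset.filter_ssubset.2 ⟨j, Finset.mem_univ _, hj⟩)).trans_le ?_
    simp

theorem whiteCount_firstMarked {n i : ℕ} (h : i < n) : whiteCount (firstMarked n i) = i := by
  classical
  have h1 : ¬ ∀ j, firstMarked n i j := fun hx => lt_irrefl i (hx ⟨i, h⟩)
  rw [whiteCount, if_neg h1, Nat.sub_zero, ← Finset.card_filter]
  have : (Finset.univ.filter fun j : Fin n => firstMarked n i j) = Finset.Iio ⟨i, h⟩ := by
    ext j
    rw [Finset.mem_filter, Finset.mem_Iio, and_iff_right (Finset.mem_univ j)]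
    rfl
  simp [this]

theorem whiteCount_comp_perm {n : ℕ} (x : Fin n → Prop) (σ : Equiv.Perm (Fin n)) :
    whiteCount (x ∘ σ) = whiteCount x := by
  classical
  have h1 : (∀ j, (x ∘ σ) j) ↔ ∀ j, x j := σ.forall_congr_left.trans (by simp)
  simp only [whiteCount, h1]
  simp only [Function.comp_apply, Equiv.sum_comp σ fun j => if x j then 1 else 0]

open Classical in
theorem whiteCount_eq_add {k l n : ℕ+} (x : Fin n → Prop) (y : Fin k → Prop) (z : Fin l → Prop)
    (h1 : (∑ j, if x j then 1 else 0) = (∑ j, if y j then 1 else 0) + ∑ j, if z j then 1 else 0)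
    (h2 : (∀ j, x j) ↔ (∀ j, y j) ∧ ∀ j, z j) :
    whiteCount x =
      (truthValue ((∀ j, y j) ∨ ∀ j, z j)).toNat + whiteCount y + whiteCount z := by
  have h3 : (∀ j, y j) → (∑ j, if y j then 1 else 0) = (k : ℕ) := fun hx => by simp [hx]
  have h4 : (∀ j, z j) → (∑ j, if z j then 1 else 0) = (l : ℕ) := fun hx => by simp [hx]
  have hk := k.pos
  have hl := l.pos
  simp only [whiteCount, h1, h2]
  generalize (∑ j, if y j then 1 else 0) = s at *
  generalize (∑ j, if z j then 1 else 0) = t at *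
  by_cases hA : ∀ j, y j <;> by_cases hB : ∀ j, z j
  · have := h3 hA
    have := h4 hB
    rw [if_pos ⟨hA, hB⟩, if_pos hA, if_pos hB, truthValue_of_true (Or.inl hA), Bool.toNat_true]
    omega
  · have := h3 hA
    rw [if_neg fun h => hB h.2, if_pos hA, if_neg hB, truthValue_of_true (Or.inl hA), Bool.toNat_true]
    omega
  · have := h4 hB
    rw [if_neg fun h => hA h.1, if_neg hA, if_pos hB, truthValue_of_true (Or.inr hB), Bool.toNat_true]
    omega
  · rw [if_neg fun h => hA h.1, if_neg hA, if_neg hB, truthValue_of_false fun h => h.elim hA hB,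
      Bool.toNat_false]
    omega

theorem whiteCount_pair {k l n : ℕ+} (h : k + l = n) (x : Fin n → Prop) :
    whiteCount x =
      (truthValue ((∀ j : Fin k, x (blockEquiv (pairArity k l) (pairArity_sum h) ⟨0, j⟩)) ∨
        ∀ j : Fin l, x (blockEquiv (pairArity k l) (pairArity_sum h) ⟨1, j⟩))).toNat +
      whiteCount (fun j : Fin k => x (blockEquiv (pairArity k l) (pairArity_sum h) ⟨0, j⟩)) +
      whiteCount (fun j : Fin l => x (blockEquiv (pairArity k l) (pairArity_sum h) ⟨1, j⟩)) := by
  classical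
  set e := blockEquiv (pairArity k l) (pairArity_sum h)
  refine whiteCount_eq_add _ _ _ ?_ ?_
  · rw [← Equiv.sum_comp e, Fintype.sum_sigma]
    exact Fin.sum_univ_two fun i : Fin 2 => ∑ j, if x (e ⟨i, j⟩) then 1 else 0
  · refine ⟨fun hx => ⟨fun j => hx _, fun j => hx _⟩, fun hx j => ?_⟩
    obtain ⟨⟨i, j⟩, rfl⟩ := e.surjective j
    rcases Fin.eq_zero_or_one i with rfl | rfl
    exacts [hx.1 j, hx.2 j]

/-- A function of two bounded indices and a bit which is unchanged when a unit is moved from the bit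
to one of the indices only depends on the sum of its arguments. -/
theorem eq_of_exchange {α : Type*} {M N : ℕ} (F : Bool → ℕ → ℕ → α)
    (h1 : ∀ i j, i + 1 < M → j < N → F true i j = F false (i + 1) j)
    (h2 : ∀ i j, i < M → j + 1 < N → F true i j = F false i (j + 1))
    {b b' : Bool} {i i' j j' : ℕ} (hi : i < M) (hi' : i' < M) (hj : j < N) (hj' : j' < N)
    (h : b.toNat + i + j = b'.toNat + i' + j') : F b i j = F b' i' j' := by
  have key : ∀ d i j, i + d < M → j + d < N → F false (i + d) j = F false i (j + d) := by
    intro d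
    induction d with
    | zero => intro i j _ _; rfl
    | succ d ih =>
      intro i j hi hj
      rw [← add_assoc, ← h1 (i + d) j hi (by omega), h2 _ _ (by omega) (by omega),
        ih _ _ (by omega) (by omega), add_assoc, add_comm 1 d]
  have key' : ∀ i i' j j', i < M → i' < M → j < N → j' < N → i + j = i' + j' →
      F false i j = F false i' j' := by
    intro i i' j j' hi hi' hj hj' h
    rcases le_total i i' with hle | hle
    · obtain ⟨d, rfl⟩ := Nat.exists_eq_add_of_le hle
      obtain rfl : j = j' + d := by omega
      exact (key d i j' hi' hj).symm
    · obtain ⟨d, rfl⟩ := Nat.exists_eq_add_of_le hle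
      obtain rfl : j' = j + d := by omega
      exact key d i' j hi hj'
  have red : ∀ i j, i < M → j < N → (∃ i' j', i' < M ∧ j' < N ∧ 1 + i + j = i' + j' ∧
      F true i j = F false i' j') ∨ (i + 1 = M ∧ j + 1 = N) := by
    intro i j hi hj
    by_cases h3 : i + 1 < M
    · exact .inl ⟨i + 1, j, h3, hj, by omega, h1 i j h3 hj⟩
    · by_cases h4 : j + 1 < N
      · exact .inl ⟨i, j + 1, hi, h4, by omega, h2 i j hi h4⟩
      · exact .inr (by omega)
  cases b <;> cases b' <;> simp only [Bool.toNat_true, Bool.toNat_false, zero_add] at h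
  · exact key' _ _ _ _ hi hi' hj hj' h
  · rcases red i' j' hi' hj' with ⟨a, c, ha, hc, hs, he⟩ | hs
    · rw [he]; exact key' _ _ _ _ hi ha hj hc (by omega)
    · omega
  · rcases red i j hi hj with ⟨a, c, ha, hc, hs, he⟩ | hs
    · rw [he]; exact key' _ _ _ _ ha hi' hc hj' (by omega)
    · omega
  · rcases red i j hi hj with ⟨a, c, ha, hc, hs, he⟩ | hs
    · rcases red i' j' hi' hj' with ⟨a', c', ha', hc', hs', he'⟩ | hs'
      · rw [he, he']; exact key' _ _ _ _ ha ha' hc hc' (by omega)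
      · omega
    · obtain rfl : i = i' := by omega
      obtain rfl : j = j' := by omega
      rfl

/-! ## Coloured generators -/

namespace BinaryQuadratic

variable {K : Type u} [Field K] (D : BinaryQuadratic.{u, v} K)

/-- The inclusion of `V` as `V_∘` (for `true`) or `V_•` (for `false`). -/
def colorInclusion (b : Bool) : D.V →ₗ[K] D.tc.V :=
  bif b then LinearMap.inl K D.V D.V else LinearMap.inr K D.V D.V

/-- The white (for `true`) or black (for `false`) operation given by a generator. -/
def colorGen (b : Bool) : D.V →ₗ[K] D.tc.operad.obj 2 :=
  D.tc.gen ∘ₗ D.colorInclusion b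

theorem act_colorGen (b : Bool) (v : D.V) :
    D.tc.operad.act (D.colorGen b v) (Equiv.swap (0 : Fin (2 : ℕ+)) 1) =
      D.colorGen b (D.swap v) := by
  refine (D.tc.act_gen _).trans (congrArg D.tc.gen ?_)
  cases b
  · exact Prod.ext D.swap.map_zero rfl
  · exact Prod.ext rfl D.swap.map_zero

theorem treeMap_decorate {A : AlgOperad.{w} K} (f : D.tc.V →ₗ[K] A.obj 2) (b b' : Bool)
    (r : Fin 3 → D.V ⊗[K] D.V) (c : Fin 3) :
    treeMap A f f c (decorate (D.colorInclusion b) (D.colorInclusion b') r c) =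
      treeMap A (f ∘ₗ D.colorInclusion b) (f ∘ₗ D.colorInclusion b') c (r c) := by
  change (treeMap A f f c ∘ₗ TensorProduct.map _ _) (r c) = _
  congr 1
  ext x y
  rfl

theorem sum_treeMap_single {A : AlgOperad.{w} K} (f : D.V →ₗ[K] A.obj 2) (c : Fin 3)
    (t : D.V ⊗[K] D.V) :
    ∑ c', treeMap A f f c' ((Pi.single c t : Fin 3 → D.V ⊗[K] D.V) c') = treeMap A f f c t := by
  rw [Finset.sum_eq_single c (fun b _ hb => by rw [Pi.single_eq_of_ne hb, map_zero])
    (fun h => absurd (Finset.mem_univ c) h), Pi.single_eq_same]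

theorem treeMap_colorGen_exchange (c : Fin 3) :
    treeMap D.tc.operad (D.colorGen true) (D.colorGen false) c =
      treeMap D.tc.operad (D.colorGen false) (D.colorGen true) c := by
  ext v w
  have h := D.tc.rel_eq_zero (.inl (.inr ⟨c, v, w, rfl⟩))
  have h := (D.tc.sum_treeMap_single _ c _).symm.trans h
  exact sub_eq_zero.1 ((LinearMap.map_sub (treeMap D.tc.operad D.tc.gen D.tc.gen c) _ _).symm.trans h)

theorem treeMap_colorGen_congr {b₁ b₂ b₁' b₂' : Bool}
    (h : b₁.toNat + b₂.toNat = b₁'.toNat + b₂'.toNat) (c : Fin 3) :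
    treeMap D.tc.operad (D.colorGen b₁) (D.colorGen b₂) c =
      treeMap D.tc.operad (D.colorGen b₁') (D.colorGen b₂') c := by
  have := D.treeMap_colorGen_exchange c
  cases b₁ <;> cases b₂ <;> cases b₁' <;> cases b₂' <;> simp_all

theorem sum_treeMap_colorGen {r : Fin 3 → D.V ⊗[K] D.V} (hr : r ∈ D.rel) (b b' : Bool) :
    ∑ c, treeMap D.tc.operad (D.colorGen b) (D.colorGen b') c (r c) = 0 := by
  have key : ∀ b b', decorate (D.colorInclusion b) (D.colorInclusion b') r ∈ D.tc.rel →
      ∑ c, treeMap D.tc.operad (D.colorGen b) (D.colorGen b') c (r c) = 0 := fun b b' h => by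
    have h := D.tc.rel_eq_zero h
    simp only [treeMap_decorate] at h
    exact h
  cases b <;> cases b'
  · exact key _ _ (.inl (.inl (.inr ⟨r, hr, rfl⟩)))
  · simp only [← treeMap_colorGen_exchange]
    exact key _ _ (.inr ⟨r, hr, rfl⟩)
  · exact key _ _ (.inr ⟨r, hr, rfl⟩)
  · exact key _ _ (.inl (.inl (.inl ⟨r, hr, rfl⟩)))

theorem colorGen_exchange (v w : D.V) {k l m r n : ℕ+} (h : k + l = r) (h' : r + m = n)
    (a : D.tc.operad.obj k) (b : D.tc.operad.obj l) (c : D.tc.operad.obj m) :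
    D.tc.operad.bin h' (D.colorGen true w) (D.tc.operad.bin h (D.colorGen false v) a b) c =
      D.tc.operad.bin h' (D.colorGen false w) (D.tc.operad.bin h (D.colorGen true v) a b) c := by
  have h'' : k + l + m = n := by rw [h, h']
  rw [AlgOperad.bin_bin_left _ h h' h'', AlgOperad.bin_bin_left _ h h' h'',
    ← AlgOperad.tree_zero, ← AlgOperad.tree_zero]
  exact congrArg (D.tc.operad.tri h'' · a b c)
    (LinearMap.congr_fun (D.treeMap_colorGen_exchange 0) (v ⊗ₜ w)).symm

/-- The generator `v`, coloured white if one of its two inputs is marked. -/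
def markedGen : D.V →ₗ[K] D.tc.operad.marked.obj 2 where
  toFun v x := D.colorGen (truthValue (x 0 ∨ x 1)) v
  map_add' _ _ := funext fun _ => map_add _ _ _
  map_smul' _ _ := funext fun _ => map_smul _ _ _

theorem treeMap_markedGen (c : Fin 3) (x : Fin (3 : ℕ+) → Prop) (t : D.V ⊗[K] D.V) :
    treeMap D.tc.operad.marked D.markedGen D.markedGen c t x =
      treeMap D.tc.operad
        (D.colorGen (truthValue (x ((finRotate (3 : ℕ+) ^ (c : ℕ)) 0) ∨
          x ((finRotate (3 : ℕ+) ^ (c : ℕ)) 1))))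
        (D.colorGen (truthValue ((x ((finRotate (3 : ℕ+) ^ (c : ℕ)) 0) ∧
          x ((finRotate (3 : ℕ+) ^ (c : ℕ)) 1)) ∨ x ((finRotate (3 : ℕ+) ^ (c : ℕ)) 2)))) c t := by
  change (LinearMap.proj x ∘ₗ treeMap D.tc.operad.marked D.markedGen D.markedGen c) t = _
  congr 1
  ext v w
  set ρ := finRotate (3 : ℕ+) ^ (c : ℕ)
  set T := D.tc.operad
  set e := blockEquiv treeArity treeArity_sum
  change T.act (T.comp treeArity treeArity_sum
    (D.colorGen (truthValue ((∀ j, x (ρ (e ⟨0, j⟩))) ∨ ∀ j, x (ρ (e ⟨1, j⟩)))) w)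
    fun i => T.marked.treeInputs (D.markedGen v) i fun j => x (ρ (e ⟨i, j⟩))) ρ⁻¹ =
    T.act (T.comp treeArity treeArity_sum (D.colorGen _ w) (T.treeInputs (D.colorGen _ v))) ρ⁻¹
  have h1 : ((∀ j, x (ρ (e ⟨0, j⟩))) ∨ ∀ j, x (ρ (e ⟨1, j⟩))) ↔ (x (ρ 0) ∧ x (ρ 1)) ∨ x (ρ 2) :=
    or_congr (Fin.forall_fin_two (p := fun j : Fin 2 => x (ρ (e ⟨0, j⟩))))
      (Fin.forall_fin_one (p := fun j : Fin 1 => x (ρ (e ⟨1, j⟩))))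
  have h2 : (fun i => T.marked.treeInputs (D.markedGen v) i fun j => x (ρ (e ⟨i, j⟩))) =
      T.treeInputs (D.colorGen (truthValue (x (ρ 0) ∨ x (ρ 1))) v) := by
    funext i
    rcases Fin.eq_zero_or_one i with rfl | rfl <;> rfl
  rw [h2]
  simp only [h1]

/-- The morphism that colours the vertices of a tree according to the marking of its inputs. -/
def colorByMarks : D.operad.Hom D.tc.operad.marked :=
  D.lift _ D.markedGen
    (fun v => funext fun x => by
      refine (D.act_colorGen _ v).trans ?_
      change _ = D.colorGen (truthValue (x 0 ∨ x 1)) _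
      have : (x ∘ (Equiv.swap (0 : Fin (2 : ℕ+)) 1).symm) 0 ∨
          (x ∘ (Equiv.swap (0 : Fin (2 : ℕ+)) 1).symm) 1 ↔ x 0 ∨ x 1 := or_comm
      simp only [this])
    (fun r hr => funext fun x => by
      refine (Finset.sum_apply x _ _).trans ?_
      simp only [treeMap_markedGen]
      refine Eq.trans (Finset.sum_congr rfl fun c _ => LinearMap.congr_fun
        (D.treeMap_colorGen_congr (b₁' := truthValue (x 0 ∨ x 1))
          (b₂' := truthValue ((x 0 ∧ x 1) ∨ x 2)) ?_ c) (r c)) (D.sum_treeMap_colorGen hr _ _)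
      have h1 := toNat_truthValue_add (x 0) (x 1) (x 2)
      obtain rfl | rfl | rfl : c = 0 ∨ c = 1 ∨ c = 2 := by decide +revert
      exacts [rfl, h1.symm, (h1.trans (toNat_truthValue_add (x 1) (x 2) (x 0))).symm])

variable {D}

/-- The element of level `i` of `ᵗᶜO` above `a`. -/
def level {n : ℕ+} (a : D.operad.obj n) (i : ℕ) : D.tc.operad.obj n :=
  D.colorByMarks.app n a (firstMarked n i)

theorem colorByMarks_bin {k l n : ℕ+} (h : k + l = n) (v : D.V) (a : D.operad.obj k)
    (b : D.operad.obj l) (x : Fin n → Prop) :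
    D.colorByMarks.app n (D.operad.bin h (D.gen v) a b) x =
      D.tc.operad.bin h (D.colorGen (truthValue
        ((∀ j : Fin k, x (blockEquiv (pairArity k l) (pairArity_sum h) ⟨0, j⟩)) ∨
          ∀ j : Fin l, x (blockEquiv (pairArity k l) (pairArity_sum h) ⟨1, j⟩))) v)
        (D.colorByMarks.app k a
          fun j : Fin k => x (blockEquiv (pairArity k l) (pairArity_sum h) ⟨0, j⟩))
        (D.colorByMarks.app l b
          fun j : Fin l => x (blockEquiv (pairArity k l) (pairArity_sum h) ⟨1, j⟩)) := by
  rw [D.colorByMarks.map_bin]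
  exact D.tc.operad.comp_eq_bin _ _ _ _

/-- The value of `a` on a marking only depends on the number of white vertices. -/
def IsSymm {n : ℕ+} (a : D.operad.obj n) : Prop :=
  ∀ x, D.colorByMarks.app n a x = level a (whiteCount x)

/-- A white vertex below `a` can be exchanged with a black vertex of `a`. -/
def HasExchange {n : ℕ+} (a : D.operad.obj n) : Prop :=
  ∀ (i : ℕ) (v : D.V) {k N : ℕ+} (h : n + k = N) (d : D.tc.operad.obj k), i + 1 < n →
    D.tc.operad.bin h (D.colorGen true v) (level a i) d =
      D.tc.operad.bin h (D.colorGen false v) (level a (i + 1)) d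

theorem HasExchange.right {n : ℕ+} {a : D.operad.obj n} (ha : HasExchange a) (i : ℕ) (v : D.V)
    {k N : ℕ+} (h : k + n = N) (d : D.tc.operad.obj k) (hi : i + 1 < n) :
    D.tc.operad.bin h (D.colorGen true v) d (level a i) =
      D.tc.operad.bin h (D.colorGen false v) d (level a (i + 1)) := by
  have h' : n + k = N := by rw [add_comm, h]
  obtain ⟨ρ, hρ⟩ := D.tc.operad.exists_bin_act_swap h' h
  have hv : D.swap (D.swap v) = v := D.swap_swap v
  rw [← hv, ← act_colorGen D true, ← act_colorGen D false, hρ, hρ, ha i _ h' d hi]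

/-- The composite of elements of given levels only depends on the sum of the levels. -/
theorem bin_level_congr {k l n : ℕ+} (h : k + l = n) (v : D.V) {a : D.operad.obj k}
    {b : D.operad.obj l} (ha : HasExchange a) (hb : HasExchange b) {ε ε' : Bool} {i i' j j' : ℕ}
    (hi : i < k) (hi' : i' < k) (hj : j < l) (hj' : j' < l)
    (hs : ε.toNat + i + j = ε'.toNat + i' + j') :
    D.tc.operad.bin h (D.colorGen ε v) (level a i) (level b j) =
      D.tc.operad.bin h (D.colorGen ε' v) (level a i') (level b j') :=
  eq_of_exchange
    (fun ε i j => D.tc.operad.bin h (D.colorGen ε v) (level a i) (level b j))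
    (fun i _ hi _ => ha i v h _ hi) (fun _ j _ hj => hb.right j v h _ hj) hi hi' hj hj' hs

theorem bin_level {k l n : ℕ+} (h : k + l = n) (v : D.V) {a : D.operad.obj k}
    {b : D.operad.obj l} (ha : HasExchange a) (hb : HasExchange b) (ha' : IsSymm a)
    (hb' : IsSymm b) {ε : Bool} {i j : ℕ} (hi : i < k) (hj : j < l) (x : Fin n → Prop)
    (hx : whiteCount x = ε.toNat + i + j) :
    D.colorByMarks.app n (D.operad.bin h (D.gen v) a b) x =
      D.tc.operad.bin h (D.colorGen ε v) (level a i) (level b j) := by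
  rw [colorByMarks_bin, ha', hb']
  refine bin_level_congr h v ha hb (whiteCount_lt _) hi (whiteCount_lt _) hj ?_
  rw [← hx, whiteCount_pair h x]

theorem level_bin {k l n : ℕ+} (h : k + l = n) (v : D.V) {a : D.operad.obj k}
    {b : D.operad.obj l} (ha : HasExchange a) (hb : HasExchange b) (ha' : IsSymm a)
    (hb' : IsSymm b) {ε : Bool} {i j : ℕ} (hi : i < k) (hj : j < l) :
    level (D.operad.bin h (D.gen v) a b) (ε.toNat + i + j) =
      D.tc.operad.bin h (D.colorGen ε v) (level a i) (level b j) := by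
  refine bin_level h v ha hb ha' hb' hi hj _ (whiteCount_firstMarked ?_)
  subst h
  have := ε.toNat_le
  rw [PNat.add_coe]
  omega

theorem isSymm_and_hasExchange {n : ℕ+} {a : D.operad.obj n}
    (ha : D.operad.Planar (Set.range D.gen) n a) : IsSymm a ∧ HasExchange a := by
  induction ha with
  | one =>
    refine ⟨fun x => ?_, fun i v k N h d hi => absurd hi (by simp)⟩
    rw [level, D.colorByMarks.map_one]
    rfl
  | node m h v x hv _ ih =>
    obtain ⟨v, rfl⟩ := hv
    rw [AlgOperad.comp_eq_bin]
    obtain ⟨s0, e0⟩ := ih 0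
    obtain ⟨s1, e1⟩ := ih 1
    have hm := pairArity_add h
    have hpos0 := (m 0).pos
    have hpos1 := (m 1).pos
    refine ⟨fun y => ?_, fun i w k N hN d hi => ?_⟩
    · have hy := whiteCount_pair hm y
      rw [bin_level hm v e0 e1 s0 s1 (whiteCount_lt _) (whiteCount_lt _) y hy, hy,
        level_bin hm v e0 e1 s0 s1 (whiteCount_lt _) (whiteCount_lt _)]
    · obtain ⟨i0, i1, hi0, hi1, rfl⟩ : ∃ i0 i1, i0 < (m 0 : ℕ) ∧ i1 < (m 1 : ℕ) ∧ i0 + i1 = i := by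
        rw [← hm, PNat.add_coe] at hi
        by_cases h0 : i < m 0
        · exact ⟨i, 0, h0, hpos1, rfl⟩
        · exact ⟨m 0 - 1, i - (m 0 - 1), by omega, by omega, by omega⟩
      have hf := level_bin hm v e0 e1 s0 s1 (ε := false) hi0 hi1
      have ht := level_bin hm v e0 e1 s0 s1 (ε := true) hi0 hi1
      rw [Bool.toNat_false, zero_add] at hf
      rw [Bool.toNat_true, show 1 + i0 + i1 = i0 + i1 + 1 by omega] at ht
      rw [hf, ht, colorGen_exchange]

theorem level_act {n : ℕ+} {a : D.operad.obj n} (ha : IsSymm a) (σ : Equiv.Perm (Fin n)) {i : ℕ}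
    (hi : i < n) : level (D.operad.act a σ) i = D.tc.operad.act (level a i) σ := by
  rw [level, D.colorByMarks.map_act]
  refine congrArg (D.tc.operad.act · σ) ((ha _).trans ?_)
  rw [whiteCount_comp_perm, whiteCount_firstMarked hi]

end BinaryQuadratic

/-! ## The linearization of `P ×_H ᵗᶜCom` -/

/-- A map that is compatible with two operations is compatible with their multilinear extensions. -/
theorem linComp_mapDomain {K : Type w} [Field K] {α γ : Type u} {α' γ' : Type v} {k : ℕ}
    {β : Fin k → Type u} {β' : Fin k → Type v}
    (f : α → (∀ i, β i) → γ) (f' : α' → (∀ i, β' i) → γ') (g : α → α') (g' : ∀ i, β i → β' i)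
    (g'' : γ → γ') (hg : ∀ a y, f' (g a) (fun i => g' i (y i)) = g'' (f a y)) (p : α →₀ K)
    (q : ∀ i, β i →₀ K) :
    linComp K f' (p.mapDomain g) (fun i => (q i).mapDomain (g' i)) =
      (linComp K f p q).mapDomain g'' := by
  refine IsML.ext (β := β)
    (F := fun q => linComp K f' (p.mapDomain g) fun i => (q i).mapDomain (g' i))
    (G := fun q => (linComp K f p q).mapDomain g'')
    (IsML.linear_arg (β := fun i => β' i →₀ K) (β' := fun i => β i →₀ K) (linComp_isML _ _)
      (fun i x => x.mapDomain (g' i)) fun i => mapDomain_linear _)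
    (IsML.linear (linComp_isML _ _) _ (mapDomain_linear _)) (fun y => ?_) q
  refine linComp_ext
    (F := fun p => linComp K f' (p.mapDomain g) fun i => (Finsupp.single (y i) 1).mapDomain (g' i))
    (G := fun p => (linComp K f p fun i => Finsupp.single (y i) 1).mapDomain g'')
    (fun c c' x x' => by simp only [mapDomain_linear, linComp_linear])
    (fun c c' x x' => by simp only [mapDomain_linear, linComp_linear]) (fun a => ?_) p
  have h1 : (fun i => (Finsupp.single (y i) (1 : K)).mapDomain (g' i)) =
      fun i => Finsupp.single (g' i (y i)) 1 := funext fun i => Finsupp.mapDomain_single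
  rw [h1, Finsupp.mapDomain_single, linComp_single f' (g a) (fun i => g' i (y i)), linComp_single,
    Finsupp.mapDomain_single, hg]

namespace SetOperad

variable (K : Type u) [Field K] (P : SetOperad.{w})

/-- The inclusion `p ↦ (p, Dᵢ)` of `⟨P⟩` into `⟨P ×_H ᵗᶜCom⟩`. -/
def atLevel {n : ℕ+} (i : Fin n) :
    (P.linearization K).obj n →ₗ[K] ((P.hadamard tcCom).linearization K).obj n :=
  Finsupp.lmapDomain K K fun p => (p, tcCom.D i)

variable {K P}

theorem atLevel_comp {k n : ℕ+} (m : Fin k → ℕ+) (h : ∑ i, (m i : ℕ) = n) (j : Fin k)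
    (l : ∀ i, Fin (m i)) (r : Fin n) (hr : (r : ℕ) = j + ∑ i, (l i : ℕ))
    (x : (P.linearization K).obj k) (y : ∀ i, (P.linearization K).obj (m i)) :
    ((P.hadamard tcCom).linearization K).comp m h (atLevel K P j x)
      (fun i => atLevel K P (l i) (y i)) = atLevel K P r ((P.linearization K).comp m h x y) :=
  linComp_mapDomain (P.comp m h) ((P.hadamard tcCom).comp m h) (fun p => (p, tcCom.D j))
    (fun i p => (p, tcCom.D (l i))) (fun p => (p, tcCom.D r))
    (fun _ _ => Prod.ext rfl (Fin.ext hr.symm)) x y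

theorem atLevel_act {n : ℕ+} (i : Fin n) (x : (P.linearization K).obj n)
    (σ : Equiv.Perm (Fin n)) :
    ((P.hadamard tcCom).linearization K).act (atLevel K P i x) σ =
      atLevel K P i ((P.linearization K).act x σ) :=
  (Finsupp.mapDomain_comp (f := fun p : P.obj n => (p, i))
    (g := fun q : P.obj n × Fin n => (P.act q.1 σ, q.2)) (v := x)).symm.trans
    (Finsupp.mapDomain_comp (f := fun p : P.obj n => P.act p σ) (g := fun p => (p, i)) (v := x))

theorem atLevel_one : atLevel K P (0 : Fin (1 : ℕ+)) (P.linearization K).one =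
    ((P.hadamard tcCom).linearization K).one :=
  Finsupp.mapDomain_single

theorem atLevel_bin {k l n : ℕ+} (h : k + l = n) (s : Fin (2 : ℕ+)) (i : Fin k) (j : Fin l)
    (r : Fin n) (hr : (r : ℕ) = s + i + j) (x : (P.linearization K).obj 2)
    (y : (P.linearization K).obj k) (z : (P.linearization K).obj l) :
    ((P.hadamard tcCom).linearization K).bin h (atLevel K P s x) (atLevel K P i y)
      (atLevel K P j z) = atLevel K P r ((P.linearization K).bin h x y z) := by
  let t : ∀ a, Fin (pairArity k l a)
    | ⟨0, _⟩ => i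
    | ⟨_ + 1, _⟩ => j
  rw [AlgOperad.bin, AlgOperad.bin, ← atLevel_comp _ _ s t r]
  · congr 1
    funext a
    rcases Fin.eq_zero_or_one a with rfl | rfl <;> rfl
  · rw [hr, add_assoc]
    rfl

theorem atLevel_tree (c : Fin 3) (i j : Fin (2 : ℕ+)) (r : Fin (3 : ℕ+)) (hr : (r : ℕ) = i + j)
    (x y : (P.linearization K).obj 2) :
    ((P.hadamard tcCom).linearization K).tree c (atLevel K P i x) (atLevel K P j y) =
      atLevel K P r ((P.linearization K).tree c x y) := by
  let t : ∀ a, Fin (treeArity a)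
    | ⟨0, _⟩ => i
    | ⟨_ + 1, _⟩ => (0 : Fin (1 : ℕ+))
  rw [AlgOperad.tree, AlgOperad.tree, LinearMap.mk₂_apply, LinearMap.mk₂_apply, ← atLevel_act,
    ← atLevel_comp _ _ j t r]
  · congr 2
    funext a
    rcases Fin.eq_zero_or_one a with rfl | rfl
    · rfl
    · exact atLevel_one.symm
  · rw [hr, add_comm]
    rfl

end SetOperad

namespace BinaryQuadratic

open SetOperad

variable {K : Type u} [Field K] {D : BinaryQuadratic.{u, v} K} {P : SetOperad.{w}}
  (φ : D.operad.Iso (P.linearization K))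

/-- The images of the coloured generators in `⟨P ×_H ᵗᶜCom⟩`. -/
def tcGenImage : D.tc.V →ₗ[K] ((P.hadamard tcCom).linearization K).obj 2 :=
  LinearMap.coprod (atLevel K P 1 ∘ₗ (φ.toEquiv 2).toLinearMap ∘ₗ D.gen)
    (atLevel K P 0 ∘ₗ (φ.toEquiv 2).toLinearMap ∘ₗ D.gen)

/-- The number of white vertices of a vertex of the given colour. -/
def colorIndex (b : Bool) : Fin (2 : ℕ+) := bif b then 1 else 0

theorem colorIndex_val (b : Bool) : (colorIndex b : ℕ) = b.toNat := by
  cases b <;> rfl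

theorem tcGenImage_comp (b : Bool) : tcGenImage φ ∘ₗ D.colorInclusion b =
    atLevel K P (colorIndex b) ∘ₗ (φ.toEquiv 2).toLinearMap ∘ₗ D.gen := by
  cases b
  · exact LinearMap.coprod_inr _ _
  · exact LinearMap.coprod_inl _ _

theorem tcGenImage_eq (p : D.tc.V) : tcGenImage φ p =
    atLevel K P 1 (φ.toEquiv 2 (D.gen p.1)) + atLevel K P 0 (φ.toEquiv 2 (D.gen p.2)) := rfl

theorem treeMap_tcGenImage (b b' : Bool) (c : Fin 3) (r : Fin (3 : ℕ+))
    (hr : (r : ℕ) = b.toNat + b'.toNat) :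
    treeMap ((P.hadamard tcCom).linearization K) (tcGenImage φ ∘ₗ D.colorInclusion b)
      (tcGenImage φ ∘ₗ D.colorInclusion b') c =
      atLevel K P r ∘ₗ (φ.toEquiv 3).toLinearMap ∘ₗ treeMap D.operad D.gen D.gen c := by
  rw [tcGenImage_comp, tcGenImage_comp]
  ext v w
  refine (atLevel_tree c _ _ r ?_ _ _).trans
    (congrArg (atLevel K P r) (φ.toHom.map_tree c (D.gen v) (D.gen w)).symm)
  rw [hr, colorIndex_val, colorIndex_val]

theorem sum_treeMap_tcGenImage {r : Fin 3 → D.V ⊗[K] D.V} (hr : r ∈ D.rel) (b b' : Bool) :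
    ∑ c, treeMap ((P.hadamard tcCom).linearization K) (tcGenImage φ) (tcGenImage φ) c
      (decorate (D.colorInclusion b) (D.colorInclusion b') r c) = 0 := by
  have hb := b.toNat_le
  have hb' := b'.toNat_le
  let s : Fin (3 : ℕ+) := ⟨b.toNat + b'.toNat, by change _ < 3; omega⟩
  simp only [treeMap_decorate, treeMap_tcGenImage φ b b' _ s rfl, LinearMap.comp_apply]
  rw [← map_sum, ← map_sum, D.rel_eq_zero hr, map_zero, map_zero]

/-- The morphism `ᵗᶜO → ⟨P ×_H ᵗᶜCom⟩`. -/
def tcHom : D.tc.operad.Hom ((P.hadamard tcCom).linearization K) :=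
  D.tc.lift _ (tcGenImage φ)
    (fun p => by
      have h : ∀ v, (P.linearization K).act (φ.toEquiv 2 (D.gen v))
          (Equiv.swap (0 : Fin (2 : ℕ+)) 1) = φ.toEquiv 2 (D.gen (D.swap v)) := fun v => by
        rw [← φ.map_act, act_gen]
      rw [tcGenImage_eq, AlgOperad.act_add, atLevel_act, atLevel_act, h, h]
      rfl)
    (fun r hr => by
      rcases hr with ((⟨r, hr, rfl⟩ | ⟨r, hr, rfl⟩) | ⟨c, v, w, rfl⟩) | ⟨r, hr, rfl⟩
      · exact sum_treeMap_tcGenImage φ hr true true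
      · exact sum_treeMap_tcGenImage φ hr false false
      · refine (D.tc.sum_treeMap_single _ c _).trans ((LinearMap.map_sub _ _ _).trans ?_)
        have h1 := treeMap_tcGenImage φ true false c 1 rfl
        have h2 := treeMap_tcGenImage φ false true c 1 rfl
        exact sub_eq_zero.2 (LinearMap.congr_fun (h1.trans h2.symm) (v ⊗ₜ w))
      · exact sum_treeMap_tcGenImage φ hr true false)

theorem tcHom_colorGen (b : Bool) (v : D.V) : (tcHom φ).app 2 (D.colorGen b v) =
    atLevel K P (colorIndex b) (φ.toEquiv 2 (D.gen v)) :=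
  LinearMap.congr_fun (tcGenImage_comp φ b) v

theorem tcHom_bin {k l n : ℕ+} (h : k + l = n) (b : Bool) (v : D.V) {s : D.tc.operad.obj k}
    {t : D.tc.operad.obj l} {x : D.operad.obj k} {y : D.operad.obj l} {i : Fin k} {j : Fin l}
    (hs : (tcHom φ).app k s = atLevel K P i (φ.toEquiv k x))
    (ht : (tcHom φ).app l t = atLevel K P j (φ.toEquiv l y)) (r : Fin n)
    (hr : (r : ℕ) = b.toNat + i + j) :
    (tcHom φ).app n (D.tc.operad.bin h (D.colorGen b v) s t) =
      atLevel K P r (φ.toEquiv n (D.operad.bin h (D.gen v) x y)) := by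
  rw [AlgOperad.Hom.map_bin, hs, ht, tcHom_colorGen]
  refine (atLevel_bin h _ _ _ r ?_ _ _ _).trans
    (congrArg (atLevel K P r) (φ.toHom.map_bin h _ x y).symm)
  rw [hr, colorIndex_val]

theorem range_gen_span (v : D.V) : D.gen v ∈ Submodule.span K (Set.range D.gen) :=
  Submodule.subset_span ⟨v, rfl⟩

/-- The coloured generators. -/
def colorGens (D : BinaryQuadratic.{u, v} K) : Set (D.tc.operad.obj 2) :=
  {x | ∃ b v, D.colorGen b v = x}

theorem gen_mem_span_colorGens (p : D.tc.V) : D.tc.gen p ∈ Submodule.span K D.colorGens := by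
  have : p = D.colorInclusion true p.1 + D.colorInclusion false p.2 :=
    Prod.ext (add_zero _).symm (zero_add _).symm
  rw [this, map_add]
  exact Submodule.add_mem _ (Submodule.subset_span ⟨true, p.1, rfl⟩)
    (Submodule.subset_span ⟨false, p.2, rfl⟩)

theorem exists_tcHom_eq_of_planar {n : ℕ+} {a : D.operad.obj n}
    (ha : D.operad.Planar (Set.range D.gen) n a) (i : Fin n) :
    ∃ t, (tcHom φ).app n t = atLevel K P i (φ.toEquiv n a) := by
  induction ha with
  | one =>
    obtain rfl : i = (0 : Fin 1) := Subsingleton.elim (α := Fin 1) _ _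
    refine ⟨D.tc.operad.one, (tcHom φ).map_one.trans ?_⟩
    rw [φ.map_one]
    exact atLevel_one.symm
  | @node n m h v x hv _ ih =>
    obtain ⟨v, rfl⟩ := hv
    have hm := pairArity_add h
    have hn := i.2
    have h0 := (m 0).pos
    have h1 := (m 1).pos
    obtain ⟨b, i0, i1, hi⟩ : ∃ (b : Bool) (i0 : Fin (m 0)) (i1 : Fin (m 1)),
        (i : ℕ) = b.toNat + i0 + i1 := by
      have hn' : (m 0 : ℕ) + m 1 = n := congrArg PNat.val hm
      by_cases hi0 : (i : ℕ) < m 0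
      · exact ⟨false, ⟨i, hi0⟩, ⟨0, h1⟩, by simp⟩
      · exact ⟨true, ⟨m 0 - 1, by omega⟩, ⟨i - m 0, by omega⟩, by simp; omega⟩
    obtain ⟨t0, ht0⟩ := ih 0 i0
    obtain ⟨t1, ht1⟩ := ih 1 i1
    rw [AlgOperad.comp_eq_bin]
    exact ⟨_, tcHom_bin φ hm b v ht0 ht1 i hi⟩

theorem exists_level {n : ℕ+} {t : D.tc.operad.obj n} (ht : D.tc.operad.Planar D.colorGens n t) :
    ∃ (a : D.operad.obj n) (i : Fin n), D.operad.Planar (Set.range D.gen) n a ∧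
      (tcHom φ).app n t = atLevel K P i (φ.toEquiv n a) ∧ level a i = t := by
  induction ht with
  | one =>
    refine ⟨D.operad.one, (0 : Fin 1), .one, (tcHom φ).map_one.trans ?_,
      congrFun D.colorByMarks.map_one _⟩
    rw [φ.map_one]
    exact atLevel_one.symm
  | @node n m h v x hv _ ih =>
    obtain ⟨b, v, rfl⟩ := hv
    obtain ⟨a0, i0, p0, h0, l0⟩ := ih 0
    obtain ⟨a1, i1, p1, h1, l1⟩ := ih 1
    have hm := pairArity_add h
    have hi : b.toNat + i0 + i1 < (n : ℕ) := by
      have := b.toNat_le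
      rw [← hm, PNat.add_coe]
      omega
    obtain ⟨s0, e0⟩ := isSymm_and_hasExchange p0
    obtain ⟨s1, e1⟩ := isSymm_and_hasExchange p1
    refine ⟨D.operad.bin hm (D.gen v) a0 a1, ⟨_, hi⟩, ?_, ?_, ?_⟩
    · refine .node _ _ _ _ ⟨v, rfl⟩ fun i => ?_
      rcases Fin.eq_zero_or_one i with rfl | rfl
      exacts [p0, p1]
    · rw [AlgOperad.comp_eq_bin]
      exact tcHom_bin φ hm b v h0 h1 _ rfl
    · rw [AlgOperad.comp_eq_bin, level_bin hm v e0 e1 s0 s1 i0.2 i1.2, l0, l1]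

/-- The inverse of `tcHom`, which sends `(p, Dᵢ)` to the element of level `i` above `p`. -/
def tcInverse (n : ℕ+) :
    ((P.hadamard tcCom).linearization K).obj n →ₗ[K] D.tc.operad.obj n :=
  Finsupp.linearCombination K fun q : P.obj n × Fin n =>
    level ((φ.toEquiv n).symm (Finsupp.single q.1 1)) q.2

theorem tcInverse_atLevel {n : ℕ+} (i : Fin n) (a : D.operad.obj n) :
    tcInverse φ n (atLevel K P i (φ.toEquiv n a)) = level a i := by
  let F : D.operad.obj n →ₗ[K] D.tc.operad.obj n :=
    LinearMap.proj (R := K) (φ := fun _ => D.tc.operad.obj n) (firstMarked n i) ∘ₗ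
      D.colorByMarks.app n
  suffices h : tcInverse φ n ∘ₗ atLevel K P i = F ∘ₗ (φ.toEquiv n).symm.toLinearMap by
    refine (LinearMap.congr_fun h (φ.toEquiv n a)).trans ?_
    exact congrArg F ((φ.toEquiv n).symm_apply_apply a)
  refine Finsupp.lhom_ext' fun p => LinearMap.ext_ring ?_
  refine (congrArg (tcInverse φ n) (Finsupp.mapDomain_single (f := fun p : P.obj n => (p, i)))).trans
    ((Finsupp.linearCombination_single K _ _).trans (one_smul K _))

theorem tcHom_bijective (n : ℕ+) : Function.Bijective ((tcHom φ).app n) := by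
  constructor
  · refine Function.LeftInverse.injective (g := tcInverse φ n) fun t => ?_
    have ht : t ∈ D.tc.operad.planarSpan D.colorGens n := by
      rw [D.tc.planarSpan_eq_top _ gen_mem_span_colorGens]
      trivial
    induction ht using Submodule.span_induction with
    | mem t ht =>
      obtain ⟨t, σ, ht, rfl⟩ := ht
      obtain ⟨a, i, ha, h1, h2⟩ := exists_level φ ht
      rw [(tcHom φ).map_act, h1, atLevel_act, ← φ.map_act, tcInverse_atLevel,
        level_act (isSymm_and_hasExchange ha).1 σ i.2, h2]
    | zero => rw [map_zero, map_zero]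
    | add x y _ _ hx hy => rw [map_add, map_add, hx, hy]
    | smul c x _ hx => rw [map_smul, map_smul, hx]
  · suffices h : ∀ (i : Fin n) (a : D.operad.obj n),
        atLevel K P i (φ.toEquiv n a) ∈ LinearMap.range ((tcHom φ).app n) by
      rw [← LinearMap.range_eq_top, eq_top_iff]
      intro x _
      induction x using Finsupp.induction_linear with
      | zero => exact Submodule.zero_mem _
      | add x y hx hy => exact Submodule.add_mem _ (hx trivial) (hy trivial)
      | single q c =>
        have := h q.2 ((φ.toEquiv n).symm (Finsupp.single q.1 c))
        refine (congrArg (· ∈ LinearMap.range ((tcHom φ).app n)) ?_).mp this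
        exact (congrArg (atLevel K P q.2) ((φ.toEquiv n).apply_symm_apply _)).trans
          Finsupp.mapDomain_single
    intro i a
    have ha : a ∈ D.operad.planarSpan (Set.range D.gen) n := by
      rw [D.planarSpan_eq_top _ range_gen_span]
      trivial
    induction ha using Submodule.span_induction with
    | mem a ha =>
      obtain ⟨a, σ, ha, rfl⟩ := ha
      obtain ⟨t, ht⟩ := exists_tcHom_eq_of_planar φ ha i
      refine ⟨D.tc.operad.act t σ, ?_⟩
      rw [(tcHom φ).map_act, ht, atLevel_act, φ.map_act]
    | zero => rw [map_zero, map_zero]; exact Submodule.zero_mem _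
    | add x y _ _ hx hy => rw [map_add, map_add]; exact Submodule.add_mem _ hx hy
    | smul c x _ hx => rw [map_smul, map_smul]; exact Submodule.smul_mem _ c hx

/-- The isomorphism `ᵗᶜO ≅ ⟨P ×_H ᵗᶜCom⟩`. -/
def tcIso : D.tc.operad.Iso ((P.hadamard tcCom).linearization K) :=
  (tcHom φ).toIso (tcHom_bijective φ)

theorem tcIso_white (v : D.V) : (tcIso φ).toEquiv 2 (D.tc.gen (v, 0)) =
    Finsupp.mapDomain (fun p => (p, tcCom.D 1)) (φ.toEquiv 2 (D.gen v)) :=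
  tcHom_colorGen φ true v

theorem tcIso_black (v : D.V) : (tcIso φ).toEquiv 2 (D.tc.gen (0, v)) =
    Finsupp.mapDomain (fun p => (p, tcCom.D 0)) (φ.toEquiv 2 (D.gen v)) :=
  tcHom_colorGen φ false v

end BinaryQuadratic

/-! ## The operad `Com` -/

theorem sumPerm_update_swap {k : ℕ} (m : Fin k → ℕ+) {n : ℕ+} (h : ∑ i, (m i : ℕ) = n) (i : Fin k)
    (a b : Fin (m i)) :
    sumPerm m h (Function.update (fun _ => 1) i (Equiv.swap a b)) =
      Equiv.swap (blockEquiv m h ⟨i, a⟩) (blockEquiv m h ⟨i, b⟩) := by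
  ext1 z
  obtain ⟨⟨j, c⟩, rfl⟩ := (blockEquiv m h).surjective z
  rw [sumPerm_apply, Equiv.swap_apply_def]
  rcases eq_or_ne j i with rfl | hj
  · rw [Function.update_self, Equiv.swap_apply_def]
    simp only [EmbeddingLike.apply_eq_iff_eq, Sigma.mk.injEq, heq_eq_eq, true_and]
    split_ifs <;> rfl
  · rw [Function.update_of_ne hj]
    simp [hj]

theorem blockEquiv_pair_zero {k l n : ℕ+} (h : k + l = n) (c : Fin k) :
    (blockEquiv (pairArity k l) (pairArity_sum h) ⟨0, c⟩ : ℕ) = c := by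
  refine (blockEquiv_val (pairArity k l) _ 0 c).trans ?_
  simp

theorem blockEquiv_pair_one {k l n : ℕ+} (h : k + l = n) (c : Fin l) :
    (blockEquiv (pairArity k l) (pairArity_sum h) ⟨1, c⟩ : ℕ) = k + c := by
  refine (blockEquiv_val (pairArity k l) _ 1 c).trans (congrArg (· + (c : ℕ)) ?_)
  exact Fin.sum_univ_two fun i : Fin 2 => if i < 1 then (pairArity k l i : ℕ) else 0

namespace AlgOperad

variable {K : Type w} [Field K] (A : AlgOperad.{u} K)

theorem act_comp_swap {k n : ℕ+} (m : Fin k → ℕ+) (h : ∑ i, (m i : ℕ) = n) (p : A.obj k)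
    (q : ∀ i, A.obj (m i)) (i : Fin k) (a b : Fin (m i))
    (hq : A.act (q i) (Equiv.swap a b) = q i) :
    A.act (A.comp m h p q) (Equiv.swap (blockEquiv m h ⟨i, a⟩) (blockEquiv m h ⟨i, b⟩)) =
      A.comp m h p q := by
  rw [← sumPerm_update_swap, ← A.comp_act_right]
  congr 1
  funext j
  rcases eq_or_ne j i with rfl | hj
  · rw [Function.update_self, hq]
  · rw [Function.update_of_ne hj, A.act_one]

theorem finRotate_three_inv : (finRotate (3 : ℕ+) ^ ((1 : Fin 3) : ℕ))⁻¹ =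
    blockPerm (Equiv.swap (0 : Fin (2 : ℕ+)) 1) treeArity treeArity_sum rfl := by
  decide

theorem bin_act_swap_one (h : (1 : ℕ+) + 2 = 3) (v w : A.obj 2) :
    A.bin h (A.act v (Equiv.swap (0 : Fin (2 : ℕ+)) 1)) A.one w = A.tree 1 w v := by
  rw [tree, LinearMap.mk₂_apply, finRotate_three_inv]
  refine Eq.trans ?_ (A.comp_act_left treeArity treeArity_sum _ rfl v (A.treeInputs w))
  exact A.comp_congr _ _ _
    (fun i => by rcases Fin.eq_zero_or_one i with rfl | rfl <;> rfl)
    fun i => by rcases Fin.eq_zero_or_one i with rfl | rfl <;> rfl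

variable {A} {G : Set (A.obj 2)}

theorem Planar.bin {k l n : ℕ+} (h : k + l = n) {v : A.obj 2} (hv : v ∈ G) {a : A.obj k}
    {b : A.obj l} (ha : A.Planar G k a) (hb : A.Planar G l b) : A.Planar G n (A.bin h v a b) :=
  .node _ _ v _ hv fun i => by
    rcases Fin.eq_zero_or_one i with rfl | rfl
    exacts [ha, hb]

theorem Planar.eq_one_or_bin {n : ℕ+} {x : A.obj n} (hx : A.Planar G n x) :
    (n = 1 ∧ HEq x A.one) ∨ ∃ (k l : ℕ+) (h : k + l = n) (v : A.obj 2) (a : A.obj k) (b : A.obj l),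
      v ∈ G ∧ A.Planar G k a ∧ A.Planar G l b ∧ x = A.bin h v a b := by
  cases hx with
  | one => exact .inl ⟨rfl, HEq.rfl⟩
  | node m h v x hv hx =>
    exact .inr ⟨m 0, m 1, pairArity_add h, v, x 0, x 1, hv, hx 0, hx 1, A.comp_eq_bin m h v x⟩

theorem exists_planar {v : A.obj 2} (hv : v ∈ G) (n : ℕ+) : ∃ x, A.Planar G n x := by
  induction n using PNat.recOn with
  | one => exact ⟨_, .one⟩
  | succ n ih =>
    obtain ⟨x, hx⟩ := ih
    exact ⟨_, hx.bin rfl hv .one⟩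

/-- If an operation is commutative and associative, all its planar monomials of the same arity
agree, and they are invariant under permutations of the inputs. -/
theorem Planar.eq_and_act_eq {μ : A.obj 2}
    (hc : A.act μ (Equiv.swap (0 : Fin (2 : ℕ+)) 1) = μ)
    (ha : A.bin (n := 3) rfl μ A.one μ = A.bin (n := 3) rfl μ μ A.one) (n : ℕ+) :
    ∀ x y : A.obj n, A.Planar {μ} n x → A.Planar {μ} n y → x = y ∧ ∀ σ, A.act x σ = x := by
  induction n using PNat.strongInductionOn with
  | _ n ih =>
  have hμ := Set.mem_singleton μ
  have assoc : ∀ {k l m r s : ℕ+} (h1 : k + l = r) (h2 : r + m = n) (h3 : l + m = s)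
      (h4 : k + s = n) (a : A.obj k) (b : A.obj l) (c : A.obj m),
      A.bin h2 μ (A.bin h1 μ a b) c = A.bin h4 μ a (A.bin h3 μ b c) := by
    intro k l m r s h1 h2 h3 h4 a b c
    rw [A.bin_bin_left h1 h2 (by rw [h1, h2]), A.bin_bin_right h3 h4 (by rw [h1, h2]), ha]
  have lt_left : ∀ {k l : ℕ+}, k + l = n → k < n := fun {k l} h => h ▸ PNat.lt_add_right k l
  have lt_right : ∀ {k l : ℕ+}, k + l = n → l < n := fun {k l} h => h ▸ PNat.lt_add_left l k
  have of_lt : ∀ {k l k' l' : ℕ+} (h : k + l = n) (h' : k' + l' = n) (a : A.obj k) (b : A.obj l)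
      (a' : A.obj k') (b' : A.obj l'), A.Planar {μ} k a → A.Planar {μ} l b → A.Planar {μ} k' a' →
      A.Planar {μ} l' b' → k < k' → A.bin h μ a b = A.bin h' μ a' b' := by
    intro k l k' l' h h' a b a' b' pa pb pa' pb' hk
    obtain ⟨d, rfl⟩ : ∃ d, k' = k + d := ⟨k' - k, (PNat.add_sub_of_lt hk).symm⟩
    obtain rfl : l = d + l' := add_left_cancel (h.trans (by rw [← h', add_assoc]))
    obtain ⟨δ, pδ⟩ := exists_planar hμ d
    rw [(ih _ (lt_left h') a' (A.bin rfl μ a δ) pa' (pa.bin rfl hμ pδ)).1,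
      (ih _ (lt_right h) b (A.bin rfl μ δ b') pb (pδ.bin rfl hμ pb')).1, assoc]
  have eq : ∀ x y : A.obj n, A.Planar {μ} n x → A.Planar {μ} n y → x = y := by
    intro x y hx hy
    rcases hx.eq_one_or_bin with ⟨rfl, hx⟩ | ⟨k, l, h, _, a, b, rfl, pa, pb, rfl⟩
    · rcases hy.eq_one_or_bin with ⟨_, hy⟩ | ⟨k, l, h, _⟩
      · exact eq_of_heq (hx.trans hy.symm)
      · exact (not_lt_one (lt_left h)).elim
    · rcases hy.eq_one_or_bin with ⟨rfl, hy⟩ | ⟨k', l', h', _, a', b', rfl, pa', pb', rfl⟩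
      · exact (not_lt_one (lt_left h)).elim
      · rcases lt_trichotomy k k' with hk | rfl | hk
        · exact of_lt h h' a b a' b' pa pb pa' pb' hk
        · obtain rfl : l = l' := add_left_cancel (h.trans h'.symm)
          rw [(ih _ (lt_left h) a a' pa pa').1, (ih _ (lt_right h) b b' pb pb').1]
        · exact (of_lt h' h a' b' a b pa' pb' pa pb hk).symm
  refine fun x y hx hy => ⟨eq x y hx hy, fun σ => ?_⟩
  have swap_left : ∀ i j : Fin n, (i : ℕ) + 1 < n → (j : ℕ) + 1 < n →
      A.act x (Equiv.swap i j) = x := by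
    intro i j hi hj
    obtain ⟨k, hk⟩ := PNat.exists_eq_succ_of_ne_one (n := n) (by rintro rfl; simp at hi)
    replace hk := hk.symm
    have hk' : (k : ℕ) + 1 = n := congrArg PNat.val hk
    obtain ⟨c, pc⟩ := exists_planar hμ k
    obtain rfl := eq x _ hx (pc.bin hk hμ .one)
    have hi' : i = blockEquiv (pairArity k 1) (pairArity_sum hk) ⟨0, (⟨i, by omega⟩ : Fin k)⟩ :=
      Fin.ext (blockEquiv_pair_zero hk ⟨i, by omega⟩).symm
    have hj' : j = blockEquiv (pairArity k 1) (pairArity_sum hk) ⟨0, (⟨j, by omega⟩ : Fin k)⟩ :=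
      Fin.ext (blockEquiv_pair_zero hk ⟨j, by omega⟩).symm
    rw [hi', hj']
    exact A.act_comp_swap _ _ _ _ 0 _ _ ((ih k (lt_left hk) c c pc pc).2 _)
  have swap_right : ∀ i j : Fin n, 0 < (i : ℕ) → 0 < (j : ℕ) → A.act x (Equiv.swap i j) = x := by
    intro i j hi hj
    have hn := i.2
    obtain ⟨k, hk⟩ := PNat.exists_eq_succ_of_ne_one (n := n)
      (by rintro rfl; exact hi.ne' (Nat.lt_one_iff.1 hn))
    replace hk : 1 + k = n := (add_comm _ _).trans hk.symm
    have hk' : 1 + (k : ℕ) = n := congrArg PNat.val hk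
    obtain ⟨c, pc⟩ := exists_planar hμ k
    obtain rfl := eq x _ hx (Planar.bin hk hμ .one pc)
    have hi' : i = blockEquiv (pairArity 1 k) (pairArity_sum hk)
        ⟨1, (⟨i - 1, by omega⟩ : Fin k)⟩ :=
      Fin.ext ((blockEquiv_pair_one hk ⟨i - 1, by omega⟩).trans (by simp; omega)).symm
    have hj' : j = blockEquiv (pairArity 1 k) (pairArity_sum hk)
        ⟨1, (⟨j - 1, by omega⟩ : Fin k)⟩ :=
      Fin.ext ((blockEquiv_pair_one hk ⟨j - 1, by omega⟩).trans (by simp; omega)).symm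
    rw [hi', hj']
    exact A.act_comp_swap _ _ _ _ 1 _ _ ((ih k (lt_right hk) c c pc pc).2 _)
  have swap_ends : ∀ i j : Fin n, (i : ℕ) = 0 → (j : ℕ) + 1 = n → i ≠ j →
      A.act x (Equiv.swap i j) = x := by
    intro i j hi hj hij
    have hij' : (i : ℕ) ≠ j := fun h => hij (Fin.ext h)
    by_cases hn : (n : ℕ) = 2
    · obtain rfl : n = 2 := PNat.coe_injective hn
      have h2 : ∑ _ : Fin (2 : ℕ+), ((1 : ℕ+) : ℕ) = (2 : ℕ+) := rfl
      have h1 := Planar.node (fun _ => 1) h2 μ (fun _ => A.one) hμ fun _ => .one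
      rw [A.comp_one] at h1
      obtain rfl := eq x μ hx h1
      obtain rfl : i = 0 := Fin.ext hi
      obtain rfl : j = 1 := Fin.ext (by change (j : ℕ) = 1; omega)
      exact hc
    · let o : Fin n := ⟨1, by omega⟩
      have ho : o ≠ i := fun h => by have := congrArg Fin.val h; simp [o] at this; omega
      have ho' : o ≠ j := fun h => by have := congrArg Fin.val h; simp [o] at this; omega
      rw [Equiv.swap_comm, ← Equiv.swap_mul_swap_mul_swap ho.symm hij, A.act_mul, A.act_mul]
      have h1 : A.act x (Equiv.swap o j) = x := swap_right o j (by simp [o]) (by omega)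
      have h2 : A.act x (Equiv.swap i o) = x := swap_left i o (by omega) (by simp [o]; omega)
      rw [h1, h2, h1]
  have swap : ∀ i j : Fin n, i ≠ j → A.act x (Equiv.swap i j) = x := by
    intro i j hij
    have := i.2
    have := j.2
    by_cases h1 : (i : ℕ) + 1 < n ∧ (j : ℕ) + 1 < n
    · exact swap_left i j h1.1 h1.2
    by_cases h2 : 0 < (i : ℕ) ∧ 0 < (j : ℕ)
    · exact swap_right i j h2.1 h2.2
    have hij' : (i : ℕ) ≠ j := fun h => hij (Fin.ext h)
    by_cases h3 : (i : ℕ) = 0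
    · exact swap_ends i j h3 (by omega) hij
    · rw [Equiv.swap_comm]
      exact swap_ends j i (by omega) (by omega) hij.symm
  induction σ using Equiv.Perm.swap_induction_on with
  | one => exact A.act_one x
  | swap_mul f i j hij hf => rw [A.act_mul, swap i j hij, hf]

end AlgOperad

/-- The composite of two isomorphisms. -/
def AlgOperad.Iso.trans {K : Type w} [Field K] {A : AlgOperad.{u} K} {B C : AlgOperad.{v} K}
    (F : A.Iso B) (G : B.Iso C) : A.Iso C where
  toEquiv n := (F.toEquiv n).trans (G.toEquiv n)
  map_one := (congrArg _ F.map_one).trans G.map_one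
  map_act x σ := (congrArg _ (F.map_act x σ)).trans (G.map_act _ σ)
  map_comp m h p q := (congrArg _ (F.map_comp m h p q)).trans (G.map_comp m h _ _)

/-- The set operad `Com`, with one operation in each arity. -/
def comSetOperad : SetOperad.{0} where
  obj _ := Unit
  act _ _ := ()
  one := ()
  comp _ _ _ _ := ()
  act_one _ := rfl
  act_mul _ _ _ := rfl
  one_comp _ _ := rfl
  comp_one _ _ := rfl
  comp_assoc _ _ _ _ _ _ _ _ _ _ := rfl
  comp_act_left _ _ _ _ _ _ := rfl
  comp_act_right _ _ _ _ _ := rfl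

section com

open BinaryQuadratic

variable (K : Type u) [Field K]

theorem sum_treeMap_comRel {A : AlgOperad.{w} K} (f : (comPresentation K).V →ₗ[K] A.obj 2)
    (d : Fin 3) :
    ∑ c, treeMap A f f c (comRel K 0 d c) =
      A.tree 0 (f (comProduct K)) (f (comProduct K)) -
        A.tree d (f (comProduct K)) (f (comProduct K)) := by
  have h : ∀ c, treeMap A f f c (comRel K 0 d c) =
      treeMap A f f c ((Pi.single 0 (comProduct K ⊗ₜ comProduct K) : Fin 3 → _) c) -
      treeMap A f f c ((Pi.single d (comProduct K ⊗ₜ comProduct K) : Fin 3 → _) c) :=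
    fun c => LinearMap.map_sub _ _ _
  rw [Finset.sum_congr rfl fun c _ => h c, Finset.sum_sub_distrib, sum_treeMap_single,
    sum_treeMap_single]
  rfl

/-- The product of the operad `Com`. -/
def comMul : (comPresentation K).operad.obj 2 := (comPresentation K).gen (comProduct K)

theorem comMul_comm : (comPresentation K).operad.act (comMul K)
    (Equiv.swap (0 : Fin (2 : ℕ+)) 1) = comMul K :=
  (comPresentation K).act_gen _

theorem comMul_assoc :
    (comPresentation K).operad.bin (n := 3) rfl (comMul K) (comPresentation K).operad.one
      (comMul K) = (comPresentation K).operad.bin (n := 3) rfl (comMul K) (comMul K)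
        (comPresentation K).operad.one := by
  have h := (sum_treeMap_comRel K (comPresentation K).gen 1).symm.trans
    ((comPresentation K).rel_eq_zero (.inl rfl))
  have h1 := (comPresentation K).operad.bin_act_swap_one rfl (comMul K) (comMul K)
  rw [comMul_comm] at h1
  rw [h1, ← AlgOperad.tree_zero]
  exact (sub_eq_zero.1 h).symm

theorem com_gen_mem_span (v : K) :
    (comPresentation K).gen v ∈ Submodule.span K {comMul K} := by
  have h : (v : (comPresentation K).V) = v • (comProduct K : (comPresentation K).V) := (mul_one (M := K) v).symm
  rw [h, map_smul]
  exact Submodule.smul_mem _ _ (Submodule.subset_span rfl)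

theorem com_planarSpan (n : ℕ+) {x : (comPresentation K).operad.obj n}
    (hx : (comPresentation K).operad.Planar {comMul K} n x) : Submodule.span K {x} = ⊤ := by
  rw [eq_top_iff, ← (comPresentation K).planarSpan_eq_top _ (com_gen_mem_span K) n]
  refine Submodule.span_le.2 ?_
  rintro _ ⟨a, σ, ha, rfl⟩
  have h := AlgOperad.Planar.eq_and_act_eq (comMul_comm K) (comMul_assoc K) n a x ha hx
  rw [h.2, h.1]
  exact Submodule.subset_span rfl

/-- The operation of arity `n` of `⟨Com⟩`. -/
def comUnit (n : ℕ+) : (comSetOperad.linearization K).obj n :=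
  (Finsupp.single () 1 : Unit →₀ K)

theorem comUnit_comp {k n : ℕ+} (m : Fin k → ℕ+) (h : ∑ i, (m i : ℕ) = n) :
    (comSetOperad.linearization K).comp m h (comUnit K k) (fun i => comUnit K (m i)) =
      comUnit K n :=
  linComp_single (comSetOperad.comp m h) () fun _ => ()

theorem comUnit_act {n : ℕ+} (σ : Equiv.Perm (Fin n)) :
    (comSetOperad.linearization K).act (comUnit K n) σ = comUnit K n :=
  Finsupp.mapDomain_single

theorem comUnit_tree (c : Fin 3) :
    (comSetOperad.linearization K).tree c (comUnit K 2) (comUnit K 2) = comUnit K 3 := by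
  have h : (comSetOperad.linearization K).treeInputs (comUnit K 2) =
      fun i => comUnit K (treeArity i) := by
    funext i
    rcases Fin.eq_zero_or_one i with rfl | rfl <;> rfl
  rw [AlgOperad.tree, LinearMap.mk₂_apply, h, comUnit_comp, comUnit_act]

theorem exists_eq_smul_comUnit {n : ℕ+} (y : (comSetOperad.linearization K).obj n) :
    ∃ c : K, y = c • comUnit K n :=
  ⟨DFunLike.coe (F := Unit →₀ K) y (), Finsupp.ext fun _ => by
    refine (mul_one _).symm.trans (congrArg (_ * ·) ?_)
    exact Finsupp.single_eq_same.symm⟩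

theorem smul_comUnit_eq_zero {n : ℕ+} {c : K} (h : c • comUnit K n = 0) : c = 0 := by
  have h' : (c • (Finsupp.single () 1 : Unit →₀ K)) () = 0 :=
    DFunLike.congr_fun (F := Unit →₀ K) h ()
  simpa using h'

/-- The canonical morphism from the operad `Com` to `⟨Com⟩`. -/
def comHom : (comPresentation K).operad.Hom (comSetOperad.linearization K) :=
  (comPresentation K).lift _ (Finsupp.lsingle () : K →ₗ[K] Unit →₀ K)
    (fun _ => Finsupp.mapDomain_single)
    (fun r hr => by
      rcases hr with rfl | rfl
      all_goals
        refine (sum_treeMap_comRel K _ _).trans ?_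
        exact sub_eq_zero.2 ((comUnit_tree K _).trans (comUnit_tree K _).symm))

theorem comHom_planar {n : ℕ+} {x : (comPresentation K).operad.obj n}
    (hx : (comPresentation K).operad.Planar {comMul K} n x) :
    (comHom K).app n x = comUnit K n := by
  induction hx with
  | one => exact (comHom K).map_one
  | node m h v x hv _ ih =>
    obtain rfl := hv
    rw [AlgOperad.Hom.map_comp, funext ih]
    exact comUnit_comp K m h

theorem comHom_bijective (n : ℕ+) : Function.Bijective ((comHom K).app n) := by
  obtain ⟨x, hx⟩ := AlgOperad.exists_planar (G := {comMul K}) (Set.mem_singleton _) n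
  have hx' := comHom_planar K hx
  constructor
  · rw [← LinearMap.ker_eq_bot, LinearMap.ker_eq_bot']
    intro y hy
    obtain ⟨c, rfl⟩ := Submodule.mem_span_singleton.1
      ((com_planarSpan K n hx).symm ▸ Submodule.mem_top : y ∈ Submodule.span K {x})
    rw [map_smul, hx'] at hy
    rw [smul_comUnit_eq_zero K hy, zero_smul]
  · intro y
    obtain ⟨c, rfl⟩ := exists_eq_smul_comUnit K y
    exact ⟨c • x, by rw [map_smul, hx']⟩

/-- The operad `Com` is the linearization of the set operad `Com`. -/
def comIso : (comPresentation K).operad.Iso (comSetOperad.linearization K) :=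
  (comHom K).toIso (comHom_bijective K)

/-- `Com ×_H ᵗᶜCom` is `ᵗᶜCom`. -/
def comHadamardIso : ((comSetOperad.hadamard tcCom).linearization K).Iso
    (tcCom.linearization K) where
  toEquiv n := Finsupp.domLCongr (Equiv.punitProd (Fin n))
  map_one := Finsupp.equivMapDomain_single _ _ _
  map_act {n} x σ := by
    have h : ∀ y : Unit × Fin n →₀ K, Finsupp.domLCongr (R := K) (Equiv.punitProd (Fin n)) y =
        y.mapDomain Prod.snd := fun y => Finsupp.equivMapDomain_eq_mapDomain _ _
    refine (h _).trans (Finsupp.mapDomain_comp.symm.trans ?_)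
    refine (Eq.trans ?_ Finsupp.mapDomain_comp).trans (congrArg _ (h _).symm)
    rfl
  map_comp {k n} m hm p q := by
    have h : ∀ {n : ℕ} (y : Unit × Fin n →₀ K),
        Finsupp.domLCongr (R := K) (Equiv.punitProd (Fin n)) y =
        y.mapDomain Prod.snd := fun y => Finsupp.equivMapDomain_eq_mapDomain _ _
    refine (h _).trans (Eq.symm ?_)
    refine Eq.trans ?_ (linComp_mapDomain ((comSetOperad.hadamard tcCom).comp m hm)
      (tcCom.comp m hm) Prod.snd (fun _ => Prod.snd) Prod.snd (fun _ _ => rfl) p q)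
    exact congrArg₂ (linComp K (tcCom.comp m hm)) (h p) (funext fun i => h (q i))

theorem comHadamardIso_comMul (i : Fin (2 : ℕ+)) :
    (comHadamardIso K).toEquiv 2
      (Finsupp.mapDomain (fun p => (p, tcCom.D i)) ((comIso K).toEquiv 2 (comMul K))) =
      Finsupp.single (tcCom.D i) 1 :=
  (congrArg ((comHadamardIso K).toEquiv 2)
    (Finsupp.mapDomain_single (f := fun p : Unit => (p, i)))).trans
    (Finsupp.equivMapDomain_single _ _ _)

end com

/-! ## The partition posets of a Hadamard product -/

namespace SetOperad

variable {P : SetOperad.{u}} {Q : SetOperad.{v}} {n : ℕ}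

/-- A decorated partition for `P ×_H Q` is a pair of decorated partitions with the same underlying
partition. -/
def partitionEquiv : (P.hadamard Q).Partition n ≃ FiberProduct (P.proj n) (Q.proj n) where
  toFun α := ⟨(α.map fun _ => Prod.fst, α.map fun _ => Prod.snd), rfl⟩
  invFun x := ⟨x.1.1.partition, fun B =>
    (x.1.1.deco B, x.1.2.deco ⟨B.1, (congrArg Finpartition.parts x.2) ▸ B.2⟩)⟩
  left_inv _ := rfl
  right_inv := by
    rintro ⟨⟨⟨π, d⟩, ⟨π', d'⟩⟩, h⟩
    obtain rfl : π = π' := h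
    rfl

theorem partition_le_iff (α β : (P.hadamard Q).Partition n) :
    α ≤ β ↔ (α.map (fun _ => Prod.fst) : P.Partition n) ≤ β.map (fun _ => Prod.fst) ∧
      (α.map (fun _ => Prod.snd) : Q.Partition n) ≤ β.map (fun _ => Prod.snd) := by
  constructor
  · rintro ⟨h, h'⟩
    refine ⟨⟨h, fun B L => ?_⟩, ⟨h, fun B L => ?_⟩⟩ <;> obtain ⟨p, hp⟩ := h' B L
    · exact ⟨p.1, congrArg Prod.fst hp⟩
    · exact ⟨p.2, congrArg Prod.snd hp⟩
  · rintro ⟨⟨h, h1⟩, ⟨_, h2⟩⟩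
    refine ⟨h, fun B L => ?_⟩
    obtain ⟨p, hp⟩ := h1 B L
    obtain ⟨q, hq⟩ := h2 B L
    exact ⟨(p, q), Prod.ext hp hq⟩

/-- The poset of decorated partitions for `P ×_H Q` is the fiber product of those for `P` and
`Q`. -/
def partitionIso : (P.hadamard Q).Partition n ≃o FiberProduct (P.proj n) (Q.proj n) where
  toEquiv := partitionEquiv
  map_rel_iff' {α β} := (partition_le_iff α β).symm

end SetOperad
end

theorem mainTheorem8 {K : Type u} [Field K] (O : BinaryQuadratic.{u, v} K)
    (P : SetOperad.{w}) (φ : O.operad.Iso (P.linearization K)) :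
    (∃ χ : (comPresentation K).tc.operad.Iso (tcCom.linearization K),
      χ.toEquiv 2 ((comPresentation K).tc.gen (comProduct K, 0)) = Finsupp.single (tcCom.D 1) 1 ∧
      χ.toEquiv 2 ((comPresentation K).tc.gen (0, comProduct K)) = Finsupp.single (tcCom.D 0) 1) ∧
    (∃ ψ : O.tc.operad.Iso ((P.hadamard tcCom).linearization K), ∀ v : O.V,
      ψ.toEquiv 2 (O.tc.gen (v, 0)) =
        Finsupp.mapDomain (fun p => (p, tcCom.D 1)) (φ.toEquiv 2 (O.gen v)) ∧
      ψ.toEquiv 2 (O.tc.gen (0, v)) =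
        Finsupp.mapDomain (fun p => (p, tcCom.D 0)) (φ.toEquiv 2 (O.gen v))) ∧
    ∀ n : ℕ+, ∃ Ψ : (P.hadamard tcCom).Partition n ≃o FiberProduct (P.proj n) (tcCom.proj n),
      ∀ α, (Ψ α).1 = (α.map fun _ => Prod.fst, α.map fun _ => Prod.snd) := by
  refine ⟨⟨(BinaryQuadratic.tcIso (comIso K)).trans (comHadamardIso K), ?_, ?_⟩,
    ⟨BinaryQuadratic.tcIso φ, fun v => ⟨BinaryQuadratic.tcIso_white φ v,
      BinaryQuadratic.tcIso_black φ v⟩⟩, fun n => ⟨SetOperad.partitionIso, fun α => rfl⟩⟩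
  · exact (congrArg ((comHadamardIso K).toEquiv 2)
      (BinaryQuadratic.tcIso_white (comIso K) (comProduct K))).trans (comHadamardIso_comMul K 1)
  · exact (congrArg ((comHadamardIso K).toEquiv 2)
      (BinaryQuadratic.tcIso_black (comIso K) (comProduct K))).trans (comHadamardIso_comMul K 0)
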